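/- **Setting.** Let $m,n\in\mathbb Z_{>0}$ and $N=1+m+n$. Write $\mathbb H$ for the upper half-plane, $\zeta_N=e^{2\pi i/N}$, $(x;q)_\infty=\prod_{j\ge0}(1-xq^j)$, and for $1\le k<N$, $y\in\mathbb H$, $q=e^{2\pi i y}$, $$f_{k,N}(y)=\log(\zeta_N^k;q)_\infty,\qquad g_{k,N}(y)=\log(q^k;q^N)_\infty$$ (sums of principal logarithms of the factors). All sums $\sum_{k\in\{1,m,n\}}$ are counted with repetitions. "As $y\to0$ in $\mathbb H$" means uniformly in every sector $|\mathrm{Re}\,y|\le c\,\mathrm{Im}\,y$. Let $\mathrm{Tr}(\rho_{m,n})$ be the analytically continued spectral trace of the inverse $\rho_{m,n}$ of $e^{\mathsf x}+e^{\mathsf y}+e^{-m\mathsf x-n\mathsf y}$, $[\mathsf x,\mathsf y]=i\hbar$, of local $\mathbb P^{m,n}$, given for $y=N\hbar/(2\pi)\in\mathbb H$, $q=e^{2\pi i y}$, $\tilde q=e^{-2\pi i/y}$ by the closed formula $$\mathrm{Tr}(\rho_{m,n})=\frac{e^{\frac{\pi i}{12y}-\pi i y(\frac m{N^2}-\frac1{12})+\frac{\pi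 i}4}}{2\sqrt y\,\sin(\pi n/N)}\;\frac{(q^{1-m/N};q)_\infty(q^{1-1/N};q)_\infty(\zeta_N^{n};\tilde q)_\infty}{(\zeta_N^{-m};\tilde q)_\infty(\zeta_N^{-1};\tilde q)_\infty(q^{n/N};q)_\infty},$$ and let $\log\mathrm{Tr}(\rho_{m,n})$ be the branch $$\tfrac{\pi i}{12y}-\pi i y\big(\tfrac m{N^2}-\tfrac1{12}\big)+\tfrac{\pi i}4-\log\big(2\sqrt y\sin\tfrac{\pi n}N\big)+g_{N-1,N}(\tfrac yN)+g_{N-m,N}(\tfrac yN)-g_{n,N}(\tfrac yN)-f_{N-1,N}(-\tfrac1y)-f_{N-m,N}(-\tfrac1y)+f_{n,N}(-\tfrac1y).$$ Put $\tau=-1/y=-2\pi/(N\hbar)$ and define, with Bernoulli numbers $B_j$, Bernoulli polynomials $B_j(x)$ and polylogarithms $\mathrm{Li}_s$ ($\mathrm{Li}_{-s}(z)=(z\,d/dz)^s\frac z{1-z}$ for integers $s\ge0$), $$\varphi_k(y)=\sum_{j\ge1}(2\pi i y)^{2j}\frac{B_{2j}B_{2j+1}(k/N)}{2j\,(2j+1)!},\qquad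 \psi_k(y)=\sum_{j\ge1}(2\pi i y)^{2j-1}\frac{B_{2j}}{(2j)!}\mathrm{Li}_{2-2j}(\zeta_N^k),$$ $$\varphi_{m,n}(\hbar)=\big[-\varphi_{N-1}-\varphi_{N-m}+\varphi_n\big]\big(\tfrac{N\hbar}{2\pi}\big),\qquad \psi_{m,n}(\tau)=\big[-\psi_{N-1}-\psi_{N-m}+\psi_n\big](\tau).$$ For $\ell\in\mathbb Z_{\ne0}$ let $\xi_\ell=\frac{4\pi^2i}N\ell$, $\eta_\ell=\frac{2\pi i}N\ell$, and, with sums over positive divisors $d$ of $\ell$, $$S_\ell=2i\sum_{k\in\{1,m,n\}}\sum_{d\mid\ell}\frac1d\sin\frac{2\pi kd}N,\qquad R_\ell=\sum_{k\in\{1,m,n\}}\Big[\sum_{d\mid\ell,\,d\equiv k(N)}\frac d\ell-\sum_{d\mid\ell,\,d\equiv-k(N)}\frac d\ell\Big],$$ and for $y\in\mathbb H$ put $f_0(y)=\sum_{\ell\ge1}S_\ell e^{2\pi i\ell y}$, $f_\infty(y)=\sum_{\ell\ge1}R_\ell e^{2\pi i\ell y}$. For a series $\phi(y)=\sum_{j\ge0}a_jy^{j+1}$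 the Borel transform is $\mathcal B[\phi](\zeta)=\sum_j a_j\zeta^j/j!$ (and its continuation), and $\mathrm{disc}_\theta\phi(y)=\int_{e^{i\theta_+}\mathbb R_{\ge0}}-\int_{e^{i\theta_-}\mathbb R_{\ge0}}e^{-\zeta/y}\mathcal B[\phi](\zeta)\,d\zeta$, $\theta_\pm=\theta\pm\epsilon$, for all sufficiently small $\epsilon>0$ (depending on $y$). $\phi$ is Gevrey-1 if $|a_j|\le CK^jj!$ for some $C,K>0$. **Theorem (strong–weak resurgent symmetry).** For all $m,n\in\mathbb Z_{>0}$: 1. *(The series of $\log\mathrm{Tr}$.)* The above branch is a logarithm of $\mathrm{Tr}(\rho_{m,n})$. As $\hbar\to0$ in $\mathbb H$, $\log\mathrm{Tr}(\rho_{m,n})\sim\log\frac{\Gamma(n/N)\Gamma(m/N)\Gamma(1/N)}{4\pi^2}-\log y+\varphi_{m,n}(\hbar)$ with $y=\frac{N\hbar}{2\pi}$. As $\tau\to0$ in $\mathbb H$, with $y=-1/\tau$ and $\mathcal V=\mathrm{Li}_2(\zeta_N^n)-\mathrm{Li}_2(\zeta_N^{-m})-\mathrm{Li}_2(\zeta_N^{-1})$,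 $$\log\mathrm{Tr}(\rho_{m,n})\sim\tfrac{\pi i}{12y}+\pi iy\Big(\tfrac{\mathcal V}{2\pi^2}-\tfrac m{N^2}+\tfrac1{12}\Big)-\log\Big(2\sqrt{2\sin\tfrac{\pi n}N\sin\tfrac{\pi m}N\sin\tfrac\pi N}\Big)-\tfrac12\log y+\psi_{m,n}(\tau).$$ 2. *(Resurgence.)* $\varphi_{m,n}$ and $\psi_{m,n}$ are Gevrey-1. Their Borel transforms extend meromorphically to $\mathbb C$, with at most simple poles, located at the points $\xi_\ell$, respectively $\eta_\ell$, $\ell\ne0$, with Stokes constants $S_\ell$, respectively $R_\ell$: near these points they equal $-\frac{S_\ell}{2\pi i(\zeta-\xi_\ell)}$, respectively $-\frac{R_\ell}{2\pi i(\zeta-\eta_\ell)}$, plus a regular function. 3. *(Discontinuities.)* For $\hbar\in\mathbb H$, respectively $\tau\in\mathbb H$, with absolutely convergent series, $$\mathrm{disc}_{\frac\pi2}\varphi_{m,n}(\hbar)=\sum_{\ell\ge1}S_\ell e^{-\xi_\ell/\hbar}=f_0\big(-\tfrac{2\pi}{N\hbar}\big)=\sum_{k\in\{1,m,n\}}\big[f_{N-k,N}-f_{k,N}\big]\big(-\tfrac{2\pi}{N\hbar}\big)-\pi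 i,$$ $$\mathrm{disc}_{\frac\pi2}\psi_{m,n}(\tau)=\sum_{\ell\ge1}R_\ell e^{-\eta_\ell/\tau}=f_\infty\big(-\tfrac1{N\tau}\big)=\sum_{k\in\{1,m,n\}}\big[g_{N-k,N}-g_{k,N}\big]\big(-\tfrac1{N\tau}\big).$$ 4. *(Each discontinuity expands to the dual series.)* As $\hbar\to0$ in $\mathbb H$, the discontinuity of $\psi_{m,n}$ at $\tau=-\frac{2\pi}{N\hbar}$ satisfies $$f_\infty\big(\tfrac{\hbar}{2\pi}\big)\sim-\log(-iN\hbar)+\sum_{k\in\{1,m,n\}}\log\frac{\Gamma(k/N)}{\Gamma(1-k/N)}+2\varphi_{m,n}(\hbar),$$ and as $\tau\to0$ in $\mathbb H$, the discontinuity of $\varphi_{m,n}$ at $\hbar=-\frac{2\pi}{N\tau}$ satisfies $$f_0(\tau)\sim-\frac{\pi i}2-\frac1{\pi\tau}\sum_{k\in\{1,m,n\}}\mathrm{Im}\,\mathrm{Li}_2(\zeta_N^k)-2\psi_{m,n}(\tau)+\frac{\pi i\tau}6 .$$ The discontinuities at angle $\frac\pi2$ of the power series in these two expansions are $\mathrm{disc}_{\frac\pi2}[2\varphi_{m,n}](\hbar)=2f_0(-\frac{2\pi}{N\hbar})$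 and $\mathrm{disc}_{\frac\pi2}[-2\psi_{m,n}+\frac{\pi i\tau}6](\tau)=-2f_\infty(-\frac1{N\tau})$; that is, the discontinuity of the expansion of each generating function is, up to the factor $\pm2$, the other one. 5. *(Mellin transforms.)* The following integrals converge absolutely and $$\int_0^\infty t^{j-1}f_0(it)\,dt=\frac{\Gamma(j)}{(2\pi)^j}\sum_{\ell\ge1}\frac{S_\ell}{\ell^j}\ (j\ge2),\qquad \int_0^\infty t^{j-1}f_\infty(it)\,dt=\frac{\Gamma(j)}{(2\pi)^j}\sum_{\ell\ge1}\frac{R_\ell}{\ell^j}\ (j\ge1),$$ the first series absolutely convergent, the second convergent in the natural order. 6. *(Exact large-order relations.)* Only even powers of $\hbar$ occur in $\varphi_{m,n}$, and only odd powers of $\tau$ in $\psi_{m,n}$. For $j\ge1$, with series summed as in 5, $$[\hbar^{2j}]\,\varphi_{m,n}=\frac{\Gamma(2j)}{\pi i}\sum_{\ell\ge1}\frac{S_\ell}{\xi_\ell^{2j}},\qquad [\tau^{2j-1}]\,\psi_{m,n}=\frac{\Gamma(2j-1)}{\pi i}\sum_{\ell\ge1}\frac{R_\ell}{\eta_\ell^{2j-1}}+\frac{\pi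 i}{12}\delta_{j,1}.$$ 7. *(The discontinuities determine the series.)* For $j\ge1$, $$[\hbar^{2j}]\,\varphi_{m,n}=\frac1{\pi i}\Big(\frac N{2\pi i}\Big)^{2j}\int_0^\infty t^{2j-1}f_0(it)\,dt,\qquad [\tau^{2j-1}]\,\psi_{m,n}=\frac1{\pi i}\Big(\frac Ni\Big)^{2j-1}\int_0^\infty t^{2j-2}f_\infty(it)\,dt+\frac{\pi i}{12}\delta_{j,1}.$$ Thus the diagram $\psi_{m,n}\leftrightarrow\mathrm{disc}_{\frac\pi2}\psi_{m,n}\to\varphi_{m,n}\leftrightarrow\mathrm{disc}_{\frac\pi2}\varphi_{m,n}\to\psi_{m,n}$, whose double arrows are 3 and 7 and whose single arrows are the expansions 4, commutes, up to the stated elementary terms and factors $\pm2$. -/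

import Mathlib

open Filter Topology MeasureTheory

namespace StrongWeak

noncomputable section

/-! ### Formal power series, Borel transforms, Laplace transforms, discontinuities -/

/-- A series `∑ aₙ y ^ (n + 1)` without constant term is Gevrey-1 when `|aₙ| ≤ C Kⁿ n!`. -/
def IsGevreyOne (φ : PowerSeries ℂ) : Prop :=
  PowerSeries.coeff 0 φ = 0 ∧
    ∃ C K : ℝ, 0 < C ∧ 0 < K ∧
      ∀ n : ℕ, ‖PowerSeries.coeff (n + 1) φ‖ ≤ C * K ^ n * (n.factorial : ℝ)

/-- The formal Borel transform `∑ aₙ y ^ (n + 1) ↦ ∑ aₙ ζ ^ n / n!`. -/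
def borel (φ : PowerSeries ℂ) : PowerSeries ℂ :=
  PowerSeries.mk fun n => PowerSeries.coeff (n + 1) φ / (n.factorial : ℂ)

/-- `B` is a single-valued analytic continuation of the Borel transform of `φ` to the complement
of the locally finite set `Ω`. Off `Ω` the function `B` is determined by `φ`, since `Ωᶜ` is
connected; the values of `B` on `Ω` are irrelevant. -/
structure IsBorelContinuation (φ : PowerSeries ℂ) (Ω : Set ℂ) (B : ℂ → ℂ) : Prop where
  zero_notMem : (0 : ℂ) ∉ Ω
  locallyFinite : ∀ r : ℝ, (Ω ∩ Metric.closedBall 0 r).Finite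
  analytic : AnalyticOnNhd ℂ B Ωᶜ
  germ : ∀ᶠ ζ in 𝓝 (0 : ℂ), HasSum (fun n : ℕ => PowerSeries.coeff n (borel φ) * ζ ^ n) (B ζ)

/-- The resurgent structure of `φ`: its Borel transform extends to a meromorphic function on `ℂ`
whose only singularities are (at most) simple poles at the points `ρ l`, `l ≠ 0`, and
`B ζ = - S l / (2 π i (ζ - ρ l)) + regular` near `ρ l`, so that `S l` is the Stokes constant
at `ρ l`. -/
def HasStokesTower (φ : PowerSeries ℂ) (ρ : ℤ → ℂ) (S : ℤ → ℂ) : Prop :=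
  ∃ B : ℂ → ℂ, IsBorelContinuation φ {z | ∃ l : ℤ, l ≠ 0 ∧ z = ρ l} B ∧
    ∀ l : ℤ, l ≠ 0 → ∃ h : ℂ → ℂ, AnalyticAt ℂ h (ρ l) ∧
      ∀ᶠ ζ in 𝓝[≠] (ρ l), B ζ = -S l / (2 * Real.pi * Complex.I * (ζ - ρ l)) + h ζ

/-- The integrand, in the arc length `r`, of the Laplace transform of `B` along the ray of
angle `θ`. -/
def laplaceIntegrand (B : ℂ → ℂ) (θ : ℝ) (y : ℂ) (r : ℝ) : ℂ :=
  Complex.exp (-(r * Complex.exp (θ * Complex.I)) / y) * B (r * Complex.exp (θ * Complex.I)) *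
    Complex.exp (θ * Complex.I)

/-- `∫ exp (-ζ / y) B(ζ) dζ` along the ray of angle `θ`. -/
def laplaceRay (B : ℂ → ℂ) (θ : ℝ) (y : ℂ) : ℂ :=
  ∫ r in Set.Ioi (0 : ℝ), laplaceIntegrand B θ y r

/-- The Borel--Laplace sum of `φ` along the ray of angle `θ` exists at `y` and equals `v`. -/
def HasBorelLaplaceSum (φ : PowerSeries ℂ) (θ : ℝ) (y v : ℂ) : Prop :=
  ∃ (Ω : Set ℂ) (B : ℂ → ℂ), IsBorelContinuation φ Ω B ∧
    (∀ r : ℝ, 0 < r → (r * Complex.exp (θ * Complex.I) : ℂ) ∉ Ω) ∧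
    0 < (Complex.exp (-(θ * Complex.I)) * y).re ∧
    IntegrableOn (laplaceIntegrand B θ y) (Set.Ioi 0) ∧
    laplaceRay B θ y = v

/-- The discontinuity of `φ` across the ray of angle `θ` exists at `y` and equals `v`:
for all sufficiently small `ε > 0` the lateral Borel--Laplace sums at the angles `θ + ε` and
`θ - ε` exist at `y`, and the first minus the second is `v`. -/
def HasDiscontinuity (φ : PowerSeries ℂ) (θ : ℝ) (y v : ℂ) : Prop :=
  ∀ᶠ ε in 𝓝[>] (0 : ℝ), ∃ vPlus vMinus : ℂ,
    HasBorelLaplaceSum φ (θ + ε) y vPlus ∧ HasBorelLaplaceSum φ (θ - ε) y vMinus ∧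
      vPlus - vMinus = v

/-- `h` has the asymptotic expansion `a` as `y → 0` in the upper half-plane, uniformly in each
closed subsector `|Re y| ≤ c Im y`. -/
def HasAsymptoticExpansion (h : ℂ → ℂ) (a : PowerSeries ℂ) : Prop :=
  ∀ c : ℝ, 0 < c → ∀ M : ℕ,
    (fun y : ℂ => h y - ∑ i ∈ Finset.range M, PowerSeries.coeff i a * y ^ i)
      =O[𝓝[{y : ℂ | 0 < y.im ∧ |y.re| ≤ c * y.im}] 0] (fun y : ℂ => y ^ M)

/-! ### `q`-Pochhammer symbols and the spectral trace -/

/-- `(x; q)_∞`. -/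
def qPoch (x q : ℂ) : ℂ := ∏' j : ℕ, (1 - x * q ^ j)

/-- `ζ_N ^ k = exp (2 π i k / N)`. -/
def rootPow (N k : ℕ) : ℂ := Complex.exp (2 * Real.pi * Complex.I * k / N)

/-- `f_{k,N}(y) = log (ζ_N ^ k; q)_∞` with `q = exp (2 π i y)`, the logarithm being the sum of
the principal logarithms of the factors. -/
def fPoch (k N : ℕ) (y : ℂ) : ℂ :=
  ∑' j : ℕ, Complex.log (1 - rootPow N k * Complex.exp (2 * Real.pi * Complex.I * y) ^ j)

/-- `g_{k,N}(y) = log (q ^ k; q ^ N)_∞` with `q = exp (2 π i y)`, the logarithm being the sum of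
the principal logarithms of the factors. -/
def gPoch (k N : ℕ) (y : ℂ) : ℂ :=
  ∑' j : ℕ, Complex.log (1 - Complex.exp (2 * Real.pi * Complex.I * y) ^ (k + j * N))

/-- The closed form of the analytically continued spectral trace `Tr ρ_{m,n}` of local
`ℙ^{m,n}` for `Im y > 0`, where `N = 1 + m + n` and `2 π y = N ħ`. -/
def specTrace (m n : ℕ) (y : ℂ) : ℂ :=
  let N : ℕ := 1 + m + n
  let q : ℂ := Complex.exp (2 * Real.pi * Complex.I * y)
  let q' : ℂ := Complex.exp (-(2 * Real.pi * Complex.I / y))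
  let qpow : ℂ → ℂ := fun s => Complex.exp (2 * Real.pi * Complex.I * y * s)
  let root : ℤ → ℂ := fun k => Complex.exp (2 * Real.pi * Complex.I * k / N)
  Complex.exp (Real.pi * Complex.I / (12 * y)
        - Real.pi * Complex.I * y * ((m : ℂ) / (N : ℂ) ^ 2 - 1 / 12) + Real.pi * Complex.I / 4)
      / (2 * y ^ (1 / 2 : ℂ) * (Real.sin (Real.pi * n / N) : ℂ))
    * (qPoch (qpow (1 - m / N)) q * qPoch (qpow (1 - 1 / N)) q * qPoch (root n) q')
    / (qPoch (root (-m)) q' * qPoch (root (-1)) q' * qPoch (qpow (n / N)) q)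

/-- The sum of `q`-Pochhammer symbols `𝒵_{1,m,n}(y)`. -/
def zSum (m n : ℕ) (y : ℂ) : ℂ :=
  let N : ℕ := 1 + m + n
  gPoch (N - 1) N (y / N) + gPoch (N - m) N (y / N) - gPoch n N (y / N)
    - fPoch (N - 1) N (-1 / y) - fPoch (N - m) N (-1 / y) + fPoch n N (-1 / y)

/-- The branch of `log Tr ρ_{m,n}` for `Im y > 0`. -/
def logSpecTrace (m n : ℕ) (y : ℂ) : ℂ :=
  let N : ℕ := 1 + m + n
  Real.pi * Complex.I / (12 * y)
    - Real.pi * Complex.I * y * ((m : ℂ) / (N : ℂ) ^ 2 - 1 / 12) + Real.pi * Complex.I / 4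
    - Complex.log (2 * y ^ (1 / 2 : ℂ) * (Real.sin (Real.pi * n / N) : ℂ))
    + zSum m n y

/-! ### The perturbative series -/

/-- `Li₂(z) = ∑_{j ≥ 1} z ^ j / j ^ 2` for `|z| ≤ 1`. -/
def dilog (z : ℂ) : ℂ := ∑' j : ℕ, z ^ (j + 1) / ((j : ℂ) + 1) ^ 2

/-- `Li_{-s}(z)`, the rational function `(z d/dz) ^ s (z / (1 - z))`. -/
def polylogNeg : ℕ → ℂ → ℂ
  | 0 => fun z => z / (1 - z)
  | s + 1 => fun z => z * deriv (polylogNeg s) z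

/-- `ψ_k(y) = ∑_{j ≥ 1} (2 π i y) ^ (2 j - 1) (B_{2 j} / (2 j)!) Li_{2 - 2 j}(ζ_N ^ k)`. -/
def psiSeries (k N : ℕ) : PowerSeries ℂ :=
  PowerSeries.mk fun i =>
    if Odd i then
      (2 * Real.pi * Complex.I) ^ i * ((bernoulli (i + 1) : ℚ) : ℂ) / ((i + 1).factorial : ℂ)
        * polylogNeg (i - 1) (rootPow N k)
    else 0

/-- `φ_k(y) = ∑_{j ≥ 1} (2 π i y) ^ (2 j) B_{2 j} B_{2 j + 1}(k / N) / (2 j (2 j + 1)!)`. -/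
def phiSeries (k N : ℕ) : PowerSeries ℂ :=
  PowerSeries.mk fun i =>
    if Even i ∧ i ≠ 0 then
      (2 * Real.pi * Complex.I) ^ i * ((bernoulli i : ℚ) : ℂ)
        * (((Polynomial.bernoulli (i + 1)).eval ((k : ℚ) / (N : ℚ)) : ℚ) : ℂ)
        / ((i : ℂ) * ((i + 1).factorial : ℂ))
    else 0

/-- The weak-coupling series `φ_{m,n}(ħ)`. -/
def phiTrace (m n : ℕ) : PowerSeries ℂ :=
  let N : ℕ := 1 + m + n
  PowerSeries.rescale ((N : ℂ) / (2 * Real.pi))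
    (-phiSeries (N - 1) N - phiSeries (N - m) N + phiSeries n N)

/-- The strong-coupling series `ψ_{m,n}(τ)`. -/
def psiTrace (m n : ℕ) : PowerSeries ℂ :=
  let N : ℕ := 1 + m + n
  (-psiSeries (N - 1) N - psiSeries (N - m) N + psiSeries n N)

/-! ### Stokes constants and their generating functions -/

/-- `∑_{k ∈ {1, m, n}} F k`, with repetitions. -/
def weightSum (m n : ℕ) (F : ℕ → ℂ) : ℂ := F 1 + F m + F n

/-- `ξ_l = 4 π² i l / N`. -/
def xiPole (m n : ℕ) (l : ℤ) : ℂ :=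
  4 * (Real.pi : ℂ) ^ 2 * Complex.I / ((1 + m + n : ℕ) : ℂ) * l

/-- `η_l = 2 π i l / N`. -/
def etaPole (m n : ℕ) (l : ℤ) : ℂ :=
  2 * (Real.pi : ℂ) * Complex.I / ((1 + m + n : ℕ) : ℂ) * l

/-- `S_l^{m,n} = 2 i ∑_{k ∈ {1,m,n}} ∑_{d ∣ l} sin (2 π k d / N) / d`. -/
def stokesS (m n : ℕ) (l : ℤ) : ℂ :=
  2 * Complex.I * weightSum m n fun k =>
    ∑ d ∈ l.natAbs.divisors,
      (1 / (d : ℂ)) * (Real.sin (2 * Real.pi * k * d / ((1 + m + n : ℕ) : ℝ)) : ℂ)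

/-- `R_l^{m,n} = ∑_{k ∈ {1,m,n}} (∑_{d ∣ l, d ≡ k (N)} d / l - ∑_{d ∣ l, d ≡ -k (N)} d / l)`,
the sums running over the positive divisors of `l`. -/
def stokesR (m n : ℕ) (l : ℤ) : ℂ :=
  weightSum m n fun k =>
    ∑ d ∈ l.natAbs.divisors,
      ((if Int.ModEq ((1 + m + n : ℕ) : ℤ) (d : ℤ) (k : ℤ) then (d : ℂ) / (l : ℂ) else 0)
        - if Int.ModEq ((1 + m + n : ℕ) : ℤ) (d : ℤ) (-(k : ℤ)) then (d : ℂ) / (l : ℂ) else 0)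

/-- The generating function on `ℂ ∖ ℝ` of a sequence `A l`, `l ≠ 0`: `∑_{l > 0} A l exp (2 π i l y)`
in the upper and `- ∑_{l < 0} A l exp (2 π i l y)` in the lower half-plane (and `0` on the real
axis, which is outside the domain). -/
def genFun (A : ℤ → ℂ) (y : ℂ) : ℂ :=
  if 0 < y.im then
    ∑' l : ℕ, A ((l : ℤ) + 1) * Complex.exp (2 * Real.pi * Complex.I * ((l : ℂ) + 1) * y)
  else if y.im < 0 then
    -∑' l : ℕ, A (-((l : ℤ) + 1)) * Complex.exp (-(2 * Real.pi * Complex.I * ((l : ℂ) + 1) * y))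
  else 0

/-- `f_0^{m,n}`, the generating function of the weak-coupling Stokes constants. -/
def fZero (m n : ℕ) : ℂ → ℂ := genFun (stokesS m n)

/-- `f_∞^{m,n}`, the generating function of the strong-coupling Stokes constants. -/
def fInf (m n : ℕ) : ℂ → ℂ := genFun (stokesR m n)

end

end StrongWeak

open StrongWeak

namespace StrongWeak

/-! ### Rotation of rays -/

section Rays

variable {G : ℂ → ℂ} {α β C : ℝ}

/-! The proof rests on two Dirichlet series. Write an index as l = de. Then Σ S_l / l^(2i) factors
as ζ(2i) times the sine series of the Bernoulli polynomial B_(2i+1) at k/N, and these are the two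
Bernoulli factors in φ_k (`hasSum_rootPow_sub_divisors`). In the same way Σ R_l / l^(2i-1) factors
as ζ(2i) times a difference of Hurwitz zeta values, which the partial fractions of the cotangent
turn into Li_(2-2i)(ζ_N^k), the factor in ψ_k (`polylogNeg_exp`, `residueSum_odd`). So the
coefficients of both series are, up to Gamma factors, sums of A_l / ξ_l^n over equally spaced points
ξ_l of the imaginary axis. These are the large-order relations.

The same relations say that the Borel transform is a constant minus (2πi)⁻¹ Σ A_l ζ / (ξ_l (ζ -
ξ_l)), a Mittag-Leffler series with one subtraction, convergent because Σ |A_l| / l² is finite.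
`MittagLefflerData` records this. The Gevrey bound, the poles and the Stokes constants are read off
from it. The discontinuity is computed pole by pole: a pole above the real axis contributes A_l
exp(-ξ_l / y), a pole below contributes nothing (`laplaceRay_poleTerm_of_pos`,
`laplaceRay_poleTerm_of_neg`).

The resulting q-series are Lambert series. Summing over one of the two factors d, e of l produces
logarithms of factors of q-Pochhammer symbols, so the discontinuities are differences of the
functions f and g (`hasSum_fPoch`, `hasSum_gPoch_sub`).

The asymptotic expansions come from Euler–Maclaurin summation with Bernoulli polynomials, with an
explicit remainder, applied along rays to log(1 - ζ e^(-w)) and to log((1 - e^(-w)) / w)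
(`SectorLog.exists_norm_eulerMaclaurin_le`). The logarithm of the trace is elementary terms plus
values of g at y/N and of f at -1/y. As y → 0 the f-part is constant up to an exponentially small
error and g carries the expansion; as y → ∞ the roles are exchanged. The reflection k ↦ N - k
changes the sign of φ_k, and of ψ_k up to a linear term, so the combination in the trace and the one
in the discontinuity agree up to the factors ±2 and the term πiτ/6.

The Mellin transforms follow by termwise integration. The delicate case is exponent 1 for R_l, where
convergence is only conditional: the residue classes k and -k have to be paired, both in the
natural-order sum and under the integral. -/

lemma continuousOn_ray {θ : ℝ} (hd : ∀ r : ℝ, 0 < r → ContinuousAt G (r * Complex.exp (θ * Complex.I))) :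
    ContinuousOn (fun r : ℝ => G (r * Complex.exp (θ * Complex.I)) * Complex.exp (θ * Complex.I))
      (Set.Ioi 0) := by
  intro r hr
  have h1 : ContinuousAt (fun r : ℝ => (r : ℂ) * Complex.exp (θ * Complex.I)) r := by fun_prop
  exact ((ContinuousAt.comp (f := fun r : ℝ => (r : ℂ) * Complex.exp (θ * Complex.I))
    (hd r hr) h1).mul continuousAt_const).continuousWithinAt

lemma integrableOn_ray {θ : ℝ} (hd : ∀ r : ℝ, 0 < r → ContinuousAt G (r * Complex.exp (θ * Complex.I)))
    (hb : ∀ r : ℝ, 0 < r → ‖G (r * Complex.exp (θ * Complex.I))‖ ≤ C / (1 + r ^ 2)) :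
    IntegrableOn (fun r : ℝ => G (r * Complex.exp (θ * Complex.I)) * Complex.exp (θ * Complex.I))
      (Set.Ioi 0) := by
  refine Integrable.mono' (g := fun r : ℝ => C * (1 + r ^ 2)⁻¹)
    (integrable_inv_one_add_sq.const_mul C).integrableOn
    ((continuousOn_ray hd).aestronglyMeasurable measurableSet_Ioi) ?_
  refine (ae_restrict_mem measurableSet_Ioi).mono fun r hr => ?_
  rw [norm_mul, Complex.norm_exp_ofReal_mul_I, mul_one, ← div_eq_mul_inv]
  exact hb r hr

/-- Under r = e^x rays become horizontal lines and a sector becomes a strip, where the rectangle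
form of Cauchy's theorem is available. -/
lemma integral_ray_eq_integral_exp {f : ℝ → ℂ} :
    ∫ r in Set.Ioi (0 : ℝ), f r = ∫ x : ℝ, (Real.exp x : ℂ) * f (Real.exp x) := by
  have h := integral_image_eq_integral_abs_deriv_smul (MeasurableSet.univ (α := ℝ))
    (fun x _ => (Real.hasDerivAt_exp x).hasDerivWithinAt)
    (fun x _ y _ hxy => Real.exp_injective hxy) f
  rw [Set.image_univ, Real.range_exp] at h
  simpa [abs_of_pos (Real.exp_pos _)] using h

lemma integrable_ray_exp {f : ℝ → ℂ} (hf : IntegrableOn f (Set.Ioi 0)) :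
    Integrable (fun x : ℝ => (Real.exp x : ℂ) * f (Real.exp x)) := by
  have h := (integrableOn_image_iff_integrableOn_abs_deriv_smul (MeasurableSet.univ (α := ℝ))
    (fun x _ => (Real.hasDerivAt_exp x).hasDerivWithinAt)
    (fun x _ y _ hxy => Real.exp_injective hxy) f).1
  rw [Set.image_univ, Real.range_exp] at h
  simpa [abs_of_pos (Real.exp_pos _), integrableOn_univ] using h hf

/-- A holomorphic function on a closed sector which is `O(1 / (1 + r ^ 2))` has the same integral
along both boundary rays. -/
theorem integral_ray_eq_of_differentiable (hαβ : α ≤ β)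
    (hd : ∀ r : ℝ, 0 < r → ∀ θ ∈ Set.Icc α β, DifferentiableAt ℂ G (r * Complex.exp (θ * Complex.I)))
    (hb : ∀ r : ℝ, 0 < r → ∀ θ ∈ Set.Icc α β,
      ‖G (r * Complex.exp (θ * Complex.I))‖ ≤ C / (1 + r ^ 2)) :
    ∫ r in Set.Ioi (0 : ℝ), G (r * Complex.exp (α * Complex.I)) * Complex.exp (α * Complex.I) =
      ∫ r in Set.Ioi (0 : ℝ), G (r * Complex.exp (β * Complex.I)) * Complex.exp (β * Complex.I) := by
  have hα : α ∈ Set.Icc α β := ⟨le_rfl, hαβ⟩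
  have hβ : β ∈ Set.Icc α β := ⟨hαβ, le_rfl⟩
  have hC : 0 ≤ C := by
    have := (norm_nonneg _).trans (hb 1 one_pos α hα)
    by_contra hneg
    push Not at hneg
    have : C / (1 + 1 ^ 2) < 0 := div_neg_of_neg_of_pos hneg (by norm_num)
    linarith
  set h : ℂ → ℂ := fun w => G (Complex.exp w) * Complex.exp w with hh
  have key : ∀ (x θ : ℝ), h (x + θ * Complex.I) = (Real.exp x : ℂ) *
      (G ((Real.exp x : ℝ) * Complex.exp (θ * Complex.I)) * Complex.exp (θ * Complex.I)) := by
    intro x θ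
    simp only [hh, Complex.exp_add, Complex.ofReal_exp]
    ring
  have hint : ∀ θ ∈ Set.Icc α β, Integrable (fun x : ℝ => h (x + θ * Complex.I)) := by
    intro θ hθ
    simp only [key]
    exact integrable_ray_exp (f := fun r : ℝ => G (r * Complex.exp (θ * Complex.I)) *
      Complex.exp (θ * Complex.I)) (integrableOn_ray (fun r hr => (hd r hr θ hθ).continuousAt)
        (fun r hr => hb r hr θ hθ))
  rw [integral_ray_eq_integral_exp, integral_ray_eq_integral_exp]
  simp only [← key]
  have hhd : ∀ w : ℂ, w.im ∈ Set.Icc α β → DifferentiableAt ℂ h w := by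
    intro w hw
    have h1 : DifferentiableAt ℂ G (Complex.exp w) := by
      have := hd (Real.exp w.re) (Real.exp_pos _) w.im hw
      rwa [Complex.ofReal_exp, ← Complex.exp_add, Complex.re_add_im] at this
    exact (DifferentiableAt.comp w h1 Complex.differentiableAt_exp).mul Complex.differentiableAt_exp
  -- The weight 1/(1 + r²) becomes e^(-|x|): decay on the right comes from G, decay on the left from
  -- the Jacobian e^x. Hence both vertical sides of the rectangle vanish in the limit.
  have hbound : ∀ x θ : ℝ, θ ∈ Set.Icc α β → ‖h (x + θ * Complex.I)‖ ≤ C * Real.exp (-|x|) := by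
    intro x θ hθ
    rw [key, norm_mul, norm_mul, Complex.norm_exp_ofReal_mul_I, mul_one, Complex.norm_real,
      Real.norm_of_nonneg (Real.exp_pos x).le]
    have h1 := hb _ (Real.exp_pos x) θ hθ
    have hx := Real.exp_pos x
    calc Real.exp x * ‖G ((Real.exp x : ℝ) * Complex.exp (θ * Complex.I))‖
        ≤ Real.exp x * (C / (1 + Real.exp x ^ 2)) := by gcongr
      _ = C * (Real.exp x / (1 + Real.exp x ^ 2)) := by ring
      _ ≤ C * Real.exp (-|x|) := by
        gcongr
        rw [div_le_iff₀ (by positivity)]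
        rcases le_total 0 x with h0 | h0
        · rw [abs_of_nonneg h0, Real.exp_neg]
          field_simp
          nlinarith
        · rw [abs_of_nonpos h0, neg_neg]
          nlinarith [mul_pos hx (pow_pos hx 2)]
  have hrect : ∀ T : ℝ, 0 ≤ T → (∫ x : ℝ in (-T)..T, h (x + α * Complex.I)) -
      (∫ x : ℝ in (-T)..T, h (x + β * Complex.I)) +
      Complex.I • (∫ y : ℝ in α..β, h (T + y * Complex.I)) -
      Complex.I • (∫ y : ℝ in α..β, h ((-T : ℝ) + y * Complex.I)) = 0 := by
    intro T hT
    have := Complex.integral_boundary_rect_eq_zero_of_differentiableOn h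
      (-T + α * Complex.I) (T + β * Complex.I) (by
        intro w hw
        apply (hhd w _).differentiableWithinAt
        have := hw.2
        simpa [Set.uIcc_of_le hαβ] using this)
    simpa using this
  have hlim : ∀ θ ∈ Set.Icc α β, Tendsto (fun n : ℕ => ∫ x : ℝ in (-(n : ℝ))..n, h (x + θ * Complex.I))
      atTop (𝓝 (∫ x : ℝ, h (x + θ * Complex.I))) := fun θ hθ =>
    intervalIntegral_tendsto_integral (hint θ hθ)
      (tendsto_neg_atTop_atBot.comp tendsto_natCast_atTop_atTop) tendsto_natCast_atTop_atTop
  have hexp : Tendsto (fun n : ℕ => C * Real.exp (-(n : ℝ)) * (β - α)) atTop (𝓝 0) := by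
    have : Tendsto (fun n : ℕ => Real.exp (-(n : ℝ))) atTop (𝓝 0) :=
      Real.tendsto_exp_neg_atTop_nhds_zero.comp tendsto_natCast_atTop_atTop
    simpa using (this.const_mul C).mul_const (β - α)
  have hvert : ∀ ε : ℝ, (ε = 1 ∨ ε = -1) →
      Tendsto (fun n : ℕ => ∫ y : ℝ in α..β, h ((ε * n : ℝ) + y * Complex.I)) atTop (𝓝 0) := by
    intro ε hε
    refine squeeze_zero_norm (fun n => ?_) hexp
    have := intervalIntegral.norm_integral_le_of_norm_le_const (a := α) (b := β)
      (C := C * Real.exp (-(n : ℝ))) (f := fun y : ℝ => h ((ε * n : ℝ) + y * Complex.I)) (by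
        intro y hy
        rw [Set.uIoc_of_le hαβ] at hy
        refine (hbound _ y ⟨hy.1.le, hy.2⟩).trans (le_of_eq ?_)
        rcases hε with rfl | rfl <;> simp)
    rwa [abs_of_nonneg (by linarith)] at this
  have h0 : Tendsto (fun n : ℕ => (∫ x : ℝ in (-(n : ℝ))..n, h (x + α * Complex.I)) -
      (∫ x : ℝ in (-(n : ℝ))..n, h (x + β * Complex.I)) +
      Complex.I • (∫ y : ℝ in α..β, h (((1 : ℝ) * n : ℝ) + y * Complex.I)) -
      Complex.I • (∫ y : ℝ in α..β, h (((-1 : ℝ) * n : ℝ) + y * Complex.I))) atTop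
      (𝓝 ((∫ x : ℝ, h (x + α * Complex.I)) - (∫ x : ℝ, h (x + β * Complex.I)) +
        Complex.I • (0 : ℂ) - Complex.I • (0 : ℂ))) :=
    (((hlim α hα).sub (hlim β hβ)).add ((hvert 1 (Or.inl rfl)).const_smul _)).sub
      ((hvert (-1) (Or.inr rfl)).const_smul _)
  have h1 := tendsto_nhds_unique h0 (tendsto_const_nhds.congr' (f₁ := fun _ => (0 : ℂ)) ?_)
  · simp only [smul_zero, add_zero, sub_zero] at h1
    exact sub_eq_zero.1 h1
  · refine Eventually.of_forall fun n => ?_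
    have := hrect n (Nat.cast_nonneg n)
    simp only [one_mul, neg_one_mul]
    exact this.symm

end Rays

end StrongWeak

namespace StrongWeak

/-! ### Laplace integrals of simple fractions along rays near the imaginary axis -/

/-- Converts exponential decay into the 1/(1 + r²) required for rotating rays. The constant comes
from X³/3! ≤ e^X at X = c(1 + r), together with (1 + r)(1 + r²) ≤ (1 + r)³. -/
lemma one_add_mul_exp_neg_le {c r : ℝ} (hc : 0 < c) (hr : 0 ≤ r) :
    (1 + r) * Real.exp (-(c * r)) ≤ 6 * Real.exp c / c ^ 3 / (1 + r ^ 2) := by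
  rw [le_div_iff₀ (by positivity), le_div_iff₀ (by positivity)]
  have h := Real.pow_div_factorial_le_exp (c * (1 + r)) (by positivity) 3
  have h2 : (c * (1 + r)) ^ 3 ≤ 6 * Real.exp (c * (1 + r)) := by
    rw [div_le_iff₀ (by positivity)] at h
    norm_num [Nat.factorial] at h ⊢
    linarith
  have h3 : Real.exp (c * (1 + r)) * Real.exp (-(c * r)) = Real.exp c := by
    rw [← Real.exp_add]; ring_nf
  have h4 : (1 + r) * (1 + r ^ 2) ≤ (1 + r) ^ 3 := by nlinarith [mul_nonneg hr hr]
  calc (1 + r) * Real.exp (-(c * r)) * (1 + r ^ 2) * c ^ 3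
      = ((1 + r) * (1 + r ^ 2)) * c ^ 3 * Real.exp (-(c * r)) := by ring
    _ ≤ (1 + r) ^ 3 * c ^ 3 * Real.exp (-(c * r)) := by gcongr
    _ = (c * (1 + r)) ^ 3 * Real.exp (-(c * r)) := by ring
    _ ≤ 6 * Real.exp (c * (1 + r)) * Real.exp (-(c * r)) := by gcongr
    _ = 6 * Real.exp c := by rw [mul_assoc, h3]

lemma exp_pi_div_two_add (δ : ℝ) : Complex.exp ((Real.pi / 2 + δ : ℝ) * Complex.I) =
    Complex.I * Complex.exp (δ * Complex.I) := by
  push_cast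
  rw [add_mul, Complex.exp_add, Complex.exp_pi_div_two_mul_I]

lemma norm_exp_neg_ray_div {c r : ℝ} {θ : ℝ} {y : ℂ} (hr : 0 ≤ r)
    (hc : c ≤ (Complex.exp (θ * Complex.I) / y).re) :
    ‖Complex.exp (-(r * Complex.exp (θ * Complex.I)) / y)‖ ≤ Real.exp (-(c * r)) := by
  rw [Complex.norm_exp, Real.exp_le_exp]
  have : -(r * Complex.exp (θ * Complex.I)) / y = ((-r : ℝ) : ℂ) * (Complex.exp (θ * Complex.I) / y) := by
    push_cast; ring
  rw [this, Complex.re_ofReal_mul]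
  nlinarith

/-- Data of a sector around the positive imaginary axis in which `exp (-ζ / y)` decays. -/
structure DecaySector (y : ℂ) (ε c : ℝ) : Prop where
  pos : 0 < ε
  lt : ε < Real.pi / 2
  c_pos : 0 < c
  le_re : ∀ δ ∈ Set.Icc (-ε) ε, c ≤ (Complex.exp ((Real.pi / 2 + δ : ℝ) * Complex.I) / y).re

/-- The number e^(-iθ) y is |y|² times the conjugate of e^(iθ)/y, so decay of the kernel along the
ray and the half-plane condition for a Borel–Laplace sum are equivalent. -/
lemma re_exp_neg_mul_pos {y : ℂ} {θ c : ℝ} (hc : 0 < c) (hy : y ≠ 0)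
    (h : c ≤ (Complex.exp (θ * Complex.I) / y).re) :
    0 < (Complex.exp (-(θ * Complex.I)) * y).re := by
  have h1 : Complex.exp (-(θ * Complex.I)) * y =
      (starRingEnd ℂ) (Complex.exp (θ * Complex.I) / y) * (Complex.normSq y : ℂ) := by
    rw [Complex.normSq_eq_conj_mul_self, map_div₀, ← Complex.exp_conj]
    have : (starRingEnd ℂ) y ≠ 0 := by simpa using hy
    simp only [map_mul, Complex.conj_ofReal, Complex.conj_I]
    field_simp
  rw [h1, Complex.re_mul_ofReal, Complex.conj_re]
  have := Complex.normSq_pos.2 hy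
  nlinarith

lemma eventually_decaySector {y : ℂ} (hy : 0 < y.im) :
    ∃ c, ∀ᶠ ε in 𝓝[>] (0 : ℝ), DecaySector y ε c := by
  have hy0 : y ≠ 0 := by rintro rfl; simp at hy
  have hns := Complex.normSq_pos.2 hy0
  set F : ℝ → ℝ := fun δ => (Complex.exp ((Real.pi / 2 + δ : ℝ) * Complex.I) / y).re with hF
  have hF0 : F 0 = y.im / Complex.normSq y := by
    simp only [hF, exp_pi_div_two_add]
    simp [Complex.div_re]
  have hpos : 0 < F 0 := by rw [hF0]; positivity
  -- On the imaginary axis itself the decay rate is Im y / |y|² > 0; half of it persists for nearby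
  -- angles by continuity, with a c independent of ε.
  refine ⟨F 0 / 2, ?_⟩
  have hcont : Continuous F := by
    simp only [hF]
    fun_prop
  have h1 : ∀ᶠ δ in 𝓝 (0 : ℝ), F 0 / 2 < F δ :=
    hcont.continuousAt.eventually (lt_mem_nhds (by linarith))
  obtain ⟨r, hr, hball⟩ := Metric.eventually_nhds_iff.1 h1
  have h2 : ∀ᶠ ε in 𝓝[>] (0 : ℝ), ε < min r (Real.pi / 2) :=
    nhdsWithin_le_nhds (gt_mem_nhds (by positivity))
  filter_upwards [h2, self_mem_nhdsWithin] with ε h3 h4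
  refine ⟨h4, h3.trans_le (min_le_right _ _), by positivity, fun δ hδ => (hball ?_).le⟩
  rw [Real.dist_eq, sub_zero]
  exact (abs_le.2 hδ).trans_lt (h3.trans_le (min_le_left _ _))

/-- The right side is at least the distance from ib to the line containing the ray. The bound grows
linearly in |b|, which is what makes the later estimates summable over the poles. -/
lemma ray_sub_norm_ge {b δ r : ℝ} :
    |b| * |Real.sin δ| ≤
      ‖(r : ℂ) * Complex.exp ((Real.pi / 2 + δ : ℝ) * Complex.I) - b * Complex.I‖ := by
  rw [exp_pi_div_two_add]
  have h1 : (r : ℂ) * (Complex.I * Complex.exp (δ * Complex.I)) - b * Complex.I =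
      Complex.I * Complex.exp (δ * Complex.I) * (r - b * Complex.exp ((-δ : ℝ) * Complex.I)) := by
    have : Complex.exp (δ * Complex.I) * Complex.exp ((-δ : ℝ) * Complex.I) = 1 := by
      rw [← Complex.exp_add]; simp
    linear_combination (Complex.I * b) * this
  rw [h1, norm_mul, norm_mul, Complex.norm_I, Complex.norm_exp_ofReal_mul_I, one_mul, one_mul]
  refine le_trans ?_ (Complex.abs_im_le_norm _)
  simp [Complex.exp_im, abs_mul]

lemma ray_im_nonneg {δ ε r : ℝ} (hε : ε < Real.pi / 2) (hδ : δ ∈ Set.Icc (-ε) ε) (hr : 0 ≤ r) :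
    0 ≤ ((r : ℂ) * Complex.exp ((Real.pi / 2 + δ : ℝ) * Complex.I)).im := by
  rw [exp_pi_div_two_add, Complex.im_ofReal_mul]
  refine mul_nonneg hr ?_
  simp only [Complex.I_mul_im, Complex.exp_ofReal_mul_I_re]
  exact Real.cos_nonneg_of_mem_Icc ⟨by linarith [hδ.1], by linarith [hδ.2]⟩

lemma norm_ray (r : ℝ) (hr : 0 ≤ r) (θ : ℝ) : ‖(r : ℂ) * Complex.exp (θ * Complex.I)‖ = r := by
  rw [norm_mul, Complex.norm_exp_ofReal_mul_I, mul_one, Complex.norm_real, Real.norm_of_nonneg hr]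

/-- With s = ζ/ξ and ξ = ib, the function log((1 - s)/(1 + s)) is a primitive of 2ξ/(ζ² - ξ²) along
the ray and vanishes at the origin. For δ ≠ 0 and r > 0 the quotient has nonzero imaginary part, so
the principal branch is never left. -/
lemma hasDerivAt_log_moebius {b δ r : ℝ} (hr : 0 ≤ r) (hb : 0 < b) (hδ : δ ≠ 0) (hδ' : |δ| < Real.pi / 2) :
    HasDerivAt (fun r : ℝ => Complex.log ((1 - (r / b : ℂ) * Complex.exp (δ * Complex.I)) /
        (1 + (r / b : ℂ) * Complex.exp (δ * Complex.I))))
      (2 * (b * Complex.I) / (((r : ℂ) * Complex.exp ((Real.pi / 2 + δ : ℝ) * Complex.I)) ^ 2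
        - (b * Complex.I) ^ 2) * Complex.exp ((Real.pi / 2 + δ : ℝ) * Complex.I)) r := by
  have hbc : (b : ℂ) ≠ 0 := by exact_mod_cast hb.ne'
  set u : ℂ := Complex.exp (δ * Complex.I) with hu
  have hure : 0 < u.re := by
    rw [hu, Complex.exp_ofReal_mul_I_re]
    exact Real.cos_pos_of_mem_Ioo ⟨by linarith [neg_abs_le δ], by linarith [le_abs_self δ]⟩
  have huim : u.im ≠ 0 := by
    rw [hu, Complex.exp_ofReal_mul_I_im]
    have h1 := abs_lt.1 hδ'
    exact Real.sin_eq_zero_iff_of_lt_of_lt (by linarith [Real.pi_pos]) (by linarith [Real.pi_pos]) |>.not.2 hδ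
  have hsre : 0 ≤ ((r / b : ℂ) * u).re := by
    have : ((r / b : ℂ) * u).re = (r / b) * u.re := by
      rw [← Complex.ofReal_div, Complex.re_ofReal_mul]
    rw [this]; positivity
  have hsim : ((r / b : ℂ) * u).im = (r / b) * u.im := by
    rw [← Complex.ofReal_div, Complex.im_ofReal_mul]
  have hplus : 1 + (r / b : ℂ) * u ≠ 0 := by
    intro h0
    have := congrArg Complex.re h0
    simp only [Complex.add_re, Complex.one_re, Complex.zero_re] at this
    linarith
  have hminus : 1 - (r / b : ℂ) * u ≠ 0 := by
    intro h0
    have h1 := congrArg Complex.im h0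
    simp only [Complex.sub_im, Complex.one_im, hsim, Complex.zero_im, zero_sub, neg_eq_zero,
      mul_eq_zero, huim, or_false] at h1
    have h2 : (r / b : ℂ) = 0 := by rw [← Complex.ofReal_div, h1]; simp
    rw [h2] at h0
    simp at h0
  have hslit : (1 - (r / b : ℂ) * u) / (1 + (r / b : ℂ) * u) ∈ Complex.slitPlane := by
    rw [Complex.mem_slitPlane_iff]
    by_cases hr0 : r = 0
    · left; simp [hr0]
    · right
      have : ((1 - (r / b : ℂ) * u) / (1 + (r / b : ℂ) * u)).im =
          -(2 * ((r / b) * u.im)) / Complex.normSq (1 + (r / b : ℂ) * u) := by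
        rw [Complex.div_im]
        simp only [Complex.sub_im, Complex.sub_re, Complex.add_im, Complex.add_re, Complex.one_im,
          Complex.one_re, hsim]
        ring
      rw [this]
      refine div_ne_zero (neg_ne_zero.2 (mul_ne_zero two_ne_zero (mul_ne_zero ?_ huim)))
        (Complex.normSq_pos.2 hplus).ne'
      exact div_ne_zero hr0 hb.ne'
  have hs : HasDerivAt (fun r : ℝ => (r / b : ℂ) * u) (1 / b * u) r :=
    ((Complex.ofRealCLM.hasDerivAt (x := r)).div_const (b : ℂ)).mul_const u
  have hq := ((hs.const_sub 1).fun_div (hs.const_add 1) hplus).clog_real hslit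
  convert! hq using 1
  rw [exp_pi_div_two_add, ← hu]
  have hI := Complex.I_sq
  have e1 : ((r : ℂ) * (Complex.I * u)) ^ 2 - (b * Complex.I) ^ 2 =
      b ^ 2 * ((1 - (r / b : ℂ) * u) * (1 + (r / b : ℂ) * u)) := by
    field_simp
    linear_combination (r ^ 2 * u ^ 2 - b ^ 2) * hI
  rw [e1]
  clear hq hs e1 hslit hsre hsim
  generalize (r / b : ℂ) * u = v at hplus hminus ⊢
  field_simp
  linear_combination 2 * u * hI

lemma tendsto_moebius {b δ : ℝ} (hb : 0 < b) :
    Tendsto (fun r : ℝ => (1 - (r / b : ℂ) * Complex.exp (δ * Complex.I)) /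
        (1 + (r / b : ℂ) * Complex.exp (δ * Complex.I))) atTop (𝓝 (-1)) := by
  set u : ℂ := Complex.exp (δ * Complex.I) with hu
  have hu0 : u ≠ 0 := Complex.exp_ne_zero _
  have hbc : (b : ℂ) ≠ 0 := by exact_mod_cast hb.ne'
  have h1 : Tendsto (fun r : ℝ => (b : ℂ) / r) atTop (𝓝 0) := by
    have : Tendsto (fun r : ℝ => b / r) atTop (𝓝 0) := tendsto_const_nhds.div_atTop tendsto_id
    have h := (Complex.continuous_ofReal.tendsto 0).comp this
    simpa [Function.comp_def] using h
  have h2 : Tendsto (fun r : ℝ => ((b : ℂ) / r - u) / ((b : ℂ) / r + u)) atTop (𝓝 ((0 - u) / (0 + u))) :=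
    (h1.sub_const u).div (h1.add_const u) (by simpa using hu0)
  have h3 : (0 - u) / (0 + u) = -1 := by rw [zero_sub, zero_add, neg_div, div_self hu0]
  rw [h3] at h2
  refine h2.congr' ?_
  filter_upwards [eventually_gt_atTop 0] with r hr
  have hrc : (r : ℂ) ≠ 0 := by exact_mod_cast hr.ne'
  have e1 : (b : ℂ) / r - u = (b / r) * (1 - r / b * u) := by field_simp
  have e2 : (b : ℂ) / r + u = (b / r) * (1 + r / b * u) := by field_simp
  rw [e1, e2, mul_div_mul_left _ _ (div_ne_zero hbc hrc)]

lemma moebius_im {b δ r : ℝ} : ((1 - (r / b : ℂ) * Complex.exp (δ * Complex.I)) /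
        (1 + (r / b : ℂ) * Complex.exp (δ * Complex.I))).im =
    -(2 * ((r / b) * Real.sin δ)) / Complex.normSq (1 + (r / b : ℂ) * Complex.exp (δ * Complex.I)) := by
  have hsim : ((r / b : ℂ) * Complex.exp (δ * Complex.I)).im = (r / b) * Real.sin δ := by
    rw [← Complex.ofReal_div, Complex.im_ofReal_mul, Complex.exp_ofReal_mul_I_im]
  rw [Complex.div_im]
  simp only [Complex.sub_im, Complex.sub_re, Complex.add_im, Complex.add_re, Complex.one_im,
    Complex.one_re, hsim]
  ring

/-- The quotient approaches -1 from below the cut when δ > 0 and from above when δ < 0. The jump of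
the logarithm between the two rays is the 2πi of the residue theorem. -/
lemma tendsto_log_moebius_pos {b δ : ℝ} (hb : 0 < b) (hδ : 0 < δ) (hδ' : δ < Real.pi / 2) :
    Tendsto (fun r : ℝ => Complex.log ((1 - (r / b : ℂ) * Complex.exp (δ * Complex.I)) /
        (1 + (r / b : ℂ) * Complex.exp (δ * Complex.I)))) atTop (𝓝 (-(Real.pi * Complex.I))) := by
  have h := Complex.tendsto_log_nhdsWithin_im_neg_of_re_neg_of_im_zero (z := -1) (by simp) (by simp)
  simp only [norm_neg, norm_one, Real.log_one, Complex.ofReal_zero, zero_sub] at h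
  refine h.comp (tendsto_nhdsWithin_iff.2 ⟨tendsto_moebius hb, ?_⟩)
  filter_upwards [eventually_gt_atTop 0] with r hr
  have hs : 0 < Real.sin δ := Real.sin_pos_of_pos_of_lt_pi hδ (by linarith [Real.pi_pos])
  change Complex.im _ < 0
  rw [moebius_im]
  refine div_neg_of_neg_of_pos (by have : 0 < r / b * Real.sin δ := by positivity
                                   linarith) (Complex.normSq_pos.2 fun h0 => ?_)
  have h1 := congrArg Complex.im h0
  rw [← Complex.ofReal_div, Complex.add_im, Complex.im_ofReal_mul, Complex.exp_ofReal_mul_I_im] at h1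
  simp only [Complex.one_im, zero_add, Complex.zero_im] at h1
  have : 0 < r / b * Real.sin δ := by positivity
  linarith

lemma tendsto_log_moebius_neg {b δ : ℝ} (hb : 0 < b) (hδ : δ < 0) (hδ' : -(Real.pi / 2) < δ) :
    Tendsto (fun r : ℝ => Complex.log ((1 - (r / b : ℂ) * Complex.exp (δ * Complex.I)) /
        (1 + (r / b : ℂ) * Complex.exp (δ * Complex.I)))) atTop (𝓝 (Real.pi * Complex.I)) := by
  have h := Complex.tendsto_log_nhdsWithin_im_nonneg_of_re_neg_of_im_zero (z := -1) (by simp) (by simp)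
  simp only [norm_neg, norm_one, Real.log_one, Complex.ofReal_zero, zero_add] at h
  refine h.comp (tendsto_nhdsWithin_iff.2 ⟨tendsto_moebius hb, ?_⟩)
  filter_upwards [eventually_gt_atTop 0] with r hr
  have hs : Real.sin δ < 0 := Real.sin_neg_of_neg_of_neg_pi_lt hδ (by linarith [Real.pi_pos])
  change 0 ≤ Complex.im _
  rw [moebius_im]
  refine div_nonneg ?_ (Complex.normSq_nonneg _)
  have : r / b * Real.sin δ < 0 := mul_neg_of_pos_of_neg (by positivity) hs
  linarith

lemma norm_sub_ge_of_im_nonneg {ζ : ℂ} {b : ℝ} (hζ : 0 ≤ ζ.im) :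
    b ≤ ‖ζ + b * Complex.I‖ := by
  refine le_trans ?_ (Complex.abs_im_le_norm _)
  simp only [Complex.add_im, Complex.mul_im, Complex.ofReal_re, Complex.I_im, mul_one,
    Complex.ofReal_im, Complex.I_re, mul_zero, add_zero]
  exact le_trans (by linarith) (le_abs_self _)

/-! ### Lateral Laplace integrals of a single pole. -/

variable {y : ℂ} {ε c : ℝ}

lemma norm_exp_neg_div_le (h : DecaySector y ε c) {δ r : ℝ} (hδ : δ ∈ Set.Icc (-ε) ε)
    (hr : 0 ≤ r) :
    ‖Complex.exp (-(r * Complex.exp ((Real.pi / 2 + δ : ℝ) * Complex.I)) / y)‖ ≤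
      Real.exp (-(c * r)) :=
  norm_exp_neg_ray_div hr (h.le_re δ hδ)

/-- Integrals along the two sides of the sector of a function holomorphic in it. -/
lemma laplaceRay_eq_of_norm_le (h : DecaySector y ε c) {B : ℂ → ℂ} {C : ℝ} (hC : 0 ≤ C)
    (hB : ∀ r : ℝ, 0 < r → ∀ δ ∈ Set.Icc (-ε) ε,
      DifferentiableAt ℂ B (r * Complex.exp ((Real.pi / 2 + δ : ℝ) * Complex.I)))
    (hb : ∀ r : ℝ, 0 < r → ∀ δ ∈ Set.Icc (-ε) ε,
      ‖B (r * Complex.exp ((Real.pi / 2 + δ : ℝ) * Complex.I))‖ ≤ C * (1 + r)) :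
    laplaceRay B (Real.pi / 2 + ε) y = laplaceRay B (Real.pi / 2 - ε) y := by
  have hε := h.pos
  have shift : ∀ θ ∈ Set.Icc (Real.pi / 2 - ε) (Real.pi / 2 + ε), ∃ δ ∈ Set.Icc (-ε) ε,
      θ = Real.pi / 2 + δ := fun θ hθ =>
    ⟨θ - Real.pi / 2, ⟨by linarith [hθ.1], by linarith [hθ.2]⟩, by ring⟩
  refine (integral_ray_eq_of_differentiable (G := fun ζ => Complex.exp (-ζ / y) * B ζ)
    (C := C * (6 * Real.exp c / c ^ 3)) (by linarith) ?_ ?_).symm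
  · intro r hr θ hθ
    obtain ⟨δ, hδ, rfl⟩ := shift θ hθ
    exact DifferentiableAt.mul (by fun_prop) (hB r hr δ hδ)
  · intro r hr θ hθ
    obtain ⟨δ, hδ, rfl⟩ := shift θ hθ
    rw [norm_mul]
    calc _ ≤ Real.exp (-(c * r)) * (C * (1 + r)) := by
          gcongr
          · exact norm_exp_neg_div_le h hδ hr.le
          · exact hb r hr δ hδ
      _ = C * ((1 + r) * Real.exp (-(c * r))) := by ring
      _ ≤ C * (6 * Real.exp c / c ^ 3 / (1 + r ^ 2)) := by
          gcongr
          exact one_add_mul_exp_neg_le h.c_pos hr.le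
      _ = _ := by ring

lemma integrableOn_laplaceIntegrand (h : DecaySector y ε c) {B : ℂ → ℂ} {C δ : ℝ} (hC : 0 ≤ C)
    (hδ : δ ∈ Set.Icc (-ε) ε)
    (hB : ∀ r : ℝ, 0 < r →
      ContinuousAt B (r * Complex.exp ((Real.pi / 2 + δ : ℝ) * Complex.I)))
    (hb : ∀ r : ℝ, 0 < r →
      ‖B (r * Complex.exp ((Real.pi / 2 + δ : ℝ) * Complex.I))‖ ≤ C * (1 + r)) :
    IntegrableOn (laplaceIntegrand B (Real.pi / 2 + δ) y) (Set.Ioi 0) := by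
  refine integrableOn_ray (G := fun ζ => Complex.exp (-ζ / y) * B ζ)
    (C := C * (6 * Real.exp c / c ^ 3)) ?_ ?_
  · intro r hr
    exact ContinuousAt.mul (by fun_prop) (hB r hr)
  · intro r hr
    rw [norm_mul]
    calc _ ≤ Real.exp (-(c * r)) * (C * (1 + r)) := by
          gcongr
          · exact norm_exp_neg_div_le h hδ hr.le
          · exact hb r hr
      _ = C * ((1 + r) * Real.exp (-(c * r))) := by ring
      _ ≤ C * (6 * Real.exp c / c ^ 3 / (1 + r ^ 2)) := by
          gcongr
          exact one_add_mul_exp_neg_le h.c_pos hr.le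
      _ = _ := by ring

/-- The term with pole `ξ` of a Mittag-Leffler expansion vanishing at the origin. -/
noncomputable def poleTerm (ξ ζ : ℂ) : ℂ := ζ / (ξ * (ζ - ξ))

/-- One factor 1/|b| comes from the subtraction at the origin and one from the distance to the ray;
the resulting 1/b² matches the summability of ‖A_l‖ / l². -/
lemma norm_poleTerm_le {b δ r : ℝ} (hb : b ≠ 0) (hs : Real.sin δ ≠ 0) (hr : 0 ≤ r) :
    ‖poleTerm (b * Complex.I) (r * Complex.exp ((Real.pi / 2 + δ : ℝ) * Complex.I))‖ ≤
      1 / (b ^ 2 * |Real.sin δ|) * (1 + r) := by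
  have h1 := ray_sub_norm_ge (b := b) (δ := δ) (r := r)
  have hb' := abs_pos.2 hb
  have hs' := abs_pos.2 hs
  have h2 : 0 < |b| * |Real.sin δ| := by positivity
  rw [poleTerm, norm_div, norm_ray r hr, norm_mul, norm_mul, Complex.norm_I, mul_one,
    Complex.norm_real, Real.norm_eq_abs, ← sq_abs b]
  calc r / (|b| * ‖(r : ℂ) * Complex.exp ((Real.pi / 2 + δ : ℝ) * Complex.I) - b * Complex.I‖)
      ≤ r / (|b| * (|b| * |Real.sin δ|)) := by gcongr
    _ = 1 / (|b| ^ 2 * |Real.sin δ|) * r := by field_simp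
    _ ≤ _ := by
      gcongr
      linarith

lemma differentiableAt_poleTerm {ξ ζ : ℂ} (hξ : ξ ≠ 0) (h : ζ ≠ ξ) :
    DifferentiableAt ℂ (poleTerm ξ) ζ := by
  unfold poleTerm
  exact DifferentiableAt.div (by fun_prop) (by fun_prop) (mul_ne_zero hξ (sub_ne_zero.2 h))

lemma ray_ne_pole {b δ r : ℝ} (hb : b ≠ 0) (hs : Real.sin δ ≠ 0) :
    (r : ℂ) * Complex.exp ((Real.pi / 2 + δ : ℝ) * Complex.I) ≠ b * Complex.I := by
  intro h
  have h1 := ray_sub_norm_ge (b := b) (δ := δ) (r := r)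
  rw [h, sub_self, norm_zero] at h1
  have := mul_pos (abs_pos.2 hb) (abs_pos.2 hs)
  linarith

lemma DecaySector.sin_pos (h : DecaySector y ε c) : 0 < Real.sin ε :=
  Real.sin_pos_of_pos_of_lt_pi h.pos (by linarith [Real.pi_pos, h.lt])

/-- The sector lies in the closed upper half-plane, at distance at least |b| from the pole, so the
ray can be rotated across the imaginary axis. -/
lemma laplaceRay_poleTerm_of_neg (h : DecaySector y ε c) {b : ℝ} (hb : b < 0) :
    laplaceRay (poleTerm (b * Complex.I)) (Real.pi / 2 + ε) y =
      laplaceRay (poleTerm (b * Complex.I)) (Real.pi / 2 - ε) y := by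
  have hξ : (b : ℂ) * Complex.I ≠ 0 := mul_ne_zero (by exact_mod_cast hb.ne) Complex.I_ne_zero
  have hdist : ∀ r : ℝ, 0 < r → ∀ δ ∈ Set.Icc (-ε) ε,
      -b ≤ ‖r * Complex.exp ((Real.pi / 2 + δ : ℝ) * Complex.I) - b * Complex.I‖ := by
    intro r hr δ hδ
    have := norm_sub_ge_of_im_nonneg (b := -b) (ray_im_nonneg h.lt hδ hr.le)
    simpa [sub_eq_add_neg] using this
  refine laplaceRay_eq_of_norm_le h (C := 1 / b ^ 2) (by positivity) ?_ ?_
  · intro r hr δ hδ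
    refine differentiableAt_poleTerm hξ fun h0 => ?_
    have := hdist r hr δ hδ
    rw [h0, sub_self, norm_zero] at this
    linarith
  · intro r hr δ hδ
    rw [poleTerm, norm_div, norm_ray r hr.le, norm_mul, norm_mul, Complex.norm_I, mul_one,
      Complex.norm_real, Real.norm_eq_abs, abs_of_neg hb]
    calc _ ≤ r / (-b * -b) := by
          have := hdist r hr δ hδ
          have : 0 < -b := by linarith
          gcongr
      _ = 1 / b ^ 2 * r := by field_simp
      _ ≤ _ := by gcongr; linarith

/-- The pole lies inside the sector, so the rays cannot be rotated directly. Subtracting e^(-ξ/y) ·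
2ξ/(ζ² - ξ²) removes the pole and keeps decay of order 1/r²; what is left has equal integrals along
both rays. The subtracted fraction is integrated by its logarithmic primitive, and its limits ∓πi
produce the residue. -/
lemma laplaceRay_poleTerm_of_pos (h : DecaySector y ε c) {b : ℝ} (hb : 0 < b) :
    laplaceRay (poleTerm (b * Complex.I)) (Real.pi / 2 + ε) y -
      laplaceRay (poleTerm (b * Complex.I)) (Real.pi / 2 - ε) y =
      -(2 * Real.pi * Complex.I) * Complex.exp (-(b * Complex.I) / y) := by
  have hbc : (b : ℂ) ≠ 0 := by exact_mod_cast hb.ne'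
  set ξ : ℂ := b * Complex.I with hξdef
  have hξ : ξ ≠ 0 := mul_ne_zero hbc Complex.I_ne_zero
  set e : ℂ := Complex.exp (-ξ / y) with he
  -- This is (ζ - ξ)(ζ + ξ) times the regularised integrand. Since p vanishes at ξ, its difference
  -- quotient there is entire, and dividing by ζ + ξ only introduces a pole at -ξ, below the sector.
  set p : ℂ → ℂ := fun ζ => Complex.exp (-ζ / y) * ζ * (ζ + ξ) / ξ - 2 * ξ * e with hp
  have hp0 : p ξ = 0 := by simp only [hp, ← he]; field_simp; ring
  have hpd : Differentiable ℂ p := by simp only [hp]; fun_prop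
  have hds : Differentiable ℂ (dslope p ξ) := by
    rw [← differentiableOn_univ] at hpd ⊢
    exact (Complex.differentiableOn_dslope univ_mem).2 hpd
  set G : ℂ → ℂ := fun ζ => dslope p ξ ζ / (ζ + ξ) with hG
  have hGeq : ∀ ζ, ζ ≠ ξ → ζ + ξ ≠ 0 → G ζ = Complex.exp (-ζ / y) * poleTerm ξ ζ -
      e * (2 * ξ / (ζ ^ 2 - ξ ^ 2)) := by
    intro ζ h1 h2
    have h3 : ζ - ξ ≠ 0 := sub_ne_zero.2 h1
    have h4 : ζ ^ 2 - ξ ^ 2 ≠ 0 := by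
      rw [sq_sub_sq]; exact mul_ne_zero h2 h3
    simp only [hG, dslope_of_ne _ h1, slope_def_field, hp0, poleTerm]
    simp only [hp]
    rw [show ζ ^ 2 - ξ ^ 2 = (ζ + ξ) * (ζ - ξ) by ring]
    field_simp
    ring
  have hplus : ∀ r : ℝ, 0 ≤ r → ∀ δ ∈ Set.Icc (-ε) ε,
      b ≤ ‖r * Complex.exp ((Real.pi / 2 + δ : ℝ) * Complex.I) + ξ‖ := fun r hr δ hδ =>
    norm_sub_ge_of_im_nonneg (ray_im_nonneg h.lt hδ hr)
  have hplus0 : ∀ r : ℝ, 0 ≤ r → ∀ δ ∈ Set.Icc (-ε) ε,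
      r * Complex.exp ((Real.pi / 2 + δ : ℝ) * Complex.I) + ξ ≠ 0 := by
    intro r hr δ hδ h0
    have := hplus r hr δ hδ
    rw [h0, norm_zero] at this
    linarith
  have hGd : ∀ ζ, ζ + ξ ≠ 0 → DifferentiableAt ℂ G ζ := fun ζ hζ =>
    DifferentiableAt.div (hds ζ) (by fun_prop) hζ
  -- Compactness handles r ≤ 2b, where the formula for G degenerates at ξ. For r ≥ 2b both |ζ - ξ|
  -- and |ζ + ξ| are at least r/2 and the two pieces are bounded separately.
  obtain ⟨C, hC0, hC⟩ : ∃ C : ℝ, 0 ≤ C ∧ ∀ r : ℝ, 0 < r → ∀ δ ∈ Set.Icc (-ε) ε,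
      ‖G (r * Complex.exp ((Real.pi / 2 + δ : ℝ) * Complex.I))‖ ≤ C / (1 + r ^ 2) := by
    have hcomp : IsCompact (Set.Icc (0 : ℝ) (2 * b) ×ˢ Set.Icc (-ε) ε) :=
      isCompact_Icc.prod isCompact_Icc
    obtain ⟨K, hK⟩ := hcomp.exists_bound_of_continuousOn
      (f := fun x : ℝ × ℝ => G (x.1 * Complex.exp ((Real.pi / 2 + x.2 : ℝ) * Complex.I))) (by
        intro x hx
        have h1 : ContinuousAt G ((x.1 : ℂ) * Complex.exp ((Real.pi / 2 + x.2 : ℝ) * Complex.I)) :=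
          (hGd _ (hplus0 _ hx.1.1 _ hx.2)).continuousAt
        have h2 : ContinuousAt (fun x : ℝ × ℝ =>
          (x.1 : ℂ) * Complex.exp ((Real.pi / 2 + x.2 : ℝ) * Complex.I)) x := by fun_prop
        exact (ContinuousAt.comp (f := fun x : ℝ × ℝ =>
          (x.1 : ℂ) * Complex.exp ((Real.pi / 2 + x.2 : ℝ) * Complex.I)) h1 h2).continuousWithinAt)
    have hcpos := h.c_pos
    refine ⟨|K| * (1 + 4 * b ^ 2) + (2 / b * (6 * Real.exp c / c ^ 3) +
      8 * b * ‖e‖ * (1 + 1 / b ^ 2)), by positivity, ?_⟩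
    intro r hr δ hδ
    rw [le_div_iff₀ (by positivity)]
    rcases le_total r (2 * b) with hrb | hrb
    · have h1 := hK (r, δ) ⟨⟨hr.le, hrb⟩, hδ⟩
      have h2 : 0 ≤ 2 / b * (6 * Real.exp c / c ^ 3) + 8 * b * ‖e‖ * (1 + 1 / b ^ 2) := by
        positivity
      calc _ ≤ |K| * (1 + (2 * b) ^ 2) := by
            gcongr
            exact h1.trans (le_abs_self K)
        _ ≤ _ := by nlinarith
    · have hnr := norm_ray r hr.le (Real.pi / 2 + δ)
      set ζ : ℂ := r * Complex.exp ((Real.pi / 2 + δ : ℝ) * Complex.I) with hζ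
      have hξn : ‖ξ‖ = b := by simp [hξdef, abs_of_pos hb]
      have hm : r / 2 ≤ ‖ζ - ξ‖ := by
        have := norm_sub_norm_le ζ ξ
        rw [hnr, hξn] at this
        linarith
      have hpl : r / 2 ≤ ‖ζ + ξ‖ := by
        have := norm_sub_norm_le ζ (-ξ)
        rw [hnr, norm_neg, hξn, sub_neg_eq_add] at this
        linarith
      have hne : ζ ≠ ξ := by
        intro h0
        rw [h0, sub_self, norm_zero] at hm
        linarith
      rw [hGeq ζ hne (hplus0 r hr.le δ hδ)]
      have hE := one_add_mul_exp_neg_le hcpos hr.le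
      have hE1 := norm_exp_neg_div_le h hδ hr.le
      rw [← hζ] at hE1
      clear_value ζ ξ
      have b1 : ‖Complex.exp (-ζ / y) * poleTerm ξ ζ‖ ≤ 2 / b * (6 * Real.exp c / c ^ 3 / (1 + r ^ 2)) := by
        rw [norm_mul, poleTerm, norm_div, norm_mul, hnr, hξn]
        calc _ ≤ Real.exp (-(c * r)) * (r / (b * (r / 2))) := by gcongr
          _ = 2 / b * (1 * Real.exp (-(c * r))) := by field_simp
          _ ≤ 2 / b * ((1 + r) * Real.exp (-(c * r))) := by gcongr; linarith
          _ ≤ _ := by gcongr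
      have b2 : ‖e * (2 * ξ / (ζ ^ 2 - ξ ^ 2))‖ ≤ 8 * b * ‖e‖ * (1 + 1 / b ^ 2) / (1 + r ^ 2) := by
        rw [sq_sub_sq, norm_mul, norm_div, norm_mul, norm_mul, hξn, Complex.norm_two]
        calc _ ≤ ‖e‖ * (2 * b / (r / 2 * (r / 2))) := by gcongr
          _ = 8 * b * ‖e‖ * (1 / r ^ 2) := by field_simp; ring
          _ ≤ 8 * b * ‖e‖ * ((1 + 1 / b ^ 2) / (1 + r ^ 2)) := by
            gcongr 8 * b * ‖e‖ * ?_
            rw [div_le_div_iff₀ (by positivity) (by positivity)]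
            have : 1 ≤ 1 / b ^ 2 * r ^ 2 := by
              rw [one_div, inv_mul_eq_div, one_le_div (by positivity)]
              nlinarith
            nlinarith
          _ = _ := by ring
      calc _ ≤ (2 / b * (6 * Real.exp c / c ^ 3 / (1 + r ^ 2)) +
            8 * b * ‖e‖ * (1 + 1 / b ^ 2) / (1 + r ^ 2)) * (1 + r ^ 2) := by
            gcongr
            exact (norm_sub_le _ _).trans (add_le_add b1 b2)
        _ = 2 / b * (6 * Real.exp c / c ^ 3) + 8 * b * ‖e‖ * (1 + 1 / b ^ 2) := by field_simp
        _ ≤ _ := by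
          have : 0 ≤ |K| * (1 + 4 * b ^ 2) := by positivity
          linarith
  have hε := h.pos
  have shift : ∀ θ ∈ Set.Icc (Real.pi / 2 - ε) (Real.pi / 2 + ε), ∃ δ ∈ Set.Icc (-ε) ε,
      θ = Real.pi / 2 + δ := fun θ hθ =>
    ⟨θ - Real.pi / 2, ⟨by linarith [hθ.1], by linarith [hθ.2]⟩, by ring⟩
  have hrot := integral_ray_eq_of_differentiable (G := G) (C := C)
    (α := Real.pi / 2 - ε) (β := Real.pi / 2 + ε) (by linarith)
    (fun r hr θ hθ => by
      obtain ⟨δ, hδ, rfl⟩ := shift θ hθ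
      exact hGd _ (hplus0 r hr.le δ hδ))
    (fun r hr θ hθ => by
      obtain ⟨δ, hδ, rfl⟩ := shift θ hθ
      exact hC r hr δ hδ)
  have hsplit : ∀ δ ∈ Set.Icc (-ε) ε, δ ≠ 0 → ∀ m : ℂ,
      Tendsto (fun r : ℝ => Complex.log ((1 - (r / b : ℂ) * Complex.exp (δ * Complex.I)) /
        (1 + (r / b : ℂ) * Complex.exp (δ * Complex.I)))) atTop (𝓝 m) →
      ∫ r in Set.Ioi (0 : ℝ), G (r * Complex.exp ((Real.pi / 2 + δ : ℝ) * Complex.I)) *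
        Complex.exp ((Real.pi / 2 + δ : ℝ) * Complex.I) =
      laplaceRay (poleTerm ξ) (Real.pi / 2 + δ) y - e * m := by
    intro δ hδ hδ0 m hm
    have hδlt : |δ| < Real.pi / 2 := (abs_le.2 hδ).trans_lt h.lt
    have hsin : Real.sin δ ≠ 0 :=
      (Real.sin_eq_zero_iff_of_lt_of_lt (by linarith [(abs_lt.1 hδlt).1, Real.pi_pos])
        (by linarith [(abs_lt.1 hδlt).2, Real.pi_pos])).not.2 hδ0
    have hi1 : IntegrableOn (laplaceIntegrand (poleTerm ξ) (Real.pi / 2 + δ) y) (Set.Ioi 0) :=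
      integrableOn_laplaceIntegrand h (C := 1 / (b ^ 2 * |Real.sin δ|)) (by positivity) hδ
        (fun r hr => (differentiableAt_poleTerm hξ (ray_ne_pole hb.ne' hsin)).continuousAt)
        (fun r hr => norm_poleTerm_le hb.ne' hsin hr.le)
    have hi2 := integrableOn_ray (G := G) (C := C) (θ := Real.pi / 2 + δ)
      (fun r hr => (hGd _ (hplus0 r hr.le δ hδ)).continuousAt) (fun r hr => hC r hr δ hδ)
    set L : ℝ → ℂ := fun r => 2 * (b * Complex.I) /
      (((r : ℂ) * Complex.exp ((Real.pi / 2 + δ : ℝ) * Complex.I)) ^ 2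
        - (b * Complex.I) ^ 2) * Complex.exp ((Real.pi / 2 + δ : ℝ) * Complex.I) with hL
    have heq : ∀ r ∈ Set.Ioi (0 : ℝ), G (r * Complex.exp ((Real.pi / 2 + δ : ℝ) * Complex.I)) *
        Complex.exp ((Real.pi / 2 + δ : ℝ) * Complex.I) =
        laplaceIntegrand (poleTerm ξ) (Real.pi / 2 + δ) y r - e * L r := by
      intro r hr
      rw [hGeq _ (ray_ne_pole hb.ne' hsin) (hplus0 r (le_of_lt hr) δ hδ)]
      simp only [hL, laplaceIntegrand, ← hξdef]
      ring
    -- The fraction is the difference of two functions already known to be integrable on the ray, so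
    -- no separate estimate is needed.
    have hi3 : IntegrableOn (fun r => e * L r) (Set.Ioi 0) := by
      refine (hi1.sub hi2).congr_fun (fun r hr => ?_) measurableSet_Ioi
      simp only [Pi.sub_apply, heq r hr]
      ring
    have he0 : e ≠ 0 := Complex.exp_ne_zero _
    have hi4 : IntegrableOn L (Set.Ioi 0) := by
      have := hi3.const_mul e⁻¹
      simp only [← mul_assoc, inv_mul_cancel₀ he0, one_mul] at this
      exact this
    have hLint : ∫ r in Set.Ioi (0 : ℝ), L r = m := by
      refine (integral_Ioi_of_hasDerivAt_of_tendsto'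
        (fun r hr => hasDerivAt_log_moebius hr hb hδ0 hδlt) hi4 hm).trans ?_
      simp
    rw [setIntegral_congr_fun measurableSet_Ioi heq, integral_sub hi1 hi3, integral_const_mul, hLint]
    rfl
  have hp1 := hsplit ε ⟨by linarith, le_rfl⟩ hε.ne' _ (tendsto_log_moebius_pos hb hε h.lt)
  have hp2 := hsplit (-ε) ⟨le_rfl, by linarith⟩ (by linarith) _
    (tendsto_log_moebius_neg hb (by linarith) (by linarith [h.lt]))
  simp only [← sub_eq_add_neg] at hp2
  rw [hp1, hp2] at hrot
  linear_combination -hrot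

end StrongWeak

namespace StrongWeak

/-! ### Series whose Borel transform has a Mittag-Leffler expansion with poles in `i κ ℤ` -/

/-- The Borel transform of `φ` has simple poles at `i κ l` with Stokes constants `A l`. The value
`A 0` is irrelevant, and the coefficient of the linear term is arbitrary. -/
structure MittagLefflerData (φ : PowerSeries ℂ) (κ : ℝ) (A : ℤ → ℂ) : Prop where
  pos : 0 < κ
  summable : Summable fun l : ℤ => ‖A l‖ / (l : ℝ) ^ 2
  coeff_zero : PowerSeries.coeff 0 φ = 0
  hasSum_coeff : ∀ n : ℕ, HasSum (fun l : ℤ => A l / (((κ * l : ℝ) : ℂ) * Complex.I) ^ (n + 2))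
    (2 * Real.pi * Complex.I * PowerSeries.coeff (n + 2) φ / ((n + 1).factorial : ℂ))

/-- The sum of the polar parts. -/
noncomputable def poleSum (κ : ℝ) (A : ℤ → ℂ) (ζ : ℂ) : ℂ :=
  ∑' l : ℤ, A l * poleTerm (((κ * l : ℝ) : ℂ) * Complex.I) ζ

variable {κ : ℝ} {A : ℤ → ℂ} {φ : PowerSeries ℂ}

lemma norm_pole (hκ : 0 < κ) (l : ℤ) : ‖((κ * l : ℝ) : ℂ) * Complex.I‖ = κ * |(l : ℝ)| := by
  rw [norm_mul, Complex.norm_I, mul_one, Complex.norm_real, Real.norm_eq_abs, abs_mul,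
    abs_of_pos hκ]

lemma pole_ne_zero (hκ : 0 < κ) {l : ℤ} (hl : l ≠ 0) : ((κ * l : ℝ) : ℂ) * Complex.I ≠ 0 :=
  mul_ne_zero (by exact_mod_cast mul_ne_zero hκ.ne' (Int.cast_ne_zero.2 hl)) Complex.I_ne_zero

lemma pole_injective (hκ : 0 < κ) {l k : ℤ}
    (h : ((κ * l : ℝ) : ℂ) * Complex.I = ((κ * k : ℝ) : ℂ) * Complex.I) : l = k := by
  have h1 := mul_right_cancel₀ Complex.I_ne_zero h
  have h2 : κ * l = κ * k := by exact_mod_cast h1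
  exact_mod_cast mul_left_cancel₀ hκ.ne' h2

/-- Far poles are at distance comparable to κ|l|, and the finitely many near ones are avoided by
shrinking the ball. Only indices with A_l ≠ 0 are excluded, so that a pole can be dropped by setting
its coefficient to zero. -/
lemma exists_pole_dist (hκ : 0 < κ) (z : ℂ)
    (hz : ∀ l : ℤ, l ≠ 0 → A l ≠ 0 → z ≠ ((κ * l : ℝ) : ℂ) * Complex.I) :
    ∃ δ c : ℝ, 0 < δ ∧ δ ≤ 1 ∧ 0 < c ∧ ∀ ζ ∈ Metric.ball z δ, ∀ l : ℤ, l ≠ 0 → A l ≠ 0 →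
      c * |(l : ℝ)| ≤ ‖ζ - ((κ * l : ℝ) : ℂ) * Complex.I‖ := by
  -- Chosen so that κL > 2(‖z‖ + 1): for |l| ≥ L, subtracting ‖ζ‖ ≤ ‖z‖ + 1 from κ|l| leaves at
  -- least κ|l|/2.
  obtain ⟨L, hL⟩ := exists_nat_gt ((2 * ‖z‖ + 2) / κ)
  have hL0 : 0 < (L : ℝ) := lt_trans (by positivity) hL
  rw [div_lt_iff₀ hκ] at hL
  have hev : ∀ᶠ δ in 𝓝[>] (0 : ℝ), ∀ l ∈ Finset.Ioo (-(L : ℤ)) L, l ≠ 0 → A l ≠ 0 →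
      2 * δ < ‖z - ((κ * l : ℝ) : ℂ) * Complex.I‖ := by
    rw [Finset.eventually_all]
    intro l _
    by_cases h : l ≠ 0 ∧ A l ≠ 0
    · have h1 : 0 < ‖z - ((κ * l : ℝ) : ℂ) * Complex.I‖ :=
        norm_pos_iff.2 (sub_ne_zero.2 (hz l h.1 h.2))
      have : Tendsto (fun δ : ℝ => 2 * δ) (𝓝[>] 0) (𝓝 0) := by
        have : Tendsto (fun δ : ℝ => 2 * δ) (𝓝 0) (𝓝 (2 * 0)) := (continuous_const_mul 2).tendsto 0
        rw [mul_zero] at this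
        exact this.mono_left nhdsWithin_le_nhds
      filter_upwards [this.eventually (gt_mem_nhds h1)] with δ hδ _ _ using hδ
    · refine Eventually.of_forall fun δ h1 h2 => absurd ⟨h1, h2⟩ h
  obtain ⟨δ, hδ, hδ0⟩ := (hev.and self_mem_nhdsWithin).exists
  replace hδ0 : 0 < δ := hδ0
  refine ⟨min δ 1, min (κ / 2) (δ / L), by positivity, min_le_right _ _, by positivity, ?_⟩
  intro ζ hζ l hl hA
  rw [Metric.mem_ball, dist_eq_norm, lt_min_iff] at hζ
  by_cases hlL : l ∈ Finset.Ioo (-(L : ℤ)) L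
  · have h1 := hδ l hlL hl hA
    have h2 : ‖z - ((κ * l : ℝ) : ℂ) * Complex.I‖ ≤ ‖ζ - ((κ * l : ℝ) : ℂ) * Complex.I‖ + ‖ζ - z‖ := by
      have := norm_sub_le (ζ - ((κ * l : ℝ) : ℂ) * Complex.I) (ζ - z)
      simpa using this
    have h3 : |(l : ℝ)| ≤ L := by
      rw [Finset.mem_Ioo] at hlL
      rw [abs_le]
      exact ⟨by exact_mod_cast hlL.1.le, by exact_mod_cast hlL.2.le⟩
    calc min (κ / 2) (δ / L) * |(l : ℝ)| ≤ δ / L * L := by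
          gcongr; exact min_le_right _ _
      _ = δ := by field_simp
      _ ≤ _ := by linarith
  · have h3 : (L : ℝ) ≤ |(l : ℝ)| := by
      rw [Finset.mem_Ioo, not_and_or, not_lt, not_lt] at hlL
      rw [le_abs]
      rcases hlL with h | h
      · right
        have : (l : ℝ) ≤ -L := by exact_mod_cast h
        linarith
      · left; exact_mod_cast h
    have h4 := norm_sub_norm_le (((κ * l : ℝ) : ℂ) * Complex.I) ζ
    rw [norm_pole hκ, norm_sub_rev] at h4
    have h5 : ‖ζ‖ ≤ ‖z‖ + 1 := by
      have := norm_sub_norm_le ζ z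
      linarith [hζ.2]
    have h6 : κ * L ≤ κ * |(l : ℝ)| := by gcongr
    calc min (κ / 2) (δ / L) * |(l : ℝ)| ≤ κ / 2 * |(l : ℝ)| := by
          gcongr; exact min_le_left _ _
      _ ≤ _ := by nlinarith

lemma poleTerm_zero_left (ζ : ℂ) : poleTerm 0 ζ = 0 := by simp [poleTerm]

lemma norm_mul_poleTerm_le {z ζ : ℂ} {c : ℝ} (hκ : 0 < κ) (hc : 0 < c)
    (hζ : ‖ζ‖ ≤ ‖z‖ + 1) {l : ℤ}
    (h : l ≠ 0 → A l ≠ 0 → c * |(l : ℝ)| ≤ ‖ζ - ((κ * l : ℝ) : ℂ) * Complex.I‖) :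
    ‖A l * poleTerm (((κ * l : ℝ) : ℂ) * Complex.I) ζ‖ ≤
      (‖z‖ + 1) / (κ * c) * (‖A l‖ / (l : ℝ) ^ 2) := by
  by_cases hl : l = 0
  · subst hl
    simp [poleTerm_zero_left]
  by_cases hA : A l = 0
  · simp [hA]
  have hl' : 0 < |(l : ℝ)| := abs_pos.2 (Int.cast_ne_zero.2 hl)
  have h1 := h hl hA
  rw [norm_mul, poleTerm, norm_div, norm_mul, norm_pole hκ, ← sq_abs (l : ℝ)]
  calc _ ≤ ‖A l‖ * ((‖z‖ + 1) / (κ * |(l : ℝ)| * (c * |(l : ℝ)|))) := by gcongr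
    _ = _ := by field_simp

lemma analyticAt_poleSum (hκ : 0 < κ) (hA : Summable fun l : ℤ => ‖A l‖ / (l : ℝ) ^ 2) (z : ℂ)
    (hz : ∀ l : ℤ, l ≠ 0 → A l ≠ 0 → z ≠ ((κ * l : ℝ) : ℂ) * Complex.I) :
    AnalyticAt ℂ (poleSum κ A) z := by
  obtain ⟨δ, c, hδ, hδ1, hc, h⟩ := exists_pole_dist hκ z hz
  have hd : DifferentiableOn ℂ (poleSum κ A) (Metric.ball z δ) := by
    refine Complex.differentiableOn_tsum_of_summable_norm
      (u := fun l => (‖z‖ + 1) / (κ * c) * (‖A l‖ / (l : ℝ) ^ 2)) (hA.mul_left _) ?_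
      Metric.isOpen_ball ?_
    · intro l ζ hζ
      by_cases hl : l = 0
      · subst hl
        simp only [Int.cast_zero, mul_zero, Complex.ofReal_zero, zero_mul, poleTerm_zero_left]
        exact differentiableWithinAt_const _
      by_cases hAl : A l = 0
      · simp only [hAl, zero_mul]
        exact differentiableWithinAt_const _
      refine (DifferentiableAt.const_mul (differentiableAt_poleTerm (pole_ne_zero hκ hl) ?_) _).differentiableWithinAt
      intro h0
      have h1 := h ζ hζ l hl hAl
      rw [h0, sub_self, norm_zero] at h1
      have : 0 < |(l : ℝ)| := abs_pos.2 (Int.cast_ne_zero.2 hl)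
      have := mul_pos hc this
      linarith
    · intro l ζ hζ
      refine norm_mul_poleTerm_le hκ hc ?_ (h ζ hζ l)
      have := norm_sub_norm_le ζ z
      rw [Metric.mem_ball, dist_eq_norm] at hζ
      linarith
  exact hd.analyticAt (Metric.isOpen_ball.mem_nhds (Metric.mem_ball_self hδ))

/-- Holds even at a pole: there the singular term is 0 by the convention for division by zero, so
its coefficient may be replaced by 0 and the previous bound applies. -/
lemma summable_poleSum (hκ : 0 < κ) (hA : Summable fun l : ℤ => ‖A l‖ / (l : ℝ) ^ 2) (z : ℂ) :
    Summable fun l : ℤ => A l * poleTerm (((κ * l : ℝ) : ℂ) * Complex.I) z := by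
  classical
  set A' : ℤ → ℂ := fun l => if z = ((κ * l : ℝ) : ℂ) * Complex.I then 0 else A l with hA'
  have heq : ∀ l, A l * poleTerm (((κ * l : ℝ) : ℂ) * Complex.I) z =
      A' l * poleTerm (((κ * l : ℝ) : ℂ) * Complex.I) z := by
    intro l
    simp only [hA']
    split_ifs with h
    · rw [← h]; simp [poleTerm]
    · rfl
  simp only [heq]
  have hle : ∀ l, ‖A' l‖ ≤ ‖A l‖ := by
    intro l
    simp only [hA']
    split_ifs <;> simp
  obtain ⟨δ, c, hδ, hδ1, hc, h⟩ := exists_pole_dist (A := A') hκ z (by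
    intro l _ h1 h2
    exact h1 (by simp [hA', h2]))
  refine Summable.of_norm_bounded (g := fun l => (‖z‖ + 1) / (κ * c) * (‖A l‖ / (l : ℝ) ^ 2))
    (hA.mul_left _) fun l => ?_
  refine (norm_mul_poleTerm_le hκ hc (by linarith) (h z (Metric.mem_ball_self hδ) l)).trans ?_
  gcongr
  exact hle l

lemma hasSum_poleTerm {ξ ζ : ℂ} (h : ‖ζ‖ < ‖ξ‖) :
    HasSum (fun n : ℕ => ζ ^ (n + 1) / ξ ^ (n + 2)) (-poleTerm ξ ζ) := by
  have hξ : ξ ≠ 0 := by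
    rintro rfl
    simp at h
    linarith [norm_nonneg ζ]
  have h1 : ‖ζ / ξ‖ < 1 := by
    rw [norm_div, div_lt_one (norm_pos_iff.2 hξ)]
    exact h
  have h2 := (hasSum_geometric_of_norm_lt_one h1).mul_left (ζ / ξ ^ 2)
  convert! h2 using 1
  · funext n
    rw [div_pow]
    field_simp
    ring
  · have h3 : ξ - ζ ≠ 0 := by
      intro h0
      rw [sub_eq_zero.1 h0] at h
      exact lt_irrefl _ h
    have h4 : ζ - ξ ≠ 0 := by rw [← neg_sub]; exact neg_ne_zero.2 h3
    have h5 : 1 - ζ / ξ ≠ 0 := by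
      rw [one_sub_div hξ]; exact div_ne_zero h3 hξ
    have h6 : 1 - ζ / ξ = -(ζ - ξ) / ξ := by field_simp; ring
    rw [poleTerm, h6]
    field_simp

/-! ### Gevrey bound, poles and discontinuity from the Mittag-Leffler expansion. -/

namespace MittagLefflerData

variable (h : MittagLefflerData φ κ A)

include h

/-- The analytic continuation of the Borel transform. -/
theorem germ : ∀ᶠ ζ in 𝓝 (0 : ℂ),
    HasSum (fun n : ℕ => PowerSeries.coeff n (borel φ) * ζ ^ n)
      (PowerSeries.coeff 1 φ - 1 / (2 * Real.pi * Complex.I) * poleSum κ A ζ) := by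
  have hκ := h.pos
  filter_upwards [Metric.ball_mem_nhds (0 : ℂ) hκ] with ζ hζ
  rw [mem_ball_zero_iff] at hζ
  set ξ : ℤ → ℂ := fun l => ((κ * l : ℝ) : ℂ) * Complex.I with hξ
  have hone : ∀ l : ℤ, l ≠ 0 → 1 ≤ |(l : ℝ)| := by
    intro l hl
    exact_mod_cast Int.one_le_abs hl
  -- For |ζ| < κ this double series over poles and powers of ζ converges absolutely. Summing over
  -- powers first gives the pole terms, summing over poles first gives the coefficients prescribed
  -- by the data.
  set u : ℤ × ℕ → ℂ := fun p => A p.1 * (ζ ^ (p.2 + 1) / ξ p.1 ^ (p.2 + 2)) with hu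
  have hus : Summable u := by
    have hg : Summable fun n : ℕ => (‖ζ‖ / κ) ^ n :=
      summable_geometric_of_lt_one (by positivity) ((div_lt_one hκ).2 hζ)
    have hprod := Summable.mul_of_nonneg (h.summable.mul_left (‖ζ‖ / κ ^ 2)) hg
      (fun l => by positivity) (fun n => by positivity)
    refine Summable.of_norm_bounded hprod fun p => ?_
    obtain ⟨l, n⟩ := p
    by_cases hl : l = 0
    · subst hl
      simp [hu, hξ]
    have hl1 := hone l hl
    have hul : ‖u (l, n)‖ = ‖A l‖ * (‖ζ‖ ^ (n + 1) / (κ * |(l : ℝ)|) ^ (n + 2)) := by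
      simp only [hu, hξ]
      rw [norm_mul, norm_div, norm_pow, norm_pow, norm_pole hκ]
    rw [hul]
    simp only
    rw [← sq_abs (l : ℝ)]
    calc ‖A l‖ * (‖ζ‖ ^ (n + 1) / (κ * |(l : ℝ)|) ^ (n + 2))
        ≤ ‖A l‖ * (‖ζ‖ ^ (n + 1) / (κ ^ n * (κ * |(l : ℝ)|) ^ 2)) := by
          gcongr
          rw [pow_add]
          gcongr
          nlinarith
      _ = _ := by
          rw [div_pow, mul_pow]
          field_simp
          ring
  have hfib : HasSum (fun l : ℤ => A l * -poleTerm (ξ l) ζ) (∑' p, u p) := by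
    refine HasSum.prod_fiberwise (f := u) hus.hasSum fun l => ?_
    change HasSum (fun n : ℕ => A l * (ζ ^ (n + 1) / ξ l ^ (n + 2))) (A l * -poleTerm (ξ l) ζ)
    by_cases hl : l = 0
    · subst hl
      simp [hξ, poleTerm_zero_left, hasSum_zero]
    · refine (hasSum_poleTerm ?_).mul_left (A l)
      rw [norm_pole hκ]
      nlinarith [hone l hl]
  have htot : ∑' p, u p = -poleSum κ A ζ := by
    rw [← hfib.tsum_eq, poleSum, ← tsum_neg]
    congr 1; funext l; ring
  have hfib2 : HasSum (fun n : ℕ => 2 * Real.pi * Complex.I * PowerSeries.coeff (n + 2) φ /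
      ((n + 1).factorial : ℂ) * ζ ^ (n + 1)) (∑' p, u p) := by
    have hsw : HasSum (u ∘ Prod.swap) (∑' p, u p) :=
      ((Equiv.prodComm ℕ ℤ).hasSum_iff (f := u)).2 hus.hasSum
    refine HasSum.prod_fiberwise (f := u ∘ Prod.swap) hsw fun n => ?_
    have := (h.hasSum_coeff n).mul_right (ζ ^ (n + 1))
    convert! this using 1
    funext l
    simp only [hu, hξ, Function.comp, Prod.swap]
    ring
  rw [htot] at hfib2
  have h2pi : (2 * Real.pi * Complex.I : ℂ) ≠ 0 := Complex.two_pi_I_ne_zero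
  -- The constant term of the Borel transform, which is the linear coefficient of φ, is not
  -- constrained by the data and is split off.
  rw [← hasSum_nat_add_iff' 1]
  have h3 := hfib2.mul_left (1 / (2 * Real.pi * Complex.I))
  convert! h3 using 1
  · funext n
    simp only [borel, PowerSeries.coeff_mk]
    field_simp
  · simp [borel]

/-- Since |l| ≥ 1, each power |κl|^(n+2) is at least κ^(n+2) l², so all coefficient sums are
dominated by κ^(-n-2) Σ ‖A_l‖ / l². The unconstrained linear coefficient only enlarges C. -/
theorem isGevreyOne : IsGevreyOne φ := by
  have hκ := h.pos
  refine ⟨h.coeff_zero, ‖PowerSeries.coeff 1 φ‖ + (∑' l : ℤ, ‖A l‖ / (l : ℝ) ^ 2) / (2 * Real.pi * κ) + 1,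
    1 / κ, ?_, by positivity, ?_⟩
  · have : 0 ≤ ∑' l : ℤ, ‖A l‖ / (l : ℝ) ^ 2 := tsum_nonneg fun l => by positivity
    positivity
  have hS : 0 ≤ ∑' l : ℤ, ‖A l‖ / (l : ℝ) ^ 2 := tsum_nonneg fun l => by positivity
  intro n
  cases n with
  | zero =>
    have : 0 ≤ (∑' l : ℤ, ‖A l‖ / (l : ℝ) ^ 2) / (2 * Real.pi * κ) := by positivity
    simp only [zero_add, pow_zero, mul_one, Nat.factorial_zero, Nat.cast_one]
    linarith
  | succ n =>
    have hb : ∀ l : ℤ, ‖A l / (((κ * l : ℝ) : ℂ) * Complex.I) ^ (n + 2)‖ ≤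
        (1 / κ) ^ (n + 2) * (‖A l‖ / (l : ℝ) ^ 2) := by
      intro l
      by_cases hl : l = 0
      · subst hl; simp
      have hl1 : 1 ≤ |(l : ℝ)| := by exact_mod_cast Int.one_le_abs hl
      rw [norm_div, norm_pow, norm_pole hκ, ← sq_abs (l : ℝ)]
      calc ‖A l‖ / (κ * |(l : ℝ)|) ^ (n + 2) ≤ ‖A l‖ / (κ ^ (n + 2) * |(l : ℝ)| ^ 2) := by
            rw [mul_pow]
            gcongr
            omega
        _ = _ := by rw [one_div, inv_pow]; field_simp
    have h1 := tsum_of_norm_bounded (h.summable.hasSum.mul_left ((1 / κ) ^ (n + 2))) hb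
    rw [(h.hasSum_coeff n).tsum_eq, norm_div, norm_mul, norm_mul, norm_mul, Complex.norm_I,
      Complex.norm_two, Complex.norm_real, Complex.norm_natCast, Real.norm_of_nonneg Real.pi_pos.le,
      mul_one, div_le_iff₀ (by positivity)] at h1
    have h2 : ‖PowerSeries.coeff (n + 1 + 1) φ‖ ≤
        (∑' l : ℤ, ‖A l‖ / (l : ℝ) ^ 2) / (2 * Real.pi * κ) * (1 / κ) ^ (n + 1) *
          ((n + 1).factorial : ℝ) := by
      have hpi := Real.pi_pos
      rw [← mul_le_mul_iff_right₀ (show 0 < 2 * Real.pi by positivity)]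
      refine h1.trans (le_of_eq ?_)
      rw [pow_succ (1 / κ) (n + 1)]
      field_simp
    refine h2.trans ?_
    gcongr
    have := norm_nonneg (PowerSeries.coeff 1 φ)
    linarith

theorem isBorelContinuation :
    IsBorelContinuation φ {z | ∃ l : ℤ, l ≠ 0 ∧ z = ((κ * l : ℝ) : ℂ) * Complex.I}
      (fun ζ => PowerSeries.coeff 1 φ - 1 / (2 * Real.pi * Complex.I) * poleSum κ A ζ) where
  zero_notMem := by
    rintro ⟨l, hl, h0⟩
    exact pole_ne_zero h.pos hl h0.symm
  locallyFinite r := by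
    refine Set.Finite.subset ((Set.finite_Icc (-(⌈r / κ⌉)) ⌈r / κ⌉).image
      fun l : ℤ => ((κ * l : ℝ) : ℂ) * Complex.I) ?_
    rintro z ⟨⟨l, hl, rfl⟩, hz⟩
    rw [mem_closedBall_zero_iff, norm_pole h.pos] at hz
    refine ⟨l, ?_, rfl⟩
    have h1 : |(l : ℝ)| ≤ ⌈r / κ⌉ := by
      refine le_trans ?_ (Int.le_ceil _)
      rw [le_div_iff₀ h.pos]
      linarith
    rw [abs_le] at h1
    exact ⟨by exact_mod_cast h1.1, by exact_mod_cast h1.2⟩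
  analytic z hz := by
    refine analyticAt_const.sub (analyticAt_const.mul (analyticAt_poleSum h.pos h.summable z ?_))
    rintro l hl _ rfl
    exact hz ⟨l, hl, rfl⟩
  germ := h.germ

/-- The term of index l is isolated by ζ/(ξ(ζ - ξ)) = 1/ξ + 1/(ζ - ξ); the remaining series is the
pole sum of the coefficients with A_l replaced by 0, hence analytic at ξ. -/
theorem hasStokesTower {ρ : ℤ → ℂ} (hρ : ∀ l, ρ l = ((κ * l : ℝ) : ℂ) * Complex.I) :
    HasStokesTower φ ρ A := by
  classical
  obtain rfl : ρ = fun l : ℤ => ((κ * l : ℝ) : ℂ) * Complex.I := funext hρ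
  refine ⟨_, h.isBorelContinuation, fun l hl => ?_⟩
  set ξ : ℂ := ((κ * l : ℝ) : ℂ) * Complex.I with hξ
  have hξ0 : ξ ≠ 0 := pole_ne_zero h.pos hl
  set A' : ℤ → ℂ := fun k => if k = l then 0 else A k with hA'
  have hA's : Summable fun k : ℤ => ‖A' k‖ / (k : ℝ) ^ 2 := by
    refine Summable.of_nonneg_of_le (fun k => by positivity) (fun k => ?_) h.summable
    gcongr
    simp only [hA']
    split_ifs <;> simp
  refine ⟨fun ζ => PowerSeries.coeff 1 φ - 1 / (2 * Real.pi * Complex.I) * (A l / ξ + poleSum κ A' ζ),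
    ?_, ?_⟩
  · refine analyticAt_const.sub (analyticAt_const.mul (analyticAt_const.add
      (analyticAt_poleSum h.pos hA's ξ ?_)))
    intro k _ hk h0
    refine hk ?_
    rw [hA']
    simp [pole_injective h.pos h0]
  · filter_upwards [self_mem_nhdsWithin] with ζ hζ
    have hζ' : ζ - ξ ≠ 0 := sub_ne_zero.2 hζ
    have h1 : poleSum κ A ζ = A l * poleTerm ξ ζ + poleSum κ A' ζ := by
      rw [poleSum, (summable_poleSum h.pos h.summable ζ).tsum_eq_add_tsum_ite l]
      congr 1
      rw [poleSum]
      congr 1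
      funext k
      simp only [hA']
      split_ifs <;> simp
    have h2 : poleTerm ξ ζ = 1 / ξ + 1 / (ζ - ξ) := by
      rw [poleTerm]; field_simp; ring
    have := Complex.two_pi_I_ne_zero
    have hpi : (Real.pi : ℂ) ≠ 0 := by exact_mod_cast Real.pi_ne_zero
    have hI := Complex.I_ne_zero
    rw [h1, h2]
    change _ = _ / (2 * Real.pi * Complex.I * (ζ - ξ)) + _
    clear_value ξ
    field_simp
    ring

/-- On a ray off the imaginary axis the pole terms are dominated by ‖A_l‖ / l² times an integrable
function, so Laplace integration and summation over the poles commute. The difference of the lateral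
sums is then taken pole by pole; the constant term has equal integrals on both rays. -/
theorem hasDiscontinuity {y v : ℂ} (hy : 0 < y.im)
    (hv : HasSum (fun l : ℕ => A ((l : ℤ) + 1) *
      Complex.exp (-(((κ * (l + 1) : ℝ) : ℂ) * Complex.I) / y)) v) :
    HasDiscontinuity φ (Real.pi / 2) y v := by
  have hκ := h.pos
  have hy0 : y ≠ 0 := by rintro rfl; simp at hy
  obtain ⟨c, hc⟩ := eventually_decaySector hy
  unfold HasDiscontinuity
  filter_upwards [hc] with ε hε
  have hε0 := hε.pos
  have hcpos := hε.c_pos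
  set ξ : ℤ → ℂ := fun l => ((κ * l : ℝ) : ℂ) * Complex.I with hξ
  set B : ℂ → ℂ := fun ζ => PowerSeries.coeff 1 φ - 1 / (2 * Real.pi * Complex.I) * poleSum κ A ζ
    with hB
  have main : ∀ δ ∈ Set.Icc (-ε) ε, Real.sin δ ≠ 0 →
      HasBorelLaplaceSum φ (Real.pi / 2 + δ) y (laplaceRay B (Real.pi / 2 + δ) y) ∧
      HasSum (fun l : ℤ => -(A l / (2 * Real.pi * Complex.I)) *
        laplaceRay (poleTerm (ξ l)) (Real.pi / 2 + δ) y)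
        (laplaceRay B (Real.pi / 2 + δ) y -
          laplaceRay (fun _ => PowerSeries.coeff 1 φ) (Real.pi / 2 + δ) y) := by
    intro δ hδ hs
    have hs' := abs_pos.2 hs
    have hnotin : ∀ r : ℝ, 0 < r → ∀ l : ℤ, l ≠ 0 →
        (r : ℂ) * Complex.exp ((Real.pi / 2 + δ : ℝ) * Complex.I) ≠ ξ l := fun r hr l hl =>
      ray_ne_pole (mul_ne_zero hκ.ne' (Int.cast_ne_zero.2 hl)) hs
    have hterm : ∀ r : ℝ, 0 < r → ∀ l : ℤ,
        ‖A l * poleTerm (ξ l) (r * Complex.exp ((Real.pi / 2 + δ : ℝ) * Complex.I))‖ ≤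
          1 / (κ ^ 2 * |Real.sin δ|) * (‖A l‖ / (l : ℝ) ^ 2) * (1 + r) := by
      intro r hr l
      by_cases hl : l = 0
      · subst hl; simp [hξ, poleTerm_zero_left]
      have hl' : (l : ℝ) ≠ 0 := Int.cast_ne_zero.2 hl
      rw [norm_mul]
      calc _ ≤ ‖A l‖ * (1 / ((κ * l) ^ 2 * |Real.sin δ|) * (1 + r)) := by
            gcongr
            exact norm_poleTerm_le (mul_ne_zero hκ.ne' hl') hs hr.le
        _ = _ := by field_simp
    have hS : 0 ≤ ∑' l : ℤ, ‖A l‖ / (l : ℝ) ^ 2 := tsum_nonneg fun l => by positivity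
    have hsumb : ∀ r : ℝ, 0 < r →
        ‖poleSum κ A (r * Complex.exp ((Real.pi / 2 + δ : ℝ) * Complex.I))‖ ≤
          1 / (κ ^ 2 * |Real.sin δ|) * (∑' l : ℤ, ‖A l‖ / (l : ℝ) ^ 2) * (1 + r) := fun r hr =>
      tsum_of_norm_bounded ((h.summable.hasSum.mul_left _).mul_right _) (hterm r hr)
    have hps : ∀ r : ℝ, 0 < r →
        ContinuousAt (poleSum κ A) (r * Complex.exp ((Real.pi / 2 + δ : ℝ) * Complex.I)) :=
      fun r hr => (analyticAt_poleSum hκ h.summable _ fun l hl _ => hnotin r hr l hl).continuousAt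
    have hint0 : IntegrableOn (laplaceIntegrand (fun _ => PowerSeries.coeff 1 φ)
        (Real.pi / 2 + δ) y) (Set.Ioi 0) :=
      integrableOn_laplaceIntegrand hε (C := ‖PowerSeries.coeff 1 φ‖) (norm_nonneg _) hδ
        (fun r hr => continuousAt_const)
        (fun r hr => by have := norm_nonneg (PowerSeries.coeff 1 φ); nlinarith)
    have hintP : IntegrableOn (laplaceIntegrand (poleSum κ A) (Real.pi / 2 + δ) y) (Set.Ioi 0) :=
      integrableOn_laplaceIntegrand hε (by positivity) hδ hps hsumb
    have hBeq : laplaceIntegrand B (Real.pi / 2 + δ) y = fun r =>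
        laplaceIntegrand (fun _ => PowerSeries.coeff 1 φ) (Real.pi / 2 + δ) y r -
          1 / (2 * Real.pi * Complex.I) * laplaceIntegrand (poleSum κ A) (Real.pi / 2 + δ) y r := by
      funext r
      simp only [laplaceIntegrand, hB]
      ring
    have hBint : IntegrableOn (laplaceIntegrand B (Real.pi / 2 + δ) y) (Set.Ioi 0) := by
      rw [hBeq]
      exact hint0.sub (hintP.const_mul _)
    refine ⟨⟨_, B, h.isBorelContinuation, ?_, ?_, hBint, rfl⟩, ?_⟩
    · rintro r hr ⟨l, hl, h0⟩
      exact hnotin r hr l hl h0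
    · exact re_exp_neg_mul_pos hcpos hy0 (hε.le_re δ hδ)
    · have hlb : ∀ l : ℤ, ∀ r ∈ Set.Ioi (0 : ℝ),
          ‖A l * laplaceIntegrand (poleTerm (ξ l)) (Real.pi / 2 + δ) y r‖ ≤
          1 / (κ ^ 2 * |Real.sin δ|) * (‖A l‖ / (l : ℝ) ^ 2) *
            (6 * Real.exp c / c ^ 3 / (1 + r ^ 2)) := by
        intro l r hr
        have e1 : A l * laplaceIntegrand (poleTerm (ξ l)) (Real.pi / 2 + δ) y r =
            (A l * poleTerm (ξ l) (r * Complex.exp ((Real.pi / 2 + δ : ℝ) * Complex.I))) *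
            Complex.exp (-(r * Complex.exp ((Real.pi / 2 + δ : ℝ) * Complex.I)) / y) *
            Complex.exp ((Real.pi / 2 + δ : ℝ) * Complex.I) := by
          simp only [laplaceIntegrand]; ring
        rw [e1, norm_mul, norm_mul, Complex.norm_exp_ofReal_mul_I, mul_one]
        calc _ ≤ 1 / (κ ^ 2 * |Real.sin δ|) * (‖A l‖ / (l : ℝ) ^ 2) * (1 + r) *
              Real.exp (-(c * r)) := by
              have hr' : 0 < r := hr
              gcongr
              · exact hterm r hr l
              · exact norm_exp_neg_div_le hε hδ (le_of_lt hr)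
          _ = 1 / (κ ^ 2 * |Real.sin δ|) * (‖A l‖ / (l : ℝ) ^ 2) * ((1 + r) *
              Real.exp (-(c * r))) := by ring
          _ ≤ _ := by
              gcongr
              exact one_add_mul_exp_neg_le hcpos (le_of_lt hr)
      have hti : ∀ l : ℤ, IntegrableOn
          (fun r => A l * laplaceIntegrand (poleTerm (ξ l)) (Real.pi / 2 + δ) y r) (Set.Ioi 0) := by
        intro l
        by_cases hl : l = 0
        · subst hl
          simp [hξ, poleTerm_zero_left, laplaceIntegrand]
        · have hl' : (l : ℝ) ≠ 0 := Int.cast_ne_zero.2 hl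
          exact (integrableOn_laplaceIntegrand hε (C := 1 / ((κ * l) ^ 2 * |Real.sin δ|))
            (by positivity) hδ
            (fun r hr => (differentiableAt_poleTerm (pole_ne_zero hκ hl)
              (hnotin r hr l hl)).continuousAt)
            (fun r hr => norm_poleTerm_le (mul_ne_zero hκ.ne' hl') hs hr.le)).const_mul (A l)
      have hgi : IntegrableOn (fun r : ℝ => 6 * Real.exp c / c ^ 3 / (1 + r ^ 2)) (Set.Ioi 0) := by
        have := (integrable_inv_one_add_sq.const_mul (6 * Real.exp c / c ^ 3)).integrableOn
          (s := Set.Ioi (0 : ℝ))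
        simpa only [div_eq_mul_inv] using this
      have hsum := hasSum_integral_of_summable_integral_norm hti (by
        refine Summable.of_nonneg_of_le (fun l => integral_nonneg fun r => norm_nonneg _)
          (fun l => ?_) ((h.summable.mul_left (1 / (κ ^ 2 * |Real.sin δ|))).mul_right
            (∫ r in Set.Ioi (0 : ℝ), 6 * Real.exp c / c ^ 3 / (1 + r ^ 2)))
        rw [← integral_const_mul]
        exact setIntegral_mono_on (hti l).norm (hgi.const_mul _) measurableSet_Ioi (hlb l))
      have hP : ∫ r in Set.Ioi (0 : ℝ), ∑' l : ℤ,
          A l * laplaceIntegrand (poleTerm (ξ l)) (Real.pi / 2 + δ) y r =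
          laplaceRay (poleSum κ A) (Real.pi / 2 + δ) y := by
        unfold laplaceRay
        congr 1
        funext r
        simp only [laplaceIntegrand, poleSum]
        rw [mul_assoc, mul_comm (tsum _), ← mul_assoc, ← tsum_mul_left]
        congr 1
        funext l
        ring
      rw [hP] at hsum
      have hval : laplaceRay B (Real.pi / 2 + δ) y -
          laplaceRay (fun _ => PowerSeries.coeff 1 φ) (Real.pi / 2 + δ) y =
          -(1 / (2 * Real.pi * Complex.I)) * laplaceRay (poleSum κ A) (Real.pi / 2 + δ) y := by
        simp only [laplaceRay]
        rw [hBeq, integral_sub hint0 (hintP.const_mul _), integral_const_mul]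
        ring
      rw [hval]
      have := hsum.mul_left (-(1 / (2 * Real.pi * Complex.I : ℂ)))
      convert! this using 1
      funext l
      rw [integral_const_mul]
      simp only [laplaceRay]
      ring
  obtain ⟨hp1, hp2⟩ := main ε ⟨by linarith, le_rfl⟩ hε.sin_pos.ne'
  obtain ⟨hm1, hm2⟩ := main (-ε) ⟨le_rfl, by linarith⟩ (by
    rw [Real.sin_neg]; exact neg_ne_zero.2 hε.sin_pos.ne')
  simp only [← sub_eq_add_neg (Real.pi / 2) ε] at hm1 hm2
  refine ⟨_, _, hp1, hm1, ?_⟩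
  have hconst : laplaceRay (fun _ => PowerSeries.coeff 1 φ) (Real.pi / 2 + ε) y =
      laplaceRay (fun _ => PowerSeries.coeff 1 φ) (Real.pi / 2 - ε) y :=
    laplaceRay_eq_of_norm_le hε (C := ‖PowerSeries.coeff 1 φ‖) (norm_nonneg _)
      (fun r hr δ hδ => differentiableAt_const _)
      (fun r hr δ hδ => by have := norm_nonneg (PowerSeries.coeff 1 φ); nlinarith)
  have hdiff := hp2.sub hm2
  rw [hconst, sub_sub_sub_cancel_right] at hdiff
  have hinj : Function.Injective (fun l : ℕ => (l : ℤ) + 1) := fun a b hab => by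
    simpa using hab
  rw [← hinj.hasSum_iff] at hdiff
  · refine hdiff.unique ?_
    convert! hv using 1
    funext l
    have hb : 0 < κ * ((l : ℝ) + 1) := by positivity
    have h1 := laplaceRay_poleTerm_of_pos hε hb
    have h2pi := Complex.two_pi_I_ne_zero
    simp only [Function.comp, hξ]
    push_cast at h1 ⊢
    rw [← mul_sub, h1]
    field_simp
  -- Negative indices have their poles below the real axis and contribute nothing; index 0 has
  -- `poleTerm 0 = 0` by convention.
  · intro l hl
    rcases lt_trichotomy l 0 with hl0 | rfl | hl0
    · have hb : κ * (l : ℝ) < 0 := mul_neg_of_pos_of_neg hκ (by exact_mod_cast hl0)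
      rw [← mul_sub, hξ, laplaceRay_poleTerm_of_neg hε hb, sub_self, mul_zero]
    · simp [hξ, poleTerm_zero_left, laplaceRay, laplaceIntegrand]
    · exact absurd ⟨(l - 1).toNat, by simp; omega⟩ hl

end MittagLefflerData

end StrongWeak

namespace StrongWeak

/-! ### Euler–Maclaurin summation with Bernoulli polynomials -/

/-- `B_n(x) / n!` as a complex number. -/
noncomputable def bernoulliCoeff (n : ℕ) (x : ℝ) : ℂ := ((bernoulliFun n x / n.factorial : ℝ) : ℂ)

/-- Mean zero gives E(x) = ∫ (E(x) - E(t)) dt, and each difference is at most K|x - t| ≤ K. Every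
step of the Euler–Maclaurin induction is this estimate. -/
lemma norm_le_of_integral_eq_zero {E E' : ℝ → ℂ} {K : ℝ}
    (hE : ∀ t ∈ Set.Icc (0 : ℝ) 1, HasDerivAt E (E' t) t)
    (hK : ∀ t ∈ Set.Icc (0 : ℝ) 1, ‖E' t‖ ≤ K) (h0 : ∫ t in (0 : ℝ)..1, E t = 0)
    {x : ℝ} (hx : x ∈ Set.Icc (0 : ℝ) 1) : ‖E x‖ ≤ K := by
  have hK0 : 0 ≤ K := (norm_nonneg _).trans (hK x hx)
  have hcont : ContinuousOn E (Set.uIcc 0 1) := by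
    rw [Set.uIcc_of_le zero_le_one]
    exact fun t ht => (hE t ht).continuousAt.continuousWithinAt
  have h1 : ∫ t in (0 : ℝ)..1, (E x - E t) = E x := by
    rw [intervalIntegral.integral_sub intervalIntegrable_const hcont.intervalIntegrable, h0]
    simp
  rw [← h1]
  have h2 := intervalIntegral.norm_integral_le_of_norm_le_const (a := (0 : ℝ)) (b := 1) (C := K)
    (f := fun t => E x - E t) (by
      intro t ht
      rw [Set.uIoc_of_le zero_le_one] at ht
      have ht' : t ∈ Set.Icc (0 : ℝ) 1 := ⟨ht.1.le, ht.2⟩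
      have h3 := (convex_Icc (0 : ℝ) 1).norm_image_sub_le_of_norm_hasDerivWithin_le
        (fun t ht => (hE t ht).hasDerivWithinAt) hK ht' hx
      refine h3.trans (mul_le_of_le_one_right hK0 ?_)
      rw [Real.norm_eq_abs, abs_le]
      exact ⟨by linarith [hx.1, ht.2], by linarith [hx.2, ht.1]⟩)
  simpa using h2

lemma hasDerivAt_bernoulliCoeff (n : ℕ) (x : ℝ) :
    HasDerivAt (bernoulliCoeff (n + 1)) (bernoulliCoeff n x) x := by
  have h1 := ((hasDerivAt_bernoulliFun (n + 1) x).div_const ((n + 1).factorial : ℝ)).ofReal_comp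
  convert! h1 using 1
  rw [bernoulliCoeff]
  congr 1
  rw [Nat.factorial_succ, Nat.add_sub_cancel]
  push_cast
  field_simp

/-- The error has mean zero, because B_n does for n ≥ 1, and its derivative is the error of order
one less for f', because B_(n+1)' = (n + 1) B_n. The bound on the top derivative therefore passes
down through the induction without loss. -/
theorem norm_eulerMaclaurin_unit_le (M : ℕ) (f : ℕ → ℝ → ℂ) (K : ℝ)
    (hf : ∀ n ≤ M, ∀ t ∈ Set.Icc (0 : ℝ) 1, HasDerivAt (f n) (f (n + 1) t) t)
    (hK : ∀ t ∈ Set.Icc (0 : ℝ) 1, ‖f (M + 1) t‖ ≤ K) {x : ℝ} (hx : x ∈ Set.Icc (0 : ℝ) 1) :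
    ‖f 0 x - (∫ t in (0 : ℝ)..1, f 0 t) -
      ∑ n ∈ Finset.range M, bernoulliCoeff (n + 1) x * (f n 1 - f n 0)‖ ≤ K := by
  induction M generalizing f x with
  | zero =>
    simp only [Finset.range_zero, Finset.sum_empty, sub_zero]
    have hcont : ContinuousOn (f 0) (Set.uIcc 0 1) := by
      rw [Set.uIcc_of_le zero_le_one]
      exact fun t ht => (hf 0 le_rfl t ht).continuousAt.continuousWithinAt
    refine norm_le_of_integral_eq_zero (E := fun x => f 0 x - ∫ t in (0 : ℝ)..1, f 0 t)
      (fun t ht => (hf 0 le_rfl t ht).sub_const _) hK ?_ hx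
    rw [intervalIntegral.integral_sub hcont.intervalIntegrable intervalIntegrable_const]
    simp
  | succ M ih =>
    have hcont : ∀ n ≤ M + 1, ContinuousOn (f n) (Set.uIcc 0 1) := by
      intro n hn
      rw [Set.uIcc_of_le zero_le_one]
      exact fun t ht => (hf n hn t ht).continuousAt.continuousWithinAt
    refine norm_le_of_integral_eq_zero (E := fun x => f 0 x - (∫ t in (0 : ℝ)..1, f 0 t) -
      ∑ n ∈ Finset.range (M + 1), bernoulliCoeff (n + 1) x * (f n 1 - f n 0))
      (E' := fun x => f 1 x - (∫ t in (0 : ℝ)..1, f 1 t) -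
      ∑ n ∈ Finset.range M, bernoulliCoeff (n + 1) x * (f (n + 1) 1 - f (n + 1) 0)) ?_ ?_ ?_ hx
    · intro t ht
      have h1 := ((hf 0 (Nat.zero_le _) t ht).sub_const (∫ t in (0 : ℝ)..1, f 0 t)).sub
        (HasDerivAt.fun_sum (u := Finset.range (M + 1)) fun n _ =>
          (hasDerivAt_bernoulliCoeff n t).mul_const (f n 1 - f n 0))
      convert! h1 using 1
      -- The n = 0 term of the differentiated sum is f 0 1 - f 0 0, which is the integral of f 1
      -- needed in the error one order lower.
      rw [Finset.sum_range_succ', intervalIntegral.integral_eq_sub_of_hasDerivAt (f := f 0)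
        (fun t ht => hf 0 (Nat.zero_le _) t (by rwa [Set.uIcc_of_le zero_le_one] at ht))
        (hcont 1 (by omega)).intervalIntegrable]
      have : bernoulliCoeff 0 t = 1 := by simp [bernoulliCoeff]
      rw [this]
      ring
    · intro t ht
      exact ih (fun n => f (n + 1)) (fun n hn t ht => hf (n + 1) (by omega) t ht) hK ht
    · have hbc : ∀ n, Continuous (bernoulliCoeff (n + 1)) := fun n =>
        continuous_iff_continuousAt.2 fun t => (hasDerivAt_bernoulliCoeff n t).continuousAt
      rw [intervalIntegral.integral_sub, intervalIntegral.integral_sub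
        (hcont 0 (by omega)).intervalIntegrable intervalIntegrable_const,
        intervalIntegral.integral_finsetSum]
      · have : ∀ n ∈ Finset.range (M + 1), ∫ x in (0 : ℝ)..1, bernoulliCoeff (n + 1) x *
            (f n 1 - f n 0) = 0 := by
          intro n _
          rw [intervalIntegral.integral_mul_const]
          have : ∫ x in (0 : ℝ)..1, bernoulliCoeff (n + 1) x = 0 := by
            simp only [bernoulliCoeff]
            rw [intervalIntegral.integral_ofReal, intervalIntegral.integral_div,
              integral_bernoulliFun_eq_zero (by omega)]
            simp
          rw [this, zero_mul]
        rw [Finset.sum_eq_zero this]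
        simp
      · exact fun n _ => ((hbc n).mul continuous_const).intervalIntegrable _ _
      · exact (hcont 0 (by omega)).intervalIntegrable.sub intervalIntegrable_const
      · exact (continuous_finsetSum _ fun n _ => (hbc n).mul continuous_const).intervalIntegrable _ _

/-- Add the unit-interval estimates: integrals concatenate and boundary terms telescope. -/
theorem norm_eulerMaclaurin_le (M : ℕ) (f : ℕ → ℝ → ℂ) (K : ℕ → ℝ)
    (hf : ∀ n ≤ M, ∀ t : ℝ, 0 ≤ t → HasDerivAt (f n) (f (n + 1) t) t)
    (hK : ∀ j : ℕ, ∀ t ∈ Set.Icc (j : ℝ) (j + 1), ‖f (M + 1) t‖ ≤ K j) {x : ℝ}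
    (hx : x ∈ Set.Icc (0 : ℝ) 1) (J : ℕ) :
    ‖∑ j ∈ Finset.range J, f 0 (j + x) - (∫ t in (0 : ℝ)..J, f 0 t) -
      ∑ n ∈ Finset.range M, bernoulliCoeff (n + 1) x * (f n J - f n 0)‖ ≤
      ∑ j ∈ Finset.range J, K j := by
  induction J with
  | zero => simp
  | succ J ih =>
    have hint : ∀ a b : ℝ, 0 ≤ a → 0 ≤ b → IntervalIntegrable (f 0) volume a b := by
      intro a b ha hb
      refine ContinuousOn.intervalIntegrable fun t ht => ?_
      refine (hf 0 (Nat.zero_le _) t ?_).continuousAt.continuousWithinAt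
      rcases le_total a b with h | h
      · rw [Set.uIcc_of_le h] at ht; linarith [ht.1]
      · rw [Set.uIcc_of_ge h] at ht; linarith [ht.1]
    have hJ : (0 : ℝ) ≤ J := Nat.cast_nonneg J
    have h1 := norm_eulerMaclaurin_unit_le M (fun n t => f n (t + J)) (K J) (by
        intro n hn t ht
        exact (hf n hn (t + J) (by linarith [ht.1])).comp_add_const t J) (by
        intro t ht
        exact hK J _ ⟨by linarith [ht.1], by linarith [ht.2]⟩) hx
    rw [intervalIntegral.integral_comp_add_right (fun t => f 0 t)] at h1
    rw [Finset.sum_range_succ, Finset.sum_range_succ]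
    have h2 := (norm_add_le _ _).trans (add_le_add ih h1)
    refine le_trans (le_of_eq ?_) h2
    congr 1
    push_cast
    rw [← intervalIntegral.integral_add_adjacent_intervals (hint 0 J le_rfl hJ)
      (hint J (J + 1) hJ (by linarith))]
    simp only [zero_add, add_comm (1 : ℝ) (J : ℝ), add_comm x (J : ℝ)]
    have h3 : ∑ n ∈ Finset.range M, bernoulliCoeff (n + 1) x * (f n (J + 1) - f n 0) =
        ∑ n ∈ Finset.range M, bernoulliCoeff (n + 1) x * (f n J - f n 0) +
        ∑ n ∈ Finset.range M, bernoulliCoeff (n + 1) x * (f n (J + 1) - f n J) := by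
      rw [← Finset.sum_add_distrib]
      refine Finset.sum_congr rfl fun n _ => ?_
      ring
    rw [h3]
    ring

/-! ### Logarithms of entire functions in the right half-plane -/

/-- An entire function with values in the slit plane on the right half-plane and at the origin,
with controlled logarithmic derivative. -/
structure SectorLog (q : ℂ → ℂ) : Prop where
  differentiable : Differentiable ℂ q
  zero_mem : q 0 ∈ Complex.slitPlane
  mem : ∀ w : ℂ, 0 < w.re → q w ∈ Complex.slitPlane
  norm_le : ∀ w : ℂ, 0 < w.re → ‖logDeriv q w‖ ≤ 2 / w.re

/-- Closed sector `|Im w| ≤ c Re w` without the origin. -/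
def rightSector (c : ℝ) : Set ℂ := {w | 0 < w.re ∧ |w.im| ≤ c * w.re}

lemma norm_le_of_mem_rightSector {c : ℝ} {w : ℂ} (hw : w ∈ rightSector c) :
    ‖w‖ ≤ (1 + c) * w.re := by
  have := Complex.norm_le_abs_re_add_abs_im w
  rw [abs_of_pos hw.1] at this
  linarith [hw.2]

lemma smul_mem_rightSector {c : ℝ} {s : ℂ} (hs : s ∈ rightSector c) {t : ℝ} (ht : 0 < t) :
    s * t ∈ rightSector c := by
  refine ⟨?_, ?_⟩
  · rw [Complex.re_mul_ofReal]; exact mul_pos hs.1 ht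
  · rw [Complex.re_mul_ofReal, Complex.im_mul_ofReal, abs_mul, abs_of_pos ht]
    have := mul_le_mul_of_nonneg_right hs.2 ht.le
    linarith

namespace SectorLog

variable {q : ℂ → ℂ} (h : SectorLog q)
include h

lemma ne_zero {w : ℂ} (hw : w = 0 ∨ 0 < w.re) : q w ≠ 0 := by
  rcases hw with rfl | hw
  · exact Complex.slitPlane_ne_zero h.zero_mem
  · exact Complex.slitPlane_ne_zero (h.mem w hw)

lemma analyticAt_logDeriv {w : ℂ} (hw : q w ≠ 0) : AnalyticAt ℂ (logDeriv q) w :=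
  (h.differentiable.analyticAt w).deriv.div (h.differentiable.analyticAt w) hw

lemma hasDerivAt_iteratedDeriv {w : ℂ} (hw : q w ≠ 0) (n : ℕ) :
    HasDerivAt (iteratedDeriv n (logDeriv q)) (iteratedDeriv (n + 1) (logDeriv q) w) w := by
  rw [iteratedDeriv_succ, iteratedDeriv_eq_iterate]
  exact ((h.analyticAt_logDeriv hw).iterated_deriv n).differentiableAt.hasDerivAt

/-- Near the origin this is compactness. Elsewhere Cauchy's estimate is used on the disc of radius
Re w / 2, where the logarithmic derivative is at most 4 / Re w (hence the 2^(n+2) in C2); in the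
sector, away from 0, Re w is comparable to 1 + |w|. -/
lemma exists_norm_iteratedDeriv_le {c : ℝ} (hc : 0 < c) (n : ℕ) :
    ∃ C : ℝ, 0 < C ∧ ∀ w : ℂ, (w = 0 ∨ w ∈ rightSector c) →
      ‖iteratedDeriv n (logDeriv q) w‖ ≤ C / (1 + ‖w‖) ^ (n + 1) := by
  obtain ⟨ρ, hρ, hball⟩ : ∃ ρ : ℝ, 0 < ρ ∧ ∀ w ∈ Metric.closedBall (0 : ℂ) ρ, q w ≠ 0 := by
    have h1 : ∀ᶠ w in 𝓝 (0 : ℂ), q w ≠ 0 :=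
      h.differentiable.continuous.continuousAt.eventually_ne (h.ne_zero (Or.inl rfl))
    obtain ⟨ρ, hρ, hb⟩ := Metric.eventually_nhds_iff_ball.1 h1
    exact ⟨ρ / 2, by positivity, fun w hw => hb w (Metric.closedBall_subset_ball (by linarith) hw)⟩
  obtain ⟨K, hK⟩ := (isCompact_closedBall (0 : ℂ) ρ).exists_bound_of_continuousOn
    (f := iteratedDeriv n (logDeriv q)) fun w hw =>
      (h.hasDerivAt_iteratedDeriv (hball w hw) n).continuousAt.continuousWithinAt
  set C1 : ℝ := |K| * (1 + ρ) ^ (n + 1) with hC1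
  set C2 : ℝ := n.factorial * 2 ^ (n + 2) * ((1 + c) * (1 / ρ + 1)) ^ (n + 1) with hC2
  have hC2pos : 0 < C2 := by positivity
  refine ⟨C1 + C2, by positivity, fun w hw => ?_⟩
  rw [le_div_iff₀ (by positivity)]
  rcases le_total ‖w‖ ρ with hwρ | hwρ
  · calc _ ≤ |K| * (1 + ρ) ^ (n + 1) := by
          gcongr
          exact (hK w (mem_closedBall_zero_iff.2 hwρ)).trans (le_abs_self K)
      _ ≤ _ := by rw [← hC1]; linarith
  · have hw' : w ∈ rightSector c := by
      rcases hw with rfl | hw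
      · rw [norm_zero] at hwρ; linarith
      · exact hw
    have hre := hw'.1
    have hcauchy := Complex.norm_iteratedDeriv_le_of_forall_mem_sphere_norm_le (c := w)
      (R := w.re / 2) (C := 4 / w.re) (f := logDeriv q) n (by positivity) (by
        refine DifferentiableOn.diffContOnCl fun z hz => ?_
        rw [closure_ball _ (by positivity)] at hz
        refine (h.analyticAt_logDeriv (h.ne_zero (Or.inr ?_))).differentiableAt.differentiableWithinAt
        have := (Complex.abs_re_le_norm (z - w)).trans (by simpa [dist_eq_norm] using hz)
        rw [Complex.sub_re, abs_le] at this
        linarith [this.1]) (by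
        intro z hz
        have h1 := (Complex.abs_re_le_norm (z - w)).trans
          (by simpa [dist_eq_norm] using (Metric.sphere_subset_closedBall hz))
        rw [Complex.sub_re, abs_le] at h1
        have h2 : w.re / 2 ≤ z.re := by linarith [h1.1]
        refine (h.norm_le z (by linarith)).trans ?_
        rw [div_le_div_iff₀ (by linarith) hre]
        linarith)
    have hnorm : 1 + ‖w‖ ≤ (1 + c) * (1 / ρ + 1) * w.re := by
      have h1 : 1 ≤ 1 / ρ * ‖w‖ := by
        rw [one_div, inv_mul_eq_div, one_le_div hρ]; exact hwρ
      have h2 := norm_le_of_mem_rightSector hw'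
      calc 1 + ‖w‖ ≤ (1 / ρ + 1) * ‖w‖ := by linarith
        _ ≤ (1 / ρ + 1) * ((1 + c) * w.re) := by gcongr
        _ = _ := by ring
    calc _ ≤ n.factorial * (4 / w.re) / (w.re / 2) ^ n *
          ((1 + c) * (1 / ρ + 1) * w.re) ^ (n + 1) := by gcongr
      _ = C2 := by
          rw [hC2, mul_pow _ w.re, div_pow]
          field_simp
          ring
      _ ≤ _ := by
          have : 0 ≤ C1 := by positivity
          linarith

end SectorLog

/-- Comparison with a telescoping sum. The bound is O(1/a) for small a: summation along the ray
costs one power of the step. -/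
lemma sum_inv_one_add_mul_sq_le {a : ℝ} (ha : 0 < a) (J : ℕ) :
    ∑ j ∈ Finset.range J, 1 / (1 + a * j) ^ 2 ≤ 1 + 1 / a := by
  have key : ∀ J : ℕ, ∑ j ∈ Finset.range (J + 1), 1 / (1 + a * j) ^ 2 ≤
      1 + 1 / a - 1 / (a * (1 + a * J)) := by
    intro J
    induction J with
    | zero => simp
    | succ J ih =>
      rw [Finset.sum_range_succ]
      have h1 : 1 / (1 + a * ((J + 1 : ℕ) : ℝ)) ^ 2 ≤
          1 / (a * (1 + a * J)) - 1 / (a * (1 + a * ((J + 1 : ℕ) : ℝ))) := by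
        push_cast
        have hJ : (0 : ℝ) ≤ J := Nat.cast_nonneg J
        have hp : 0 < 1 + a * J := by positivity
        have e : 1 / (a * (1 + a * J)) - 1 / (a * (1 + a * (J + 1))) =
            1 / ((1 + a * J) * (1 + a * (J + 1))) := by
          field_simp; ring
        rw [e]
        apply one_div_le_one_div_of_le (by positivity)
        rw [sq]
        gcongr
        linarith
      linarith
  refine le_trans ?_ ((key J).trans ?_)
  · exact Finset.sum_le_sum_of_subset_of_nonneg (Finset.range_mono (Nat.le_succ J))
      fun _ _ _ => by positivity
  · have : 0 ≤ 1 / (a * (1 + a * J)) := by positivity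
    linarith

/-- Euler–Maclaurin for t ↦ log q(st), whose n-th derivative for n ≥ 1 is sⁿ times the (n-1)-st
derivative of q'/q. Boundary terms at infinity vanish from the first derivative on. The B_1 term is
kept inside the limit L, since log q itself need not tend to 0; L is the regularised sum. -/
theorem SectorLog.exists_norm_eulerMaclaurin_le {q : ℂ → ℂ} (h : SectorLog q) {c : ℝ} (hc : 0 < c)
    (M : ℕ) : ∃ C : ℝ, 0 < C ∧ ∀ s ∈ rightSector c, ‖s‖ ≤ 1 → ∀ x ∈ Set.Icc (0 : ℝ) 1, ∀ L : ℂ,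
      Tendsto (fun J : ℕ => ∑ j ∈ Finset.range J, Complex.log (q (s * ((j + x : ℝ) : ℂ))) -
        (∫ u in (0 : ℝ)..J, Complex.log (q (s * u))) -
        bernoulliCoeff 1 x * (Complex.log (q (s * J)) - Complex.log (q 0))) atTop (𝓝 L) →
      ‖L + ∑ n ∈ Finset.range M, bernoulliCoeff (n + 2) x * s ^ (n + 1) *
        iteratedDeriv n (logDeriv q) 0‖ ≤ C * ‖s‖ ^ (M + 1) := by
  obtain ⟨C, hC, hbd⟩ := h.exists_norm_iteratedDeriv_le hc (M + 1)
  refine ⟨2 * C, by positivity, fun s hs hs1 x hx L hL => ?_⟩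
  have hs0 : s ≠ 0 := by rintro rfl; simpa using hs.1
  have hns : 0 < ‖s‖ := norm_pos_iff.2 hs0
  have hray : ∀ t : ℝ, 0 ≤ t → s * (t : ℂ) = 0 ∨ s * (t : ℂ) ∈ rightSector c := by
    intro t ht
    rcases ht.eq_or_lt with rfl | ht
    · left; simp
    · right; exact smul_mem_rightSector hs ht
  have hq : ∀ t : ℝ, 0 ≤ t → q (s * t) ≠ 0 := fun t ht =>
    h.ne_zero ((hray t ht).imp id fun h => h.1)
  have hslit : ∀ t : ℝ, 0 ≤ t → q (s * t) ∈ Complex.slitPlane := by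
    intro t ht
    rcases hray t ht with h0 | h0
    · rw [h0]; exact h.zero_mem
    · exact h.mem _ h0.1
  set f : ℕ → ℝ → ℂ := fun n => match n with
    | 0 => fun t => Complex.log (q (s * t))
    | n + 1 => fun t => s ^ (n + 1) * iteratedDeriv n (logDeriv q) (s * t) with hf
  have hlin : ∀ t : ℝ, HasDerivAt (fun t : ℝ => s * (t : ℂ)) s t := by
    intro t
    simpa using (Complex.ofRealCLM.hasDerivAt (x := t)).const_mul s
  have hderiv : ∀ n, ∀ t : ℝ, 0 ≤ t → HasDerivAt (f n) (f (n + 1) t) t := by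
    intro n t ht
    cases n with
    | zero =>
      have h1 : HasDerivAt (fun t : ℝ => q (s * t)) (deriv q (s * t) * s) t :=
        HasDerivAt.comp t (h.differentiable (s * t)).hasDerivAt (hlin t)
      have h2 := h1.clog_real (hslit t ht)
      simp only [hf]
      convert! h2 using 1
      rw [zero_add, pow_one, iteratedDeriv_zero, logDeriv_apply]
      ring
    | succ n =>
      have h1 : HasDerivAt (fun t : ℝ => iteratedDeriv n (logDeriv q) (s * t))
          (iteratedDeriv (n + 1) (logDeriv q) (s * t) * s) t :=
        HasDerivAt.comp (h₂ := iteratedDeriv n (logDeriv q)) (h := fun t : ℝ => s * (t : ℂ)) t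
          (h.hasDerivAt_iteratedDeriv (hq t ht) n) (hlin t)
      have h2 := h1.const_mul (s ^ (n + 1))
      simp only [hf]
      convert! h2 using 1
      ring
  -- Order M + 1, not M: the remainder carries |s|^(M+2), and summing 1/(1 + |s|j)² costs one factor
  -- of |s|, leaving |s|^(M+1).
  have hEM := fun J : ℕ => norm_eulerMaclaurin_le (M + 1) f
    (fun j => C * ‖s‖ ^ (M + 2) * (1 / (1 + ‖s‖ * j) ^ 2)) (fun n _ => hderiv n) (by
      intro j t ht
      have ht0 : 0 ≤ t := (Nat.cast_nonneg j).trans ht.1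
      simp only [hf]
      rw [norm_mul, norm_pow]
      have h1 := hbd _ (hray t ht0)
      rw [norm_mul, Complex.norm_real, Real.norm_of_nonneg ht0] at h1
      calc _ ≤ ‖s‖ ^ (M + 1 + 1) * (C / (1 + ‖s‖ * t) ^ (M + 1 + 1)) := by gcongr
        _ ≤ ‖s‖ ^ (M + 1 + 1) * (C / (1 + ‖s‖ * j) ^ 2) := by
          gcongr ‖s‖ ^ (M + 1 + 1) * (C / ?_)
          calc (1 + ‖s‖ * j) ^ 2 ≤ (1 + ‖s‖ * t) ^ 2 := by gcongr; exact ht.1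
            _ ≤ _ := by
              apply pow_le_pow_right₀
              · have : 0 ≤ ‖s‖ * t := by positivity
                linarith
              · omega
        _ = _ := by ring) hx J
  have hlim : Tendsto (fun J : ℕ => ∑ j ∈ Finset.range J, f 0 (j + x) -
      (∫ t in (0 : ℝ)..J, f 0 t) -
      ∑ n ∈ Finset.range (M + 1), bernoulliCoeff (n + 1) x * (f n J - f n 0)) atTop
      (𝓝 (L - ∑ n ∈ Finset.range M, bernoulliCoeff (n + 2) x *
        (s ^ (n + 1) * 0 - s ^ (n + 1) * iteratedDeriv n (logDeriv q) 0))) := by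
    have hD : ∀ n, Tendsto (fun J : ℕ => iteratedDeriv n (logDeriv q) (s * J)) atTop (𝓝 0) := by
      intro n
      obtain ⟨C', hC', hb'⟩ := h.exists_norm_iteratedDeriv_le hc n
      have h1 : Tendsto (fun J : ℕ => C' / (1 + ‖s‖ * (J : ℝ)) ^ (n + 1)) atTop (𝓝 0) := by
        refine tendsto_const_nhds.div_atTop ?_
        refine (tendsto_pow_atTop (by omega)).comp ?_
        exact tendsto_atTop_add_const_left _ _
          (tendsto_natCast_atTop_atTop.const_mul_atTop hns)
      refine squeeze_zero_norm (fun J => ?_) h1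
      have := hb' _ (hray J (Nat.cast_nonneg J))
      simpa using this
    have h2 := hL.sub (tendsto_finsetSum (Finset.range M) fun n _ =>
      (((hD n).const_mul (s ^ (n + 1))).sub_const
        (s ^ (n + 1) * iteratedDeriv n (logDeriv q) 0)).const_mul (bernoulliCoeff (n + 2) x))
    refine h2.congr fun J => ?_
    rw [Finset.sum_range_succ']
    simp only [hf, Complex.ofReal_natCast, Complex.ofReal_zero, mul_zero]
    ring
  have hfin := le_of_tendsto' hlim.norm fun J => (hEM J).trans (show _ ≤ 2 * C * ‖s‖ ^ (M + 1) by
    rw [← Finset.mul_sum]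
    calc _ ≤ C * ‖s‖ ^ (M + 2) * (1 + 1 / ‖s‖) := by
          gcongr
          exact sum_inv_one_add_mul_sq_le hns J
      _ = C * ‖s‖ ^ (M + 1) * (‖s‖ + 1) := by field_simp; ring
      _ ≤ C * ‖s‖ ^ (M + 1) * (1 + 1) := by gcongr
      _ = _ := by ring)
  refine le_trans (le_of_eq ?_) hfin
  congr 1
  rw [sub_eq_add_neg, ← Finset.sum_neg_distrib]
  congr 1
  refine Finset.sum_congr rfl fun n _ => ?_
  ring

end StrongWeak

namespace StrongWeak

/-! ### The two logarithms -/

lemma norm_exp_neg (w : ℂ) : ‖Complex.exp (-w)‖ = Real.exp (-w.re) := by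
  rw [Complex.norm_exp, Complex.neg_re]

lemma norm_exp_neg_lt_one {w : ℂ} (hw : 0 < w.re) : ‖Complex.exp (-w)‖ < 1 := by
  rw [norm_exp_neg, Real.exp_lt_one_iff]
  linarith

lemma re_one_sub_mul_exp_pos {ζ w : ℂ} (hζ : ‖ζ‖ ≤ 1) (hw : 0 < w.re) :
    0 < (1 - ζ * Complex.exp (-w)).re := by
  have h1 : ‖ζ * Complex.exp (-w)‖ < 1 := by
    rw [norm_mul]
    exact lt_of_le_of_lt (mul_le_of_le_one_left (norm_nonneg _) hζ) (norm_exp_neg_lt_one hw)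
  have h2 := Complex.re_le_norm (ζ * Complex.exp (-w))
  rw [Complex.sub_re, Complex.one_re]
  linarith

/-- With x = Re w the inequality x e^(-x) ≤ 1 - e^(-x), a form of 1 + x ≤ e^x, bounds the
denominator from below. -/
lemma norm_exp_div_one_sub_le {ζ w : ℂ} (hζ : ‖ζ‖ ≤ 1) (hw : 0 < w.re) :
    ‖ζ * Complex.exp (-w) / (1 - ζ * Complex.exp (-w))‖ ≤ 1 / w.re := by
  have hu := Real.exp_pos (-w.re)
  have h1 : ‖ζ * Complex.exp (-w)‖ ≤ Real.exp (-w.re) := by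
    rw [norm_mul, norm_exp_neg]
    exact mul_le_of_le_one_left hu.le hζ
  have h2 : 1 - Real.exp (-w.re) ≤ ‖1 - ζ * Complex.exp (-w)‖ := by
    have := norm_sub_norm_le (1 : ℂ) (ζ * Complex.exp (-w))
    rw [norm_one] at this
    linarith
  have h3 : w.re * Real.exp (-w.re) ≤ 1 - Real.exp (-w.re) := by
    have h4 := Real.add_one_le_exp w.re
    have h5 : Real.exp w.re * Real.exp (-w.re) = 1 := by rw [← Real.exp_add]; simp
    nlinarith
  have h4 : 0 < w.re * Real.exp (-w.re) := by positivity
  rw [norm_div]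
  calc _ ≤ Real.exp (-w.re) / (w.re * Real.exp (-w.re)) := by
        gcongr
        linarith
    _ = _ := by field_simp

lemma hasDerivAt_one_sub_mul_exp (ζ w : ℂ) :
    HasDerivAt (fun w => 1 - ζ * Complex.exp (-w)) (ζ * Complex.exp (-w)) w := by
  have := (((hasDerivAt_neg w).cexp).const_mul ζ).const_sub 1
  convert! this using 1
  ring

lemma sectorLog_one_sub {ζ : ℂ} (hζ : ‖ζ‖ = 1) (hζ1 : ζ ≠ 1) :
    SectorLog fun w => 1 - ζ * Complex.exp (-w) where
  differentiable := by fun_prop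
  zero_mem := by
    left
    simp only [neg_zero, Complex.exp_zero, mul_one, Complex.sub_re, Complex.one_re]
    have h1 := Complex.re_le_norm ζ
    rw [hζ] at h1
    rcases h1.lt_or_eq with h | h
    · linarith
    · refine absurd ?_ hζ1
      have h2 := Complex.sq_norm_sub_sq_re ζ
      rw [hζ, h] at h2
      have h3 : ζ.im = 0 := by nlinarith
      exact Complex.ext (by simpa using h) (by simpa using h3)
  mem w hw := Or.inl (re_one_sub_mul_exp_pos hζ.le hw)
  norm_le w hw := by
    rw [logDeriv_apply, (hasDerivAt_one_sub_mul_exp ζ w).deriv]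
    refine (norm_exp_div_one_sub_le hζ.le hw).trans ?_
    gcongr
    norm_num

/-- `(1 - exp (-w)) / w`. -/
noncomputable def toddDenom : ℂ → ℂ := dslope (fun w => 1 - 1 * Complex.exp (-w)) 0

lemma toddDenom_of_ne {w : ℂ} (hw : w ≠ 0) : toddDenom w = (1 - Complex.exp (-w)) / w := by
  rw [toddDenom, dslope_of_ne _ hw, slope_def_field]
  simp

lemma toddDenom_zero : toddDenom 0 = 1 := by
  rw [toddDenom, dslope_same, (hasDerivAt_one_sub_mul_exp 1 0).deriv]
  simp

lemma differentiable_toddDenom : Differentiable ℂ toddDenom := by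
  have h : Differentiable ℂ (fun w => 1 - 1 * Complex.exp (-w)) := by fun_prop
  rw [← differentiableOn_univ] at h ⊢
  exact (Complex.differentiableOn_dslope univ_mem).2 h

lemma logDeriv_toddDenom {w : ℂ} (hw : w ≠ 0) (hw' : 1 - Complex.exp (-w) ≠ 0) :
    logDeriv toddDenom w = Complex.exp (-w) / (1 - Complex.exp (-w)) - 1 / w := by
  have h1 : toddDenom =ᶠ[𝓝 w] fun w => (1 - 1 * Complex.exp (-w)) / w := by
    filter_upwards [eventually_ne_nhds hw] with z hz
    rw [toddDenom_of_ne hz, one_mul]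
  rw [logDeriv_apply, h1.deriv_eq, h1.eq_of_nhds,
    ((hasDerivAt_one_sub_mul_exp 1 w).fun_div (hasDerivAt_id' w) hw).deriv]
  simp only [one_mul]
  field_simp

/-- A real value ≤ 0 would make 1 - e^(-w) a nonpositive multiple of w, although both have positive
real part. The bound is the sum of two terms, each at most 1/Re w. -/
lemma sectorLog_toddDenom : SectorLog toddDenom where
  differentiable := differentiable_toddDenom
  zero_mem := by rw [toddDenom_zero]; exact Complex.one_mem_slitPlane
  mem w hw := by
    have hw0 : w ≠ 0 := by rintro rfl; simp at hw
    rw [Complex.mem_slitPlane_iff]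
    by_contra hcon
    push Not at hcon
    have h1 : toddDenom w = ((toddDenom w).re : ℂ) := by
      apply Complex.ext <;> simp [hcon.2]
    have h2 : 1 - Complex.exp (-w) = toddDenom w * w := by
      rw [toddDenom_of_ne hw0]; field_simp
    have h3 := re_one_sub_mul_exp_pos (ζ := 1) (by simp) hw
    rw [one_mul, h2, h1, Complex.re_ofReal_mul] at h3
    nlinarith [hcon.1]
  norm_le w hw := by
    have hw0 : w ≠ 0 := by rintro rfl; simp at hw
    have hre := re_one_sub_mul_exp_pos (ζ := 1) (by simp) hw
    have h0 : 1 - Complex.exp (-w) ≠ 0 := by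
      intro h0
      rw [one_mul, h0] at hre
      simp at hre
    rw [logDeriv_toddDenom hw0 h0]
    have h1 := norm_exp_div_one_sub_le (ζ := 1) (by simp) hw
    rw [one_mul] at h1
    have h2 : ‖1 / w‖ ≤ 1 / w.re := by
      rw [norm_div, norm_one]
      gcongr
      exact Complex.re_le_norm w
    calc _ ≤ 1 / w.re + 1 / w.re := (norm_sub_le _ _).trans (add_le_add h1 h2)
      _ = 2 / w.re := by ring

/-- Both 1 - e^(-w) and w have argument in (-π/2, π/2), so the difference of the principal
logarithms stays on the principal branch. -/
lemma log_toddDenom {w : ℂ} (hw : 0 < w.re) :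
    Complex.log (toddDenom w) = Complex.log (1 - Complex.exp (-w)) - Complex.log w := by
  have hw0 : w ≠ 0 := by rintro rfl; simp at hw
  have hq := sectorLog_toddDenom.ne_zero (Or.inr hw)
  have hre := re_one_sub_mul_exp_pos (ζ := 1) (by simp) hw
  rw [one_mul] at hre
  have hne : 1 - Complex.exp (-w) ≠ 0 := fun h0 => by rw [h0] at hre; simp at hre
  have h2 : toddDenom w = (1 - Complex.exp (-w)) * w⁻¹ := by
    rw [toddDenom_of_ne hw0, div_eq_mul_inv]
  have a1 := abs_lt.1 (Complex.abs_arg_lt_pi_div_two_iff.2 (Or.inl hre))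
  have a2 := abs_lt.1 (Complex.abs_arg_lt_pi_div_two_iff.2 (Or.inl hw))
  have hpi : w.arg ≠ Real.pi := by linarith [Real.pi_pos, a2.2]
  rw [h2, Complex.log_mul hne (inv_ne_zero hw0), Complex.log_inv _ hpi]
  · ring
  rw [Complex.arg_inv, if_neg hpi]
  exact ⟨by linarith [a1.1, a2.2], by linarith [a1.2, a2.1]⟩

/-! ### Taylor coefficients of the logarithmic derivatives -/

lemma differentiableAt_polylogNeg (n : ℕ) {z : ℂ} (hz : z ≠ 1) :
    DifferentiableAt ℂ (polylogNeg n) z := by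
  suffices h : DifferentiableOn ℂ (polylogNeg n) {1}ᶜ from
    h.differentiableAt (isOpen_compl_singleton.mem_nhds hz)
  induction n with
  | zero =>
    intro z hz
    have hz1 : (1 : ℂ) - z ≠ 0 := sub_ne_zero.2 (Ne.symm hz)
    simp only [polylogNeg]
    exact (DifferentiableAt.div (by fun_prop) (by fun_prop) hz1).differentiableWithinAt
  | succ n ih =>
    simp only [polylogNeg]
    exact differentiableOn_id.mul (ih.deriv isOpen_compl_singleton)

/-- Differentiating in w a function of z = ζ e^(-w) is applying -z d/dz, and the logarithmic
derivative itself is z/(1 - z). -/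
lemma iteratedDeriv_polylog (ζ : ℂ) (n : ℕ) {w : ℂ} (hw : ζ * Complex.exp (-w) ≠ 1) :
    iteratedDeriv n (logDeriv fun w => 1 - ζ * Complex.exp (-w)) w =
      (-1) ^ n * polylogNeg n (ζ * Complex.exp (-w)) := by
  induction n generalizing w with
  | zero =>
    rw [iteratedDeriv_zero, logDeriv_apply, (hasDerivAt_one_sub_mul_exp ζ w).deriv]
    simp [polylogNeg]
  | succ n ih =>
    have hcont : ContinuousAt (fun w => ζ * Complex.exp (-w)) w := by fun_prop
    have hev : iteratedDeriv n (logDeriv fun w => 1 - ζ * Complex.exp (-w)) =ᶠ[𝓝 w]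
        fun w => (-1) ^ n * polylogNeg n (ζ * Complex.exp (-w)) := by
      filter_upwards [hcont.eventually_ne hw] with z hz using ih hz
    have hd : HasDerivAt (fun w => ζ * Complex.exp (-w)) (ζ * (Complex.exp (-w) * -1)) w :=
      ((hasDerivAt_neg w).cexp).const_mul ζ
    have hd2 := (HasDerivAt.comp (h₂ := polylogNeg n) (h := fun w => ζ * Complex.exp (-w)) w
      (differentiableAt_polylogNeg n hw).hasDerivAt hd).const_mul ((-1) ^ n)
    rw [iteratedDeriv_succ, hev.deriv_eq]
    refine hd2.deriv.trans ?_
    simp only [polylogNeg]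
    ring

lemma eq_bernoulli_of_recurrence {b : ℕ → ℂ}
    (hb : ∀ n, ∑ i ∈ Finset.range n, (n.choose i : ℂ) * b i = if n = 1 then 1 else 0) (n : ℕ) :
    b n = ((bernoulli n : ℚ) : ℂ) := by
  induction n using Nat.strong_induction_on with
  | _ n ih =>
    have h1 := hb (n + 1)
    have h2 : ∑ i ∈ Finset.range (n + 1), ((n + 1).choose i : ℂ) * ((bernoulli i : ℚ) : ℂ) =
        if n + 1 = 1 then 1 else 0 := by
      have := congrArg (fun x : ℚ => (x : ℂ)) (sum_bernoulli (n + 1))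
      push_cast at this
      rw [this]
      split_ifs <;> simp_all
    rw [Finset.sum_range_succ] at h1 h2
    have h3 : ∑ i ∈ Finset.range n, ((n + 1).choose i : ℂ) * b i =
        ∑ i ∈ Finset.range n, ((n + 1).choose i : ℂ) * ((bernoulli i : ℚ) : ℂ) :=
      Finset.sum_congr rfl fun i hi => by rw [ih i (Finset.mem_range.1 hi)]
    rw [h3] at h1
    have h4 := add_left_cancel (h1.trans h2.symm)
    refine mul_left_cancel₀ ?_ h4
    rw [Nat.choose_succ_self_right]
    exact_mod_cast Nat.succ_ne_zero n

lemma iteratedDeriv_succ_id_mul {f : ℂ → ℂ} (hf : AnalyticAt ℂ f 0) (n : ℕ) :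
    iteratedDeriv (n + 1) (fun w => w * f w) 0 = (n + 1) * iteratedDeriv n f 0 := by
  have hid : ContDiffAt ℂ ((n + 1 : ℕ)) (fun w : ℂ => w) 0 := contDiffAt_id
  rw [iteratedDeriv_fun_mul hid hf.contDiffAt]
  rw [Finset.sum_eq_single 1]
  · simp [iteratedDeriv_one]
  · intro i _ hi
    have : iteratedDeriv i (fun w : ℂ => w) 0 = 0 := by
      match i, hi with
      | 0, _ => simp
      | 1, h => exact absurd rfl h
      | k + 2, _ =>
        rw [iteratedDeriv_succ', show deriv (fun w : ℂ => w) = fun _ => 1 from deriv_id'']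
        rw [iteratedDeriv_const]
        simp
    rw [this]
    simp
  · intro h
    simp at h

/-- Near 0 the function P(w) = 1 + w q'(w)/q(w) satisfies P(w)(e^w - 1) = w. Leibniz's rule at 0
then yields the Bernoulli recurrence, with B_1 = -1/2. -/
lemma iteratedDeriv_toddDenom (n : ℕ) :
    iteratedDeriv n (logDeriv toddDenom) 0 = ((bernoulli (n + 1) : ℚ) : ℂ) / (n + 1) := by
  have hD : AnalyticAt ℂ (logDeriv toddDenom) 0 :=
    sectorLog_toddDenom.analyticAt_logDeriv (sectorLog_toddDenom.ne_zero (Or.inl rfl))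
  set P : ℂ → ℂ := fun w => w * logDeriv toddDenom w + 1 with hP
  have hPa : AnalyticAt ℂ P 0 := (analyticAt_id.mul hD).add analyticAt_const
  have hEa : AnalyticAt ℂ (fun w => Complex.exp w - 1) 0 := by fun_prop
  have hprod : (fun w => P w * (Complex.exp w - 1)) =ᶠ[𝓝 0] fun w => w := by
    have hq : ∀ᶠ w in 𝓝 (0 : ℂ), toddDenom w ≠ 0 :=
      differentiable_toddDenom.continuous.continuousAt.eventually_ne
        (sectorLog_toddDenom.ne_zero (Or.inl rfl))
    filter_upwards [hq] with w hw
    by_cases hw0 : w = 0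
    · simp [hw0]
    rw [toddDenom_of_ne hw0] at hw
    have h1 : 1 - Complex.exp (-w) ≠ 0 := (div_ne_zero_iff.1 hw).1
    simp only [hP]
    rw [logDeriv_toddDenom hw0 h1]
    have h2 : Complex.exp w * Complex.exp (-w) = 1 := by rw [← Complex.exp_add]; simp
    field_simp
    linear_combination w * h2
  have hrec : ∀ n, ∑ i ∈ Finset.range n, (n.choose i : ℂ) * iteratedDeriv i P 0 =
      if n = 1 then 1 else 0 := by
    intro n
    have h1 : iteratedDeriv n (fun w => P w * (Complex.exp w - 1)) 0 = if n = 1 then 1 else 0 := by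
      rw [(hprod.iteratedDeriv n).eq_of_nhds]
      match n with
      | 0 => simp
      | 1 => simp [iteratedDeriv_one]
      | k + 2 =>
        rw [iteratedDeriv_succ', show deriv (fun w : ℂ => w) = fun _ => 1 from deriv_id'',
          iteratedDeriv_const]
        simp
    rw [iteratedDeriv_fun_mul hPa.contDiffAt hEa.contDiffAt, Finset.sum_range_succ] at h1
    have hE : ∀ k, k ≠ 0 → iteratedDeriv k (fun w => Complex.exp w - 1) 0 = 1 := by
      intro k hk
      obtain ⟨k, rfl⟩ := Nat.exists_eq_succ_of_ne_zero hk
      have hde : deriv (fun w => Complex.exp w - 1) = Complex.exp := by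
        funext w
        simp
      rw [Nat.succ_eq_add_one, iteratedDeriv_succ', hde, iteratedDeriv_eq_iterate,
        Complex.iter_deriv_exp, Complex.exp_zero]
    rw [← h1]
    simp only [Nat.sub_self, iteratedDeriv_zero, Complex.exp_zero, sub_self, mul_zero, add_zero]
    refine Finset.sum_congr rfl fun i hi => ?_
    rw [hE (n - i) (Nat.sub_ne_zero_of_lt (Finset.mem_range.1 hi)), mul_one]
  have hb := eq_bernoulli_of_recurrence hrec (n + 1)
  have hder : iteratedDeriv (n + 1) P 0 = iteratedDeriv (n + 1) (fun w => w * logDeriv toddDenom w) 0 := by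
    rw [iteratedDeriv_succ', iteratedDeriv_succ']
    congr 1
    funext w
    simp only [hP, deriv_add_const]
  rw [hder, iteratedDeriv_succ_id_mul hD] at hb
  rw [← hb]
  have : (n + 1 : ℂ) ≠ 0 := by exact_mod_cast Nat.succ_ne_zero n
  field_simp

end StrongWeak

namespace StrongWeak

/-! ### Termwise integration -/

/-- Termwise integration in a form that also gives integrability of the sum; it serves the
dilogarithm integral and both Mellin transforms. -/
lemma integrable_of_hasSum {α ι : Type*} [MeasurableSpace α] {μ : Measure α} [Countable ι]
    {F : ι → α → ℂ} {f : α → ℂ} (hF : ∀ i, Integrable (F i) μ)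
    (hs : Summable fun i => ∫ a, ‖F i a‖ ∂μ) (hf : ∀ᵐ a ∂μ, HasSum (fun i => F i a) (f a)) :
    Integrable f μ ∧ HasSum (fun i => ∫ a, F i a ∂μ) (∫ a, f a ∂μ) := by
  have hae : (fun a => ∑' i, F i a) =ᵐ[μ] f := hf.mono fun a ha => ha.tsum_eq
  refine ⟨⟨?_, ?_⟩, ?_⟩
  · refine aestronglyMeasurable_of_tendsto_ae (u := (atTop : Filter (Finset ι)))
      (f := fun s a => ∑ i ∈ s, F i a) (fun s => ?_) hf
    exact (integrable_finsetSum s fun i _ => hF i).aestronglyMeasurable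
  · have h1 : ∀ᵐ a ∂μ, ‖f a‖ₑ ≤ ∑' i, ‖F i a‖ₑ := by
      filter_upwards [hf] with a ha
      rw [← ha.tsum_eq]
      exact enorm_tsum_le_tsum_enorm
    refine lt_of_le_of_lt (lintegral_mono_ae h1) ?_
    rw [lintegral_tsum fun i => (hF i).aestronglyMeasurable.enorm]
    have h2 : ∀ i, ∫⁻ a, ‖F i a‖ₑ ∂μ = ENNReal.ofReal (∫ a, ‖F i a‖ ∂μ) := fun i =>
      (ofReal_integral_norm_eq_lintegral_enorm (hF i)).symm
    simp only [h2]
    rw [← ENNReal.ofReal_tsum_of_nonneg (fun i => integral_nonneg fun a => norm_nonneg _) hs]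
    exact ENNReal.ofReal_lt_top
  · have := hasSum_integral_of_summable_integral_norm hF hs
    rwa [integral_congr_ae hae] at this

lemma hasSum_dilog {ζ : ℂ} (hζ : ‖ζ‖ ≤ 1) :
    HasSum (fun j : ℕ => ζ ^ (j + 1) / ((j : ℂ) + 1) ^ 2) (dilog ζ) := by
  refine Summable.hasSum ?_
  have h1 : Summable fun j : ℕ => 1 / ((j : ℝ) + 1) ^ 2 := by
    have := (summable_nat_add_iff 1).2 (Real.summable_one_div_nat_pow (p := 2).2 (by norm_num))
    simpa using this
  refine Summable.of_norm_bounded h1 fun j => ?_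
  rw [norm_div, norm_pow, norm_pow]
  have : ‖(j : ℂ) + 1‖ = (j : ℝ) + 1 := by
    rw [← Nat.cast_add_one, Complex.norm_natCast]; push_cast; rfl
  rw [this]
  gcongr
  exact pow_le_one₀ (norm_nonneg _) hζ

lemma dilog_one : dilog 1 = (Real.pi ^ 2 / 6 : ℝ) := by
  have h1 := (hasSum_nat_add_iff' 1).2 hasSum_zeta_two
  have h2 := Complex.hasSum_ofReal.2 h1
  have h3 := hasSum_dilog (ζ := 1) (by simp)
  refine h3.unique ?_
  simpa using h2

lemma norm_mul_exp_neg_lt_one {ζ s : ℂ} (hζ : ‖ζ‖ ≤ 1) (hs : 0 < s.re) {u : ℝ} (hu : 0 < u) :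
    ‖ζ * Complex.exp (-(s * u))‖ < 1 := by
  rw [norm_mul]
  refine lt_of_le_of_lt (mul_le_of_le_one_left (norm_nonneg _) hζ) (norm_exp_neg_lt_one ?_)
  rw [Complex.re_mul_ofReal]
  positivity

/-- Expand the logarithm and integrate each exponential. The L¹ norms are O(1/j²), so roots of unity
and ζ = 1 are included. -/
lemma integral_log_one_sub {ζ s : ℂ} (hζ : ‖ζ‖ ≤ 1) (hs : 0 < s.re) :
    IntegrableOn (fun u : ℝ => Complex.log (1 - ζ * Complex.exp (-(s * u)))) (Set.Ioi 0) ∧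
    ∫ u in Set.Ioi (0 : ℝ), Complex.log (1 - ζ * Complex.exp (-(s * u))) = -dilog ζ / s := by
  have hs0 : s ≠ 0 := by rintro rfl; simp at hs
  set F : ℕ → ℝ → ℂ := fun j u => -(ζ ^ (j + 1) / ((j : ℂ) + 1)) *
    Complex.exp ((-((j : ℂ) + 1) * s) * u) with hF
  have hre : ∀ j : ℕ, (-((j : ℂ) + 1) * s).re = -(((j : ℝ) + 1) * s.re) := by
    intro j
    simp [Complex.mul_re]
    ring
  have hneg : ∀ j : ℕ, (-((j : ℂ) + 1) * s).re < 0 := by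
    intro j
    rw [hre]
    have : 0 < ((j : ℝ) + 1) * s.re := by positivity
    linarith
  have hint : ∀ j, IntegrableOn (F j) (Set.Ioi 0) := fun j =>
    (integrableOn_exp_mul_complex_Ioi (hneg j) 0).const_mul _
  have hj1 : ∀ j : ℕ, ‖(j : ℂ) + 1‖ = (j : ℝ) + 1 := by
    intro j
    rw [← Nat.cast_add_one, Complex.norm_natCast]; push_cast; rfl
  have hnorm : ∀ j : ℕ, ∫ u in Set.Ioi (0 : ℝ), ‖F j u‖ = ‖ζ‖ ^ (j + 1) / ((j : ℝ) + 1) ^ 2 / s.re := by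
    intro j
    have e1 : ∀ u : ℝ, ‖F j u‖ = ‖ζ‖ ^ (j + 1) / ((j : ℝ) + 1) *
        Real.exp (-(((j : ℝ) + 1) * s.re) * u) := by
      intro u
      simp only [hF]
      rw [norm_mul, norm_neg, norm_div, norm_pow, hj1, Complex.norm_exp, Complex.re_mul_ofReal, hre]
    simp only [e1]
    have hpos : 0 < ((j : ℝ) + 1) * s.re := by positivity
    rw [integral_const_mul, integral_exp_mul_Ioi (by linarith)]
    simp only [mul_zero, Real.exp_zero]
    field_simp
  have hsum : Summable fun j => ∫ u in Set.Ioi (0 : ℝ), ‖F j u‖ := by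
    simp only [hnorm]
    refine Summable.div_const ?_ _
    have := (hasSum_dilog hζ).summable.norm
    refine this.congr fun j => ?_
    rw [norm_div, norm_pow, norm_pow, hj1]
  have hlog : ∀ᵐ u ∂(volume.restrict (Set.Ioi (0 : ℝ))), HasSum (fun j => F j u)
      (Complex.log (1 - ζ * Complex.exp (-(s * u)))) := by
    refine (ae_restrict_mem measurableSet_Ioi).mono fun u hu => ?_
    have := (Complex.hasSum_taylorSeries_neg_log' (norm_mul_exp_neg_lt_one hζ hs hu)).neg
    rw [neg_neg] at this
    convert! this using 1
    funext j
    simp only [hF]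
    rw [mul_pow, ← Complex.exp_nat_mul]
    have : ((j : ℂ) + 1) ≠ 0 := by exact_mod_cast Nat.succ_ne_zero j
    push_cast
    rw [show -((j : ℂ) + 1) * s * u = ((j : ℂ) + 1) * -(s * u) by ring]
    ring
  obtain ⟨h1, h2⟩ := integrable_of_hasSum hint hsum hlog
  refine ⟨h1, h2.unique ?_⟩
  have h3 := (hasSum_dilog hζ).neg.div_const s
  convert! h3 using 1
  funext j
  simp only [hF]
  rw [integral_const_mul, integral_exp_mul_complex_Ioi (hneg j)]
  have : ((j : ℂ) + 1) ≠ 0 := by exact_mod_cast Nat.succ_ne_zero j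
  simp only [Complex.ofReal_zero, mul_zero, Complex.exp_zero]
  field_simp

/-! ### Stirling's formula for shifted factorials -/

/-- Gauss's limit for log Γ(x) contains log J!, which Stirling's limit eliminates. -/
lemma tendsto_sum_log_add {x : ℝ} (hx : 0 < x) :
    Tendsto (fun J : ℕ => (J : ℝ) * Real.log J - J + (x - 1 / 2) * Real.log J -
      ∑ j ∈ Finset.range J, Real.log (j + x)) atTop
      (𝓝 (Real.log (Real.Gamma x) - Real.log (2 * Real.pi) / 2)) := by
  have h1 := Real.BohrMollerup.tendsto_log_gamma hx
  have h2 : Tendsto (fun n => Real.log (Stirling.stirlingSeq n)) atTop (𝓝 (Real.log √Real.pi)) :=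
    (Real.continuousAt_log (Real.sqrt_pos.2 Real.pi_pos).ne').tendsto.comp
      Stirling.tendsto_stirlingSeq_sqrt_pi
  -- `logGammaSeq` runs over m ≤ J; this correction trades its last term log(x + J) for log J.
  have h3 : Tendsto (fun J : ℕ => Real.log (1 + x / J)) atTop (𝓝 0) := by
    have h4 : Tendsto (fun J : ℕ => 1 + x / (J : ℝ)) atTop (𝓝 (1 + 0)) :=
      tendsto_const_nhds.add (tendsto_const_div_atTop_nhds_zero_nat x)
    rw [add_zero] at h4
    have := (Real.continuousAt_log one_ne_zero).tendsto.comp h4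
    rwa [Real.log_one] at this
  have h5 := ((h1.sub h2).add h3).sub_const (Real.log 2 / 2)
  have e : Real.log (Real.Gamma x) - Real.log √Real.pi + 0 - Real.log 2 / 2 =
      Real.log (Real.Gamma x) - Real.log (2 * Real.pi) / 2 := by
    rw [Real.log_sqrt Real.pi_pos.le, Real.log_mul two_ne_zero Real.pi_ne_zero]
    ring
  rw [e] at h5
  refine h5.congr' ?_
  filter_upwards [eventually_gt_atTop 0] with J hJ
  have hJ' : (0 : ℝ) < J := by exact_mod_cast hJ
  rw [Stirling.log_stirlingSeq_formula, Real.BohrMollerup.logGammaSeq, Finset.sum_range_succ,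
    Real.log_mul two_ne_zero hJ'.ne', Real.log_div hJ'.ne' (Real.exp_pos 1).ne', Real.log_exp]
  have h6 : Real.log (1 + x / J) = Real.log (x + J) - Real.log J := by
    rw [← Real.log_div (by positivity) hJ'.ne']
    congr 1
    field_simp
    ring
  have h7 : ∑ m ∈ Finset.range J, Real.log (x + m) = ∑ j ∈ Finset.range J, Real.log (j + x) :=
    Finset.sum_congr rfl fun j _ => by rw [add_comm]
  rw [h6, h7]
  ring

/-! ### The limits entering the Euler–Maclaurin formula -/

lemma summable_mul_exp_neg {ζ s : ℂ} (hs : 0 < s.re) (x : ℝ) :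
    Summable fun j : ℕ => ζ * Complex.exp (-(s * ((j + x : ℝ) : ℂ))) := by
  have h1 : ‖Complex.exp (-s)‖ < 1 := norm_exp_neg_lt_one hs
  have h2 := (summable_geometric_of_norm_lt_one h1).mul_left (ζ * Complex.exp (-(s * x)))
  refine h2.congr fun j => ?_
  rw [← Complex.exp_nat_mul, mul_assoc, ← Complex.exp_add]
  congr 2
  push_cast
  ring

lemma summable_log_one_sub_exp {ζ s : ℂ} (hs : 0 < s.re) (x : ℝ) :
    Summable fun j : ℕ => Complex.log (1 - ζ * Complex.exp (-(s * ((j + x : ℝ) : ℂ)))) := by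
  have := Complex.summable_log_one_add_of_summable (summable_mul_exp_neg (ζ := ζ) hs x).neg
  simpa only [← sub_eq_add_neg] using this

lemma tendsto_log_one_sub_exp {ζ s : ℂ} (hs : 0 < s.re) :
    Tendsto (fun J : ℕ => Complex.log (1 - ζ * Complex.exp (-(s * J)))) atTop (𝓝 0) := by
  simpa using (summable_log_one_sub_exp (ζ := ζ) hs 0).tendsto_atTop_zero

lemma bernoulliCoeff_one (x : ℝ) : bernoulliCoeff 1 x = x - 1 / 2 := by
  simp [bernoulliCoeff]

/-- At x = 0 the coefficient of the boundary term is B_1 = -1/2; as log(1 - ζ e^(-sJ)) tends to 0,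
only -log(1 - ζ)/2 is left of it. -/
lemma tendsto_eulerMaclaurin_one_sub {ζ s : ℂ} (hζ : ‖ζ‖ ≤ 1) (hs : 0 < s.re) :
    Tendsto (fun J : ℕ => ∑ j ∈ Finset.range J,
        Complex.log (1 - ζ * Complex.exp (-(s * ((j + 0 : ℝ) : ℂ)))) -
      (∫ u in (0 : ℝ)..J, Complex.log (1 - ζ * Complex.exp (-(s * u)))) -
      bernoulliCoeff 1 0 * (Complex.log (1 - ζ * Complex.exp (-(s * J))) -
        Complex.log (1 - ζ * Complex.exp (-0)))) atTop
      (𝓝 ((∑' j : ℕ, Complex.log (1 - ζ * Complex.exp (-(s * j)))) + dilog ζ / s -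
        Complex.log (1 - ζ) / 2)) := by
  obtain ⟨h1, h2⟩ := integral_log_one_sub hζ hs
  have t1 := (summable_log_one_sub_exp (ζ := ζ) hs 0).hasSum.tendsto_sum_nat
  have t2 := intervalIntegral_tendsto_integral_Ioi 0 h1 (tendsto_natCast_atTop_atTop (R := ℝ))
  have t3 := ((tendsto_log_one_sub_exp (ζ := ζ) hs).sub_const
    (Complex.log (1 - ζ * Complex.exp (-0)))).const_mul (bernoulliCoeff 1 0)
  rw [h2] at t2
  have := (t1.sub t2).sub t3
  convert! this using 2
  rw [bernoulliCoeff_one]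
  simp
  ring

/-- Here log q(st) = log(1 - e^(-st)) - log s - log t. Sum, integral and boundary term of log t
diverge separately, but their combination converges by Stirling and produces log Γ(x); the copies of
log s add up to (x - 1/2) log s. -/
lemma tendsto_eulerMaclaurin_toddDenom {s : ℂ} (hs : 0 < s.re) {x : ℝ} (hx : 0 < x) :
    Tendsto (fun J : ℕ => ∑ j ∈ Finset.range J, Complex.log (toddDenom (s * ((j + x : ℝ) : ℂ))) -
      (∫ u in (0 : ℝ)..J, Complex.log (toddDenom (s * u))) -
      bernoulliCoeff 1 x * (Complex.log (toddDenom (s * J)) - Complex.log (toddDenom 0))) atTop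
      (𝓝 ((∑' j : ℕ, Complex.log (1 - Complex.exp (-(s * ((j + x : ℝ) : ℂ))))) +
        (Real.pi ^ 2 / 6 : ℝ) / s + (x - 1 / 2) * Complex.log s +
        (Real.log (Real.Gamma x) - Real.log (2 * Real.pi) / 2 : ℝ))) := by
  have hs0 : s ≠ 0 := by rintro rfl; simp at hs
  obtain ⟨h1, h2⟩ := integral_log_one_sub (ζ := 1) (by simp) hs
  have hlog : ∀ t : ℝ, 0 < t → Complex.log (toddDenom (s * t)) =
      Complex.log (1 - 1 * Complex.exp (-(s * t))) - (Complex.log s + (Real.log t : ℂ)) := by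
    intro t ht
    rw [log_toddDenom (by rw [Complex.re_mul_ofReal]; positivity), mul_comm s (t : ℂ),
      Complex.log_ofReal_mul ht hs0, one_mul]
    ring
  have t1 := (summable_log_one_sub_exp (ζ := 1) hs x).hasSum.tendsto_sum_nat
  have t2 := intervalIntegral_tendsto_integral_Ioi 0 h1 (tendsto_natCast_atTop_atTop (R := ℝ))
  have t3 := (tendsto_log_one_sub_exp (ζ := 1) hs).const_mul (bernoulliCoeff 1 x)
  have t4 := (Complex.continuous_ofReal.tendsto _).comp (tendsto_sum_log_add hx)
  rw [h2, dilog_one] at t2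
  have t5 := ((t1.sub t2).sub t3).add (t4.add_const ((x - 1 / 2) * Complex.log s))
  have hlim : (∑' j : ℕ, Complex.log (1 - 1 * Complex.exp (-(s * ((j + x : ℝ) : ℂ))))) -
      -((Real.pi ^ 2 / 6 : ℝ) : ℂ) / s - bernoulliCoeff 1 x * 0 +
      (((Real.log (Real.Gamma x) - Real.log (2 * Real.pi) / 2 : ℝ) : ℂ) + (x - 1 / 2) * Complex.log s) =
      (∑' j : ℕ, Complex.log (1 - Complex.exp (-(s * ((j + x : ℝ) : ℂ))))) +
        (Real.pi ^ 2 / 6 : ℝ) / s + (x - 1 / 2) * Complex.log s +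
        (Real.log (Real.Gamma x) - Real.log (2 * Real.pi) / 2 : ℝ) := by
    simp only [one_mul]
    ring
  rw [hlim] at t5
  refine t5.congr' ?_
  filter_upwards [eventually_gt_atTop 0] with J hJ
  have hJ' : (0 : ℝ) < J := by exact_mod_cast hJ
  have e1 : ∑ j ∈ Finset.range J, Complex.log (toddDenom (s * ((j + x : ℝ) : ℂ))) =
      ∑ j ∈ Finset.range J, Complex.log (1 - 1 * Complex.exp (-(s * ((j + x : ℝ) : ℂ)))) -
      (J * Complex.log s + ((∑ j ∈ Finset.range J, Real.log (j + x) : ℝ) : ℂ)) := by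
    rw [Finset.sum_congr rfl fun (j : ℕ) _ => hlog ((j : ℝ) + x) (by positivity), Finset.sum_sub_distrib,
      Finset.sum_add_distrib, Finset.sum_const, Finset.card_range, nsmul_eq_mul, Complex.ofReal_sum]
  have hii : IntervalIntegrable (fun u : ℝ => Complex.log (1 - 1 * Complex.exp (-(s * u)))) volume 0 J := by
    rw [intervalIntegrable_iff_integrableOn_Ioc_of_le hJ'.le]
    exact h1.mono_set Set.Ioc_subset_Ioi_self
  have hil : IntervalIntegrable (fun u : ℝ => (Real.log u : ℂ)) volume 0 J :=
    let h : IntervalIntegrable Real.log volume 0 J := intervalIntegral.intervalIntegrable_log'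
    ⟨h.1.ofReal, h.2.ofReal⟩
  have e2 : ∫ u in (0 : ℝ)..J, Complex.log (toddDenom (s * u)) =
      (∫ u in (0 : ℝ)..J, Complex.log (1 - 1 * Complex.exp (-(s * u)))) -
      (J * Complex.log s + ((J * Real.log J - J : ℝ) : ℂ)) := by
    have : ∫ u in (0 : ℝ)..J, Complex.log (toddDenom (s * u)) =
        ∫ u in (0 : ℝ)..J, (Complex.log (1 - 1 * Complex.exp (-(s * u))) -
          (Complex.log s + (Real.log u : ℂ))) := by
      refine intervalIntegral.integral_congr_ae (Eventually.of_forall fun u hu => ?_)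
      rw [Set.uIoc_of_le hJ'.le] at hu
      exact hlog u hu.1
    rw [this, intervalIntegral.integral_sub hii (intervalIntegrable_const.add hil),
      intervalIntegral.integral_add intervalIntegrable_const hil, intervalIntegral.integral_ofReal,
      integral_log_from_zero]
    simp
  have e3 := hlog J hJ'
  rw [Complex.ofReal_natCast] at e3
  rw [e1, e2, e3, toddDenom_zero, Complex.log_one, bernoulliCoeff_one]
  simp only [Function.comp]
  push_cast
  ring

end StrongWeak

namespace StrongWeak

/-! ### Calculus of asymptotic expansions -/

/-- The closed subsector `|Re y| ≤ c Im y` of the upper half-plane. -/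
def upperSector (c : ℝ) : Set ℂ := {y : ℂ | 0 < y.im ∧ |y.re| ≤ c * y.im}

lemma pow_isBigO_pow {c : ℝ} {i M : ℕ} (h : M ≤ i) :
    (fun y : ℂ => y ^ i) =O[𝓝[upperSector c] 0] fun y : ℂ => y ^ M := by
  have h1 : (fun y : ℂ => y ^ (i - M)) =O[𝓝[upperSector c] (0 : ℂ)] fun _ => (1 : ℂ) :=
    ((continuous_pow (i - M)).tendsto (0 : ℂ)).mono_left nhdsWithin_le_nhds |>.isBigO_one ℂ
  have h2 := h1.mul (Asymptotics.isBigO_refl (fun y : ℂ => y ^ M) (𝓝[upperSector c] 0))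
  refine (h2.congr (fun y => ?_) fun y => one_mul _)
  rw [← pow_add, Nat.sub_add_cancel h]

namespace HasAsymptoticExpansion

variable {h h' : ℂ → ℂ} {a b : PowerSeries ℂ}

/-- Terms beyond order M are themselves O(y^M), so an estimate with too many terms is as good. -/
lemma of_exists_ge (H : ∀ c : ℝ, 0 < c → ∀ M : ℕ, ∃ M', M ≤ M' ∧
    (fun y : ℂ => h y - ∑ i ∈ Finset.range M', PowerSeries.coeff i a * y ^ i)
      =O[𝓝[upperSector c] 0] (fun y : ℂ => y ^ M)) : HasAsymptoticExpansion h a := by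
  intro c hc M
  obtain ⟨M', hM, hO⟩ := H c hc M
  have h1 : (fun y : ℂ => ∑ i ∈ Finset.Ico M M', PowerSeries.coeff i a * y ^ i)
      =O[𝓝[upperSector c] 0] (fun y : ℂ => y ^ M) :=
    Asymptotics.IsBigO.fun_sum fun i hi =>
      (pow_isBigO_pow (Finset.mem_Ico.1 hi).1).const_mul_left _
  refine (hO.add h1).congr_left fun y => ?_
  rw [← Finset.sum_range_add_sum_Ico _ hM]
  ring

lemma congr (H : HasAsymptoticExpansion h a) (hh : ∀ y : ℂ, 0 < y.im → h y = h' y) :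
    HasAsymptoticExpansion h' a := by
  intro c hc M
  refine (H c hc M).congr' ?_ EventuallyEq.rfl
  filter_upwards [self_mem_nhdsWithin] with y hy
  rw [hh y hy.1]

lemma add (H : HasAsymptoticExpansion h a) (H' : HasAsymptoticExpansion h' b) :
    HasAsymptoticExpansion (fun y => h y + h' y) (a + b) := by
  intro c hc M
  refine ((H c hc M).add (H' c hc M)).congr_left fun y => ?_
  simp only [map_add, add_mul, Finset.sum_add_distrib]
  ring

lemma neg (H : HasAsymptoticExpansion h a) : HasAsymptoticExpansion (fun y => -h y) (-a) := by
  intro c hc M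
  refine (H c hc M).neg_left.congr_left fun y => ?_
  simp only [map_neg, neg_mul, Finset.sum_neg_distrib]
  ring

lemma sub (H : HasAsymptoticExpansion h a) (H' : HasAsymptoticExpansion h' b) :
    HasAsymptoticExpansion (fun y => h y - h' y) (a - b) := by
  simpa only [sub_eq_add_neg] using H.add H'.neg

lemma linear (z : ℂ) :
    HasAsymptoticExpansion (fun y => z * y) (PowerSeries.C z * PowerSeries.X) := by
  refine of_exists_ge fun c _ M => ⟨M + 2, by omega, ?_⟩
  have : ∀ y : ℂ, z * y - ∑ i ∈ Finset.range (M + 2),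
      PowerSeries.coeff i (PowerSeries.C z * PowerSeries.X) * y ^ i = 0 := by
    intro y
    rw [Finset.sum_eq_single 1]
    · simp
    · intro i _ hi
      rw [PowerSeries.coeff_C_mul, PowerSeries.coeff_X, if_neg hi]
      simp
    · simp
  simp only [this]
  exact Asymptotics.isBigO_zero _ _

lemma of_flat (H : ∀ c : ℝ, 0 < c → ∀ M : ℕ, h =O[𝓝[upperSector c] 0] (fun y : ℂ => y ^ M)) :
    HasAsymptoticExpansion h 0 := by
  intro c hc M
  refine (H c hc M).congr_left fun y => ?_
  simp

lemma add_flat (H : HasAsymptoticExpansion h a) (H' : HasAsymptoticExpansion h' 0) :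
    HasAsymptoticExpansion (fun y => h y + h' y) a := by
  simpa using H.add H'

lemma comp_mul {r : ℝ} (hr : 0 < r) (H : HasAsymptoticExpansion h a) :
    HasAsymptoticExpansion (fun y => h (r * y)) (PowerSeries.rescale (r : ℂ) a) := by
  intro c hc M
  have ht : Tendsto (fun y : ℂ => (r : ℂ) * y) (𝓝[upperSector c] 0) (𝓝[upperSector c] 0) := by
    refine tendsto_nhdsWithin_iff.2 ⟨?_, ?_⟩
    · have : Tendsto (fun y : ℂ => (r : ℂ) * y) (𝓝 0) (𝓝 (r * 0)) :=
        (continuous_const_mul (r : ℂ)).tendsto 0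
      rw [mul_zero] at this
      exact this.mono_left nhdsWithin_le_nhds
    · filter_upwards [self_mem_nhdsWithin] with y hy
      refine ⟨by rw [Complex.im_ofReal_mul]; exact mul_pos hr hy.1, ?_⟩
      rw [Complex.im_ofReal_mul, Complex.re_ofReal_mul, abs_mul, abs_of_pos hr]
      calc r * |y.re| ≤ r * (c * y.im) := by gcongr; exact hy.2
        _ = _ := by ring
  have h1 := (H c hc M).comp_tendsto ht
  have h2 : (fun y : ℂ => ((r : ℂ) * y) ^ M) =O[𝓝[upperSector c] 0] fun y => y ^ M := by
    simp only [mul_pow]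
    exact (Asymptotics.isBigO_refl _ _).const_mul_left _
  refine (h1.trans h2).congr_left fun y => ?_
  simp only [Function.comp, PowerSeries.coeff_rescale]
  congr 1
  exact Finset.sum_congr rfl fun i _ => by ring

end HasAsymptoticExpansion

/-! ### The expansions of the `q`-Pochhammer symbols -/

lemma neg_mem_rightSector {c : ℝ} {y : ℂ} (hy : y ∈ upperSector c) :
    -(2 * Real.pi * Complex.I * y) ∈ rightSector c := by
  have e : -(2 * Real.pi * Complex.I * y) = ((2 * Real.pi : ℝ) : ℂ) * (-(Complex.I * y)) := by
    push_cast; ring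
  rw [e, rightSector, Set.mem_ofPred_eq, Complex.re_ofReal_mul, Complex.im_ofReal_mul]
  simp only [Complex.neg_re, Complex.neg_im, Complex.I_mul_re, Complex.I_mul_im, neg_neg]
  refine ⟨mul_pos (by positivity) hy.1, ?_⟩
  rw [abs_mul, abs_neg, abs_of_pos (by positivity : (0 : ℝ) < 2 * Real.pi)]
  calc 2 * Real.pi * |y.re| ≤ 2 * Real.pi * (c * y.im) := by gcongr; exact hy.2
    _ = _ := by ring

lemma norm_neg_two_pi_I_mul (y : ℂ) : ‖-(2 * Real.pi * Complex.I * y)‖ = 2 * Real.pi * ‖y‖ := by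
  simp [abs_of_pos Real.pi_pos]

lemma re_neg_two_pi_I_mul (y : ℂ) : (-(2 * Real.pi * Complex.I * y)).re = 2 * Real.pi * y.im := by
  simp [Complex.mul_re, Complex.mul_im]

lemma SectorLog.hasAsymptoticExpansion {q : ℂ → ℂ} (hq : SectorLog q) {x : ℝ}
    (hx : x ∈ Set.Icc (0 : ℝ) 1) {h : ℂ → ℂ} {a : PowerSeries ℂ}
    (hL : ∀ y : ℂ, 0 < y.im →
      Tendsto (fun J : ℕ => ∑ j ∈ Finset.range J,
          Complex.log (q (-(2 * Real.pi * Complex.I * y) * ((j + x : ℝ) : ℂ))) -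
        (∫ u in (0 : ℝ)..J, Complex.log (q (-(2 * Real.pi * Complex.I * y) * u))) -
        bernoulliCoeff 1 x * (Complex.log (q (-(2 * Real.pi * Complex.I * y) * J)) -
          Complex.log (q 0))) atTop (𝓝 (h y)))
    (ha0 : PowerSeries.coeff 0 a = 0)
    (ha : ∀ n, PowerSeries.coeff (n + 1) a = -(bernoulliCoeff (n + 2) x *
      (-(2 * Real.pi * Complex.I)) ^ (n + 1) * iteratedDeriv n (logDeriv q) 0)) :
    HasAsymptoticExpansion h a := by
  refine HasAsymptoticExpansion.of_exists_ge fun c hc M => ⟨M + 1, by omega, ?_⟩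
  obtain ⟨C, hC, hb⟩ := hq.exists_norm_eulerMaclaurin_le hc M
  refine Asymptotics.IsBigO.trans (g := fun y : ℂ => y ^ (M + 1)) ?_ (pow_isBigO_pow (by omega))
  refine Asymptotics.IsBigO.of_bound (C * (2 * Real.pi) ^ (M + 1)) ?_
  have hball : Metric.ball (0 : ℂ) (1 / (2 * Real.pi)) ∈ 𝓝[upperSector c] (0 : ℂ) :=
    mem_nhdsWithin_of_mem_nhds (Metric.ball_mem_nhds _ (by positivity))
  filter_upwards [self_mem_nhdsWithin, hball] with y hy hy1
  rw [mem_ball_zero_iff, lt_div_iff₀ (by positivity)] at hy1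
  have hb' := hb _ (neg_mem_rightSector hy) (by rw [norm_neg_two_pi_I_mul]; linarith) x hx _
    (hL y hy.1)
  rw [norm_neg_two_pi_I_mul, mul_pow, ← mul_assoc, ← norm_pow] at hb'
  refine le_trans (le_of_eq ?_) hb'
  congr 1
  rw [Finset.sum_range_succ', ha0, zero_mul, add_zero, sub_eq_add_neg, ← Finset.sum_neg_distrib]
  congr 1
  refine Finset.sum_congr rfl fun n _ => ?_
  rw [ha, show -(2 * Real.pi * Complex.I * y) = -(2 * Real.pi * Complex.I) * y by ring, mul_pow]
  ring

lemma norm_rootPow (N k : ℕ) : ‖rootPow N k‖ = 1 := by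
  rw [rootPow, show (2 * Real.pi * Complex.I * k / N : ℂ) = ((2 * Real.pi * k / N : ℝ) : ℂ) *
    Complex.I by push_cast; ring, Complex.norm_exp_ofReal_mul_I]

lemma rootPow_ne_one {N k : ℕ} (hk : 0 < k) (hkN : k < N) : rootPow N k ≠ 1 := by
  have hN : (N : ℂ) ≠ 0 := by exact_mod_cast (by omega : N ≠ 0)
  rw [rootPow, Ne, Complex.exp_eq_one_iff]
  rintro ⟨n, hn⟩
  have h2 : (2 * Real.pi * Complex.I : ℂ) ≠ 0 := Complex.two_pi_I_ne_zero
  have h3 : (k : ℂ) = n * N := by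
    field_simp at hn
    have := mul_left_cancel₀ h2 (show (2 * Real.pi * Complex.I : ℂ) * k =
      2 * Real.pi * Complex.I * (n * N) by linear_combination (2 * Real.pi * Complex.I) * hn)
    exact this
  have h4 : (k : ℤ) = n * N := by exact_mod_cast h3
  have h5 : (N : ℤ) ∣ k := ⟨n, by linarith⟩
  have := Int.le_of_dvd (by exact_mod_cast hk) h5
  omega

/-- With s = -2πiτ this is the regularised sum of log(1 - ζ_N^k e^(-sj)) started at x = 0. Odd
powers alone survive because the Bernoulli numbers of odd index at least 3 vanish. -/
theorem fPoch_hasAsymptoticExpansion {k N : ℕ} (hk : 0 < k) (hkN : k < N) :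
    HasAsymptoticExpansion (fun τ => fPoch k N τ +
      dilog (rootPow N k) / (-(2 * Real.pi * Complex.I * τ)) - Complex.log (1 - rootPow N k) / 2)
      (psiSeries k N) := by
  have h1 := norm_rootPow N k
  have h2 := rootPow_ne_one hk hkN
  refine (sectorLog_one_sub h1 h2).hasAsymptoticExpansion (x := 0) (by simp) (fun τ hτ => ?_)
    (by simp [psiSeries]) fun n => ?_
  · have hs : 0 < (-(2 * Real.pi * Complex.I * τ)).re := by
      rw [re_neg_two_pi_I_mul]; exact mul_pos (by positivity) hτ
    have := tendsto_eulerMaclaurin_one_sub h1.le hs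
    convert! this using 5
    rw [fPoch]
    refine tsum_congr fun j => ?_
    rw [← Complex.exp_nat_mul]
    congr 4
    ring
  · rw [psiSeries, PowerSeries.coeff_mk, iteratedDeriv_polylog _ _ (by simpa using h2)]
    simp only [neg_zero, Complex.exp_zero, mul_one]
    split_ifs with ho
    · have hne : (-1 : ℂ) ^ n = 1 := by
        rw [Nat.odd_add_one, Nat.not_odd_iff_even] at ho
        exact ho.neg_one_pow
      rw [neg_pow, pow_succ (-1 : ℂ), hne, bernoulliCoeff, bernoulliFun_eval_zero,
        Nat.add_sub_cancel]
      push_cast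
      ring
    · have hz : bernoulli (n + 2) = 0 := by
        refine bernoulli_eq_zero_of_odd ?_ (by omega)
        rw [Nat.not_odd_iff_even] at ho
        exact ho.add_one
      simp [bernoulliCoeff, bernoulliFun_eval_zero, hz]

lemma bernoulliFun_ratCast (n k N : ℕ) : bernoulliFun n ((k : ℝ) / N) =
    (((Polynomial.bernoulli n).eval ((k : ℚ) / (N : ℚ)) : ℚ) : ℝ) := by
  rw [bernoulliFun, show ((k : ℝ) / N) = algebraMap ℚ ℝ ((k : ℚ) / N) by simp,
    Polynomial.eval_map_algebraMap, Polynomial.aeval_algebraMap_apply]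
  simp

theorem gPoch_hasAsymptoticExpansion {k N : ℕ} (hk : 0 < k) (hkN : k < N) :
    HasAsymptoticExpansion (fun y => gPoch k N (y / N) +
      (Real.pi ^ 2 / 6 : ℝ) / (-(2 * Real.pi * Complex.I * y)) +
      ((k / N : ℝ) - 1 / 2) * Complex.log (-(2 * Real.pi * Complex.I * y)) +
      (Real.log (Real.Gamma (k / N)) - Real.log (2 * Real.pi) / 2 : ℝ) +
      (bernoulliFun 2 (k / N) * (2 * Real.pi * Complex.I) / 4) * y)
      (-phiSeries k N) := by
  have hN : (0 : ℝ) < N := by exact_mod_cast (by omega : 0 < N)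
  have hk' : (0 : ℝ) < k := by exact_mod_cast hk
  have hx : 0 < (k / N : ℝ) := by positivity
  have hx1 : (k / N : ℝ) ≤ 1 := by
    rw [div_le_one hN]; exact_mod_cast hkN.le
  -- Euler–Maclaurin also produces a linear term, from B_1 = -1/2 and B_2(k/N); it does not belong
  -- to φ_k and is moved to the other side at the end.
  set a : PowerSeries ℂ := -phiSeries k N -
    PowerSeries.C ((bernoulliFun 2 (k / N) * (2 * Real.pi * Complex.I) / 4)) * PowerSeries.X with ha
  have key : HasAsymptoticExpansion (fun y => gPoch k N (y / N) +
      (Real.pi ^ 2 / 6 : ℝ) / (-(2 * Real.pi * Complex.I * y)) +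
      ((k / N : ℝ) - 1 / 2) * Complex.log (-(2 * Real.pi * Complex.I * y)) +
      (Real.log (Real.Gamma (k / N)) - Real.log (2 * Real.pi) / 2 : ℝ)) a := by
    refine sectorLog_toddDenom.hasAsymptoticExpansion (x := k / N) ⟨hx.le, hx1⟩ (fun y hy => ?_)
      ?_ fun n => ?_
    · have hs : 0 < (-(2 * Real.pi * Complex.I * y)).re := by
        rw [re_neg_two_pi_I_mul]; exact mul_pos (by positivity) hy
      have := tendsto_eulerMaclaurin_toddDenom hs hx
      convert! this using 5
      rw [gPoch]
      refine tsum_congr fun j => ?_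
      rw [← Complex.exp_nat_mul]
      congr 3
      push_cast
      have : (N : ℂ) ≠ 0 := by exact_mod_cast hN.ne'
      field_simp
      ring
    · simp [ha, phiSeries]
    · rw [iteratedDeriv_toddDenom, ha, map_sub, map_neg, PowerSeries.coeff_C_mul,
        PowerSeries.coeff_X, phiSeries, PowerSeries.coeff_mk, bernoulliCoeff]
      rcases n with _ | n
      · norm_num [bernoulli_one]
        ring
      · have e1 : n + 1 + 1 ≠ 1 := by omega
        rw [if_neg e1, mul_zero, sub_zero]
        split_ifs with ho
        · rw [neg_pow, ho.1.neg_one_pow, bernoulliFun_ratCast]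
          push_cast
          have : ((n : ℂ) + 1 + 1) ≠ 0 := by exact_mod_cast Nat.succ_ne_zero (n + 1)
          field_simp
        · have hz : bernoulli (n + 1 + 1) = 0 := by
            refine bernoulli_eq_zero_of_odd ?_ (by omega)
            rw [← Nat.not_even_iff_odd]
            exact fun h => ho ⟨h, by omega⟩
          simp [hz]
  have := key.add (HasAsymptoticExpansion.linear
    ((bernoulliFun 2 (k / N) * (2 * Real.pi * Complex.I) / 4)))
  rwa [ha, sub_add_cancel] at this

end StrongWeak

namespace StrongWeak

/-! ### Exponentially small corrections -/

lemma im_neg_one_div (y : ℂ) : (-1 / y).im = y.im / Complex.normSq y := by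
  rw [neg_div, one_div, Complex.neg_im, Complex.inv_im]
  ring

lemma im_neg_one_div_pos {y : ℂ} (hy : 0 < y.im) : 0 < (-1 / y).im := by
  rw [im_neg_one_div]
  have : y ≠ 0 := by rintro rfl; simp at hy
  exact div_pos hy (Complex.normSq_pos.2 this)

/-- In the sector Im(-1/y) is at least a multiple of 1/|y|, and e^(-δ/|y|) ≤ n! (|y|/δ)ⁿ for every
n. The estimate is only required once the exponential is at most 1/2, where log(1 - z) is controlled
by z. -/
lemma hasAsymptoticExpansion_zero_of_exp {h : ℂ → ℂ} {κ D : ℝ} (hκ : 0 < κ)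
    (hh : ∀ y : ℂ, 0 < y.im → Real.exp (-(κ * (-1 / y).im)) ≤ 1 / 2 →
      ‖h y‖ ≤ D * Real.exp (-(κ * (-1 / y).im))) : HasAsymptoticExpansion h 0 := by
  refine HasAsymptoticExpansion.of_flat fun c hc M => ?_
  set δ : ℝ := κ / (1 + c) ^ 2 with hδ
  have hδ0 : 0 < δ := by positivity
  have hexp : ∀ y ∈ upperSector c, ∀ n : ℕ,
      Real.exp (-(κ * (-1 / y).im)) ≤ n.factorial / δ ^ n * ‖y‖ ^ n := by
    intro y hy n
    have hy0 : y ≠ 0 := by rintro rfl; simpa using hy.1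
    have hny : 0 < ‖y‖ := norm_pos_iff.2 hy0
    have h1 : ‖y‖ ≤ (1 + c) * y.im := by
      have := Complex.norm_le_abs_re_add_abs_im y
      rw [abs_of_pos hy.1] at this
      linarith [hy.2]
    have h2 : δ / ‖y‖ ≤ κ * (-1 / y).im := by
      rw [im_neg_one_div, Complex.normSq_eq_norm_sq, hδ, div_div, mul_div_assoc']
      rw [div_le_div_iff₀ (by positivity) (by positivity)]
      have h3 : ‖y‖ ≤ y.im * (1 + c) ^ 2 := by
        have : (0 : ℝ) ≤ y.im * (1 + c) * c := by have := hy.1.le; positivity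
        nlinarith
      calc κ * ‖y‖ ^ 2 = κ * ‖y‖ * ‖y‖ := by ring
        _ ≤ κ * ‖y‖ * (y.im * (1 + c) ^ 2) := by gcongr
        _ = _ := by ring
    have h4 := Real.pow_div_factorial_le_exp (δ / ‖y‖) (by positivity) n
    have h5 : 0 < (δ / ‖y‖) ^ n / n.factorial := by positivity
    calc Real.exp (-(κ * (-1 / y).im)) ≤ Real.exp (-(δ / ‖y‖)) := by gcongr
      _ = (Real.exp (δ / ‖y‖))⁻¹ := Real.exp_neg _
      _ ≤ ((δ / ‖y‖) ^ n / n.factorial)⁻¹ := inv_anti₀ h5 h4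
      _ = _ := by rw [div_pow]; field_simp
  refine Asymptotics.IsBigO.of_bound (|D| * (M.factorial / δ ^ M)) ?_
  have hball : Metric.ball (0 : ℂ) (δ / 2) ∈ 𝓝[upperSector c] (0 : ℂ) :=
    mem_nhdsWithin_of_mem_nhds (Metric.ball_mem_nhds _ (by positivity))
  filter_upwards [self_mem_nhdsWithin, hball] with y hy hy1
  rw [mem_ball_zero_iff] at hy1
  have h1 := hexp y hy 1
  have h2 : Real.exp (-(κ * (-1 / y).im)) ≤ 1 / 2 := by
    refine h1.trans ?_
    simp only [Nat.factorial_one, Nat.cast_one, pow_one]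
    rw [div_mul_eq_mul_div, one_mul, div_le_iff₀ hδ0]
    linarith
  calc ‖h y‖ ≤ D * Real.exp (-(κ * (-1 / y).im)) := hh y hy.1 h2
    _ ≤ |D| * Real.exp (-(κ * (-1 / y).im)) := by gcongr; exact le_abs_self D
    _ ≤ |D| * (M.factorial / δ ^ M * ‖y‖ ^ M) := by gcongr; exact hexp y hy M
    _ = _ := by rw [norm_pow]; ring

lemma norm_tsum_log_one_sub_le {z : ℕ → ℂ} {r : ℝ} (hr0 : 0 ≤ r) (hr : r ≤ 1 / 2)
    (hz : ∀ j, ‖z j‖ ≤ r ^ (j + 1)) : ‖∑' j, Complex.log (1 - z j)‖ ≤ 3 * r := by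
  have h1 : ∀ j, ‖Complex.log (1 - z j)‖ ≤ 3 / 2 * r * r ^ j := by
    intro j
    have h2 : ‖-z j‖ ≤ 1 / 2 := by
      rw [norm_neg]
      calc ‖z j‖ ≤ r ^ (j + 1) := hz j
        _ ≤ r := pow_le_of_le_one hr0 (by linarith) (by omega)
        _ ≤ 1 / 2 := hr
    have := Complex.norm_log_one_add_half_le_self h2
    rw [← sub_eq_add_neg, norm_neg] at this
    calc _ ≤ 3 / 2 * ‖z j‖ := this
      _ ≤ 3 / 2 * r ^ (j + 1) := by gcongr; exact hz j
      _ = _ := by ring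
  have hg := (hasSum_geometric_of_lt_one hr0 (by linarith : r < 1)).mul_left (3 / 2 * r)
  refine (tsum_of_norm_bounded hg h1).trans ?_
  have : (1 - r)⁻¹ ≤ 2 := by
    rw [inv_le_comm₀ (by linarith) (by norm_num)]
    linarith
  calc 3 / 2 * r * (1 - r)⁻¹ ≤ 3 / 2 * r * 2 := by gcongr
    _ = 3 * r := by ring

lemma norm_exp_two_pi_I_mul (y : ℂ) :
    ‖Complex.exp (2 * Real.pi * Complex.I * y)‖ = Real.exp (-(2 * Real.pi * y.im)) := by
  rw [Complex.norm_exp]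
  congr 1
  simp [Complex.mul_re, Complex.mul_im]

lemma norm_exp_two_pi_I_mul_lt_one {y : ℂ} (hy : 0 < y.im) :
    ‖Complex.exp (2 * Real.pi * Complex.I * y)‖ < 1 := by
  rw [norm_exp_two_pi_I_mul, Real.exp_lt_one_iff]
  have := Real.pi_pos
  have : 0 < 2 * Real.pi * y.im := by positivity
  linarith

lemma summable_fPoch (k N : ℕ) {y : ℂ} (hy : 0 < y.im) : Summable fun j : ℕ =>
    Complex.log (1 - rootPow N k * Complex.exp (2 * Real.pi * Complex.I * y) ^ j) := by
  have := Complex.summable_log_one_add_of_summable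
    ((summable_geometric_of_norm_lt_one (norm_exp_two_pi_I_mul_lt_one hy)).mul_left
      (rootPow N k)).neg
  simpa only [← sub_eq_add_neg] using this

lemma summable_pow_arith {k N : ℕ} (hN : 0 < N) {q : ℂ} (hq : ‖q‖ < 1) :
    Summable fun j : ℕ => q ^ (k + j * N) := by
  have h1 : ‖q ^ N‖ < 1 := by
    rw [norm_pow]
    exact pow_lt_one₀ (norm_nonneg _) hq hN.ne'
  refine ((summable_geometric_of_norm_lt_one h1).mul_left (q ^ k)).congr fun j => ?_
  rw [← pow_mul, ← pow_add, mul_comm N j]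

lemma summable_gPoch (k : ℕ) {N : ℕ} (hN : 0 < N) {y : ℂ} (hy : 0 < y.im) : Summable fun j : ℕ =>
    Complex.log (1 - Complex.exp (2 * Real.pi * Complex.I * y) ^ (k + j * N)) := by
  have := Complex.summable_log_one_add_of_summable
    (summable_pow_arith (k := k) hN (norm_exp_two_pi_I_mul_lt_one hy)).neg
  simpa only [← sub_eq_add_neg] using this

/-- Only the factor with j = 0 does not tend to 1 as y → 0; it is the constant 1 - ζ_N^k. -/
lemma fPoch_flat (k N : ℕ) : HasAsymptoticExpansion
    (fun y => fPoch k N (-1 / y) - Complex.log (1 - rootPow N k)) 0 := by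
  refine hasAsymptoticExpansion_zero_of_exp (κ := 2 * Real.pi) (D := 3) (by positivity)
    fun y hy hr => ?_
  have h1 := (summable_fPoch k N (im_neg_one_div_pos hy)).tsum_eq_zero_add
  rw [fPoch, h1, pow_zero, mul_one, add_sub_cancel_left]
  refine norm_tsum_log_one_sub_le (Real.exp_pos _).le hr fun j => ?_
  rw [norm_mul, norm_pow, norm_rootPow, one_mul, norm_exp_two_pi_I_mul]

lemma gPoch_flat {k N : ℕ} (hk : 0 < k) (hN : 0 < N) : HasAsymptoticExpansion
    (fun y => gPoch k N (-1 / y / N)) 0 := by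
  have hN' : (0 : ℝ) < N := by exact_mod_cast hN
  refine hasAsymptoticExpansion_zero_of_exp (κ := 2 * Real.pi / N) (D := 3) (by positivity)
    fun y hy hr => ?_
  refine norm_tsum_log_one_sub_le (Real.exp_pos _).le hr fun j => ?_
  have e : (-1 / y / N : ℂ).im = (-1 / y).im / N := by
    rw [← Complex.ofReal_natCast, Complex.div_ofReal_im]
  rw [norm_pow, norm_exp_two_pi_I_mul, e,
    show -(2 * Real.pi * ((-1 / y).im / N)) = -(2 * Real.pi / N * (-1 / y).im) by ring]
  refine pow_le_pow_of_le_one (Real.exp_pos _).le (by linarith) ?_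
  nlinarith

/-! ### Elementary logarithms -/

/-- With θ = πk/N one has 1 - e^(2iθ) = 2 sin θ · e^(i(θ - π/2)), and θ in (0, π) keeps the argument
within (-π/2, π/2). -/
lemma log_one_sub_rootPow {k N : ℕ} (hk : 0 < k) (hkN : k < N) :
    Complex.log (1 - rootPow N k) = Real.log 2 + Real.log (Real.sin (Real.pi * k / N)) +
      Complex.I * (Real.pi * k / N - Real.pi / 2) := by
  have hN : (0 : ℝ) < N := by exact_mod_cast (by omega : 0 < N)
  have hk' : (0 : ℝ) < k := by exact_mod_cast hk
  have hkN' : (k : ℝ) < N := by exact_mod_cast hkN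
  set θ : ℝ := Real.pi * k / N with hθ
  have h0 : 0 < θ := by positivity
  have h1 : θ < Real.pi := by
    rw [hθ, div_lt_iff₀ hN]
    exact mul_lt_mul_of_pos_left hkN' Real.pi_pos
  have hs := Real.sin_pos_of_pos_of_lt_pi h0 h1
  have e : 1 - rootPow N k = Complex.exp (Real.log 2 + Real.log (Real.sin θ) +
      Complex.I * (θ - Real.pi / 2)) := by
    rw [Complex.exp_add, ← Complex.ofReal_add, ← Complex.ofReal_exp, Real.exp_add,
      Real.exp_log two_pos, Real.exp_log hs, mul_sub, Complex.exp_sub, mul_comm Complex.I,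
      mul_comm Complex.I, Complex.exp_pi_div_two_mul_I, rootPow,
      show (2 * Real.pi * Complex.I * k / N : ℂ) = 2 * (θ * Complex.I) by rw [hθ]; push_cast; ring]
    have h2 : Complex.exp (2 * (θ * Complex.I)) = Complex.exp (θ * Complex.I) ^ 2 := by
      rw [← Complex.exp_nat_mul]; norm_num
    have h3 := Complex.cos_sq_add_sin_sq (θ : ℂ)
    rw [h2, Complex.exp_mul_I]
    push_cast
    field_simp
    have h4 := Complex.I_sq
    linear_combination (-Complex.I) * h3 -
      (Complex.I * Complex.sin θ ^ 2 + 2 * Complex.cos θ * Complex.sin θ) * h4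
  rw [e, Complex.log_exp]
  · push_cast [hθ]; ring
  · simp [Complex.log_im]; linarith
  · simp [Complex.log_im]; linarith

lemma ne_zero_of_im_pos {y : ℂ} (hy : 0 < y.im) : y ≠ 0 := by rintro rfl; simp at hy

lemma log_neg_two_pi_I_mul {y : ℂ} (hy : 0 < y.im) :
    Complex.log (-(2 * Real.pi * Complex.I * y)) =
      Real.log (2 * Real.pi) + Complex.log y - Real.pi / 2 * Complex.I := by
  have hy0 := ne_zero_of_im_pos hy
  have hpi := Real.pi_pos
  have ha := Complex.arg_le_pi y
  have ha0 : 0 ≤ Complex.arg y := Complex.arg_nonneg_iff.2 hy.le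
  have e : -(2 * Real.pi * Complex.I * y) = Complex.exp (Real.log (2 * Real.pi) + Complex.log y -
      Real.pi / 2 * Complex.I) := by
    rw [Complex.exp_sub, Complex.exp_add, Complex.exp_log hy0, ← Complex.ofReal_exp,
      Real.exp_log (by positivity), Complex.exp_pi_div_two_mul_I]
    push_cast
    field_simp
    linear_combination -Complex.I_sq
  rw [e, Complex.log_exp]
  · simp [Complex.log_im]; linarith
  · simp [Complex.log_im]; linarith

lemma log_two_mul_sqrt_mul {y : ℂ} (hy : 0 < y.im) {r : ℝ} (hr : 0 < r) :
    Complex.log (2 * y ^ (1 / 2 : ℂ) * r) = Real.log 2 + Real.log r + Complex.log y / 2 := by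
  have hy0 := ne_zero_of_im_pos hy
  have hpi := Real.pi_pos
  have ha := Complex.arg_le_pi y
  have ha0 : 0 ≤ Complex.arg y := Complex.arg_nonneg_iff.2 hy.le
  have e : 2 * y ^ (1 / 2 : ℂ) * r = Complex.exp (Real.log 2 + Real.log r + Complex.log y / 2) := by
    rw [Complex.exp_add, ← Complex.ofReal_add, ← Complex.ofReal_exp, Real.exp_add,
      Real.exp_log two_pos, Real.exp_log hr, Complex.cpow_def_of_ne_zero hy0]
    push_cast
    rw [show Complex.log y * (1 / 2) = Complex.log y / 2 by ring]
    ring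
  rw [e, Complex.log_exp]
  · simp [Complex.log_im]; linarith
  · simp [Complex.log_im]; linarith

lemma log_Gamma_one_sub {x : ℝ} (h0 : 0 < x) (h1 : x < 1) :
    Real.log (Real.Gamma (1 - x)) = Real.log Real.pi - Real.log (Real.sin (Real.pi * x)) -
      Real.log (Real.Gamma x) := by
  have hs : 0 < Real.sin (Real.pi * x) := by
    refine Real.sin_pos_of_pos_of_lt_pi (by positivity) ?_
    nlinarith [Real.pi_pos]
  have h2 := congrArg Real.log (Real.Gamma_mul_Gamma_one_sub x)
  rw [Real.log_mul (Real.Gamma_pos_of_pos h0).ne' (Real.Gamma_pos_of_pos (by linarith)).ne',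
    Real.log_div Real.pi_ne_zero hs.ne'] at h2
  linarith

/-! ### Reflection of the perturbative series -/

lemma rootPow_sub {k N : ℕ} (hkN : k ≤ N) (hN : 0 < N) :
    rootPow N (N - k) = (rootPow N k)⁻¹ := by
  have hN' : (N : ℂ) ≠ 0 := by exact_mod_cast hN.ne'
  rw [rootPow, rootPow, ← Complex.exp_neg, Nat.cast_sub hkN,
    show (2 * Real.pi * Complex.I * ((N : ℂ) - k) / N : ℂ) =
      -(2 * Real.pi * Complex.I * k / N) + 2 * Real.pi * Complex.I by field_simp; ring,
    Complex.exp_add, Complex.exp_two_pi_mul_I, mul_one]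

lemma rootPow_inv_eq_conj (N k : ℕ) : (rootPow N k)⁻¹ = (starRingEnd ℂ) (rootPow N k) :=
  Complex.inv_eq_conj (norm_rootPow N k)

lemma dilog_conj {ζ : ℂ} (hζ : ‖ζ‖ ≤ 1) : dilog ((starRingEnd ℂ) ζ) = (starRingEnd ℂ) (dilog ζ) := by
  have h1 := Complex.hasSum_conj'.2 (hasSum_dilog hζ)
  have h2 := hasSum_dilog (ζ := (starRingEnd ℂ) ζ) (by simpa using hζ)
  refine h2.unique ?_
  simpa using h1

lemma dilog_rootPow_sub {k N : ℕ} (hkN : k ≤ N) (hN : 0 < N) :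
    dilog (rootPow N (N - k)) = dilog (rootPow N k) -
      2 * ((dilog (rootPow N k)).im : ℂ) * Complex.I := by
  rw [rootPow_sub hkN hN, rootPow_inv_eq_conj, dilog_conj (norm_rootPow N k).le]
  apply Complex.ext <;> simp
  ring

/-- The operator z d/dz changes sign under z ↦ 1/z, so the parity alternates; the constant present
at order 0 is killed by the first differentiation. -/
lemma polylogNeg_inv (n : ℕ) {z : ℂ} (hz : z ≠ 0) (hz1 : z ≠ 1) :
    polylogNeg n z⁻¹ = (-1) ^ (n + 1) * polylogNeg n z - if n = 0 then 1 else 0 := by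
  induction n generalizing z with
  | zero =>
    have h1 : 1 - z ≠ 0 := sub_ne_zero.2 hz1.symm
    have h2 : z - 1 ≠ 0 := sub_ne_zero.2 hz1
    simp only [polylogNeg, if_true]
    rw [show 1 - z⁻¹ = (z - 1) / z by field_simp]
    field_simp
    ring
  | succ n ih =>
    have hinv : z⁻¹ ≠ 1 := by rwa [Ne, inv_eq_one]
    have hev : (fun w => polylogNeg n w⁻¹) =ᶠ[𝓝 z]
        fun w => (-1) ^ (n + 1) * polylogNeg n w - if n = 0 then 1 else 0 := by
      filter_upwards [isOpen_ne.mem_nhds hz, isOpen_ne.mem_nhds hz1] with w hw hw1 using ih hw hw1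
    have h1 : HasDerivAt (fun w => polylogNeg n w⁻¹) (deriv (polylogNeg n) z⁻¹ * -(z ^ 2)⁻¹) z :=
      HasDerivAt.comp z (h₂ := polylogNeg n) (differentiableAt_polylogNeg n hinv).hasDerivAt
        (hasDerivAt_inv hz)
    have h2 : HasDerivAt (fun w => (-1) ^ (n + 1) * polylogNeg n w - if n = 0 then 1 else 0)
        ((-1) ^ (n + 1) * deriv (polylogNeg n) z) z :=
      (((differentiableAt_polylogNeg n hz1).hasDerivAt).const_mul _).sub_const _
    have h3 := (h2.congr_of_eventuallyEq hev).unique h1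
    simp only [polylogNeg]
    rw [if_neg (Nat.succ_ne_zero n), sub_zero, pow_succ]
    have : deriv (polylogNeg n) z⁻¹ = -z ^ 2 * ((-1) ^ (n + 1) * deriv (polylogNeg n) z) := by
      rw [h3]; field_simp
    rw [this]
    field_simp

/-- The linear defect comes from Li_0(1/z) = -1 - Li_0(z), multiplied by 2πi B_2/2 = πi/6. All
elementary linear corrections of the reflected series originate here. -/
lemma psiSeries_sub {k N : ℕ} (hk : 0 < k) (hkN : k < N) :
    psiSeries (N - k) N = -psiSeries k N -
      PowerSeries.C (Real.pi * Complex.I / 6) * PowerSeries.X := by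
  have hz : rootPow N k ≠ 0 := Complex.exp_ne_zero _
  ext i
  rw [map_sub, map_neg, PowerSeries.coeff_C_mul, PowerSeries.coeff_X, psiSeries, psiSeries,
    PowerSeries.coeff_mk, PowerSeries.coeff_mk, rootPow_sub hkN.le (by omega)]
  split_ifs with h1 h2 h2
  · subst h2
    rw [polylogNeg_inv _ hz (rootPow_ne_one hk hkN)]
    norm_num
    ring
  · rw [polylogNeg_inv _ hz (rootPow_ne_one hk hkN), if_neg (by
      obtain ⟨r, rfl⟩ := h1; omega), Nat.sub_add_cancel h1.pos, h1.neg_one_pow]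
    ring
  · subst h2; exact absurd odd_one h1
  · simp

lemma phiSeries_sub {k N : ℕ} (hkN : k ≤ N) (hN : 0 < N) :
    phiSeries (N - k) N = -phiSeries k N := by
  have hN' : (N : ℚ) ≠ 0 := by exact_mod_cast hN.ne'
  ext i
  rw [map_neg, phiSeries, phiSeries, PowerSeries.coeff_mk, PowerSeries.coeff_mk]
  split_ifs with h1
  · have h2 : (Polynomial.bernoulli (i + 1)).eval (((N - k : ℕ) : ℚ) / N) =
        -(Polynomial.bernoulli (i + 1)).eval ((k : ℚ) / N) := by
      rw [Nat.cast_sub hkN, sub_div, div_self hN', Polynomial.bernoulli_eval_one_sub,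
        pow_succ, h1.1.neg_one_pow]
      ring
    rw [h2]
    push_cast
    ring
  · simp

end StrongWeak

namespace StrongWeak

/-! ### The expansions of the logarithm of the spectral trace -/

lemma log_one_sub_rootPow_sub {k N : ℕ} (hk : 0 < k) (hkN : k < N) :
    Complex.log (1 - rootPow N (N - k)) = Real.log 2 + Real.log (Real.sin (Real.pi * k / N)) -
      Complex.I * (Real.pi * k / N - Real.pi / 2) := by
  have hN : (N : ℝ) ≠ 0 := by exact_mod_cast (by omega : N ≠ 0)
  rw [log_one_sub_rootPow (by omega) (by omega)]
  have e : Real.pi * ((N - k : ℕ) : ℝ) / N = Real.pi - Real.pi * k / N := by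
    rw [Nat.cast_sub hkN.le]; field_simp
  have e' : (Real.pi * ((N - k : ℕ) : ℂ) / N : ℂ) = Real.pi - Real.pi * k / N := by
    exact_mod_cast congrArg Complex.ofReal e
  rw [e, e', Real.sin_pi_sub]
  ring

theorem gPoch_sub_hasAsymptoticExpansion {k N : ℕ} (hk : 0 < k) (hkN : k < N) :
    HasAsymptoticExpansion (fun y => gPoch (N - k) N (y / N) +
      (Real.pi ^ 2 / 6 : ℝ) / (-(2 * Real.pi * Complex.I * y)) +
      (1 / 2 - (k / N : ℝ)) * Complex.log (-(2 * Real.pi * Complex.I * y)) +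
      (Real.log (Real.Gamma (1 - k / N)) - Real.log (2 * Real.pi) / 2 : ℝ) +
      (bernoulliFun 2 (k / N) * (2 * Real.pi * Complex.I) / 4) * y)
      (phiSeries k N) := by
  have hN : (N : ℝ) ≠ 0 := by exact_mod_cast (by omega : N ≠ 0)
  have h := gPoch_hasAsymptoticExpansion (k := N - k) (N := N) (by omega) (by omega)
  have e : (((N - k : ℕ) : ℝ) / N) = 1 - k / N := by
    rw [Nat.cast_sub hkN.le]; field_simp
  rw [phiSeries_sub hkN.le (by omega), neg_neg, e] at h
  refine h.congr fun y _ => ?_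
  rw [bernoulliFun_two, bernoulliFun_two]
  push_cast
  ring

variable {m n N : ℕ}

lemma log_Gamma_one_sub_natCast_div {k : ℕ} (hk : 0 < k) (hkN : k < N) :
    Real.log (Real.Gamma (1 - k / N)) = Real.log Real.pi - Real.log (Real.sin (Real.pi * k / N)) -
      Real.log (Real.Gamma (k / N)) := by
  have hN : (0 : ℝ) < N := by exact_mod_cast (by omega : 0 < N)
  have hk' : (0 : ℝ) < k := by exact_mod_cast hk
  rw [log_Gamma_one_sub (by positivity) (by rw [div_lt_one hN]; exact_mod_cast hkN), mul_div_assoc]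

lemma sin_pi_mul_div_pos {k : ℕ} (hk : 0 < k) (hkN : k < N) :
    0 < Real.sin (Real.pi * k / N) := by
  have hN : (0 : ℝ) < N := by exact_mod_cast (by omega : 0 < N)
  have hk' : (0 : ℝ) < k := by exact_mod_cast hk
  refine Real.sin_pos_of_pos_of_lt_pi (by positivity) ?_
  rw [div_lt_iff₀ hN]
  exact mul_lt_mul_of_pos_left (by exact_mod_cast hkN) Real.pi_pos

lemma Gamma_div_pos {k : ℕ} (hk : 0 < k) (hN : 0 < N) : 0 < Real.Gamma (k / N) :=
  Real.Gamma_pos_of_pos (div_pos (by exact_mod_cast hk) (by exact_mod_cast hN))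

lemma logSpecTrace_eq (hn : 0 < n) (hN : N = 1 + m + n) {y : ℂ} (hy : 0 < y.im) :
    logSpecTrace m n y = Real.pi * Complex.I / (12 * y)
    - Real.pi * Complex.I * y * ((m : ℂ) / (N : ℂ) ^ 2 - 1 / 12) + Real.pi * Complex.I / 4
    - (Real.log 2 + Real.log (Real.sin (Real.pi * n / N)) + Complex.log y / 2)
    + (gPoch (N - 1) N (y / N) + gPoch (N - m) N (y / N) - gPoch n N (y / N)
    - fPoch (N - 1) N (-1 / y) - fPoch (N - m) N (-1 / y) + fPoch n N (-1 / y)) := by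
  rw [← log_two_mul_sqrt_mul hy (sin_pi_mul_div_pos hn (by omega))]
  subst hN
  rfl

/-- The f-part, evaluated at -1/y, is constant up to a flat error; the g-part carries the series.
What remains is the matching of elementary terms, using Euler's reflection formula for Γ. -/
theorem logSpecTrace_weak (hm : 0 < m) (hn : 0 < n) (hN : N = 1 + m + n) :
    HasAsymptoticExpansion
      (fun y : ℂ => logSpecTrace m n y
        - (Real.log (Real.Gamma (n / N) * Real.Gamma (m / N) * Real.Gamma (1 / N)
              / (4 * Real.pi ^ 2)) : ℂ)
        + Complex.log y)
      (-phiSeries (N - 1) N - phiSeries (N - m) N + phiSeries n N) := by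
  have hN0 : 0 < N := by omega
  have g1 := gPoch_sub_hasAsymptoticExpansion (k := 1) (N := N) one_pos (by omega)
  have gm := gPoch_sub_hasAsymptoticExpansion (k := m) (N := N) hm (by omega)
  have gn := gPoch_hasAsymptoticExpansion (k := n) (N := N) hn (by omega)
  have hf := (((fPoch_flat n N).sub (fPoch_flat (N - 1) N)).sub (fPoch_flat (N - m) N))
  simp only [sub_zero] at hf
  have H := (((g1.add gm).sub gn).add_flat hf)
  rw [phiSeries_sub (by omega) hN0, phiSeries_sub (by omega) hN0]
  have es : phiSeries 1 N + phiSeries m N - -phiSeries n N =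
      - -phiSeries 1 N - -phiSeries m N + phiSeries n N := by ring
  rw [es] at H
  refine H.congr fun y hy => ?_
  have hlogG : Real.log (Real.Gamma (n / N) * Real.Gamma (m / N) * Real.Gamma (1 / N)
      / (4 * Real.pi ^ 2)) = Real.log (Real.Gamma (n / N)) + Real.log (Real.Gamma (m / N)) +
      Real.log (Real.Gamma (1 / N)) - (2 * Real.log 2 + 2 * Real.log Real.pi) := by
    have h1 : Real.Gamma ((1 : ℝ) / N) ≠ 0 := by
      have := Gamma_div_pos (k := 1) (N := N) one_pos hN0
      push_cast at this
      exact this.ne'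
    rw [Real.log_div (mul_ne_zero (mul_ne_zero (Gamma_div_pos hn hN0).ne'
      (Gamma_div_pos hm hN0).ne') h1) (by positivity), Real.log_mul (mul_ne_zero
      (Gamma_div_pos hn hN0).ne' (Gamma_div_pos hm hN0).ne') h1, Real.log_mul
      (Gamma_div_pos hn hN0).ne' (Gamma_div_pos hm hN0).ne', Real.log_mul (by norm_num)
      (by positivity), Real.log_pow, show (4 : ℝ) = 2 ^ 2 by norm_num, Real.log_pow]
    push_cast
    ring
  have hNc : (N : ℂ) ≠ 0 := by exact_mod_cast hN0.ne'
  have hy0 := ne_zero_of_im_pos hy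
  have hpi : (Real.pi : ℂ) ≠ 0 := by exact_mod_cast Real.pi_ne_zero
  have e1 : ((Real.pi ^ 2 / 6 : ℝ) : ℂ) / (-(2 * Real.pi * Complex.I * y)) =
      Real.pi * Complex.I / (12 * y) := by
    push_cast
    field_simp
    linear_combination (-(12 : ℂ)) * Complex.I_sq
  -- With this relation B_2(1/N) + B_2(m/N) - B_2(n/N) = 1/6 - 2m/N², which is the linear exponent
  -- in the trace.
  have hn' : (n : ℂ) = N - 1 - m := by rw [hN]; push_cast; ring
  rw [logSpecTrace_eq hn hN hy, hlogG, log_one_sub_rootPow hn (by omega),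
    log_one_sub_rootPow_sub hm (by omega), log_one_sub_rootPow_sub one_pos (by omega),
    log_Gamma_one_sub_natCast_div hm (by omega), log_Gamma_one_sub_natCast_div one_pos (by omega),
    log_neg_two_pi_I_mul hy, e1, bernoulliFun_two, bernoulliFun_two, bernoulliFun_two,
    Real.log_mul two_ne_zero Real.pi_ne_zero]
  push_cast
  rw [hn']
  field_simp
  ring

/-- Now y = -1/τ, so g at y/N is flat and f at -1/y = τ carries the series. The phases of the three
logarithms log(1 - ζ) cancel against πi/4 because 1 + m + n = N. -/
theorem logSpecTrace_strong (hm : 0 < m) (hn : 0 < n) (hN : N = 1 + m + n) :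
    HasAsymptoticExpansion
      (fun τ : ℂ => logSpecTrace m n (-1 / τ)
        - (Real.pi * Complex.I / (12 * (-1 / τ))
          + Real.pi * Complex.I * (-1 / τ)
            * ((dilog (rootPow N n) - dilog (rootPow N (N - m)) - dilog (rootPow N (N - 1)))
                / (2 * Real.pi ^ 2) - m / N ^ 2 + 1 / 12))
        + (Real.log (2 * √(2 * Real.sin (Real.pi * n / N) * Real.sin (Real.pi * m / N)
              * Real.sin (Real.pi / N))) : ℂ)
        + Complex.log (-1 / τ) / 2)
      (-psiSeries (N - 1) N - psiSeries (N - m) N + psiSeries n N) := by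
  have hN0 : 0 < N := by omega
  have f1 := fPoch_hasAsymptoticExpansion (k := N - 1) (N := N) (by omega) (by omega)
  have fm := fPoch_hasAsymptoticExpansion (k := N - m) (N := N) (by omega) (by omega)
  have fn := fPoch_hasAsymptoticExpansion (k := n) (N := N) hn (by omega)
  have hg := (((gPoch_flat (k := N - 1) (by omega) hN0).add
    (gPoch_flat (k := N - m) (by omega) hN0)).sub (gPoch_flat hn hN0))
  simp only [sub_zero, add_zero] at hg
  refine (((f1.neg.sub fm).add fn).add_flat hg).congr fun τ hτ => ?_
  have hsn := sin_pi_mul_div_pos hn (by omega : n < N)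
  have hsm := sin_pi_mul_div_pos hm (by omega : m < N)
  have hs1 := sin_pi_mul_div_pos one_pos (by omega : 1 < N)
  rw [Nat.cast_one, mul_one] at hs1
  have hlog : Real.log (2 * √(2 * Real.sin (Real.pi * n / N) * Real.sin (Real.pi * m / N)
      * Real.sin (Real.pi / N))) = Real.log 2 + (Real.log 2 + Real.log (Real.sin (Real.pi * n / N))
      + Real.log (Real.sin (Real.pi * m / N)) + Real.log (Real.sin (Real.pi / N))) / 2 := by
    rw [Real.log_mul two_ne_zero (by positivity), Real.log_sqrt (by positivity),
      Real.log_mul (by positivity) hs1.ne', Real.log_mul (by positivity) hsm.ne',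
      Real.log_mul two_ne_zero hsn.ne']
  have hNc : (N : ℂ) ≠ 0 := by exact_mod_cast hN0.ne'
  have hτ0 := ne_zero_of_im_pos hτ
  have hpi : (Real.pi : ℂ) ≠ 0 := by exact_mod_cast Real.pi_ne_zero
  have hn' : (n : ℂ) = N - 1 - m := by rw [hN]; push_cast; ring
  have e0 : -1 / (-1 / τ) = τ := by field_simp
  have e1 : ∀ d : ℂ, d / (-(2 * Real.pi * Complex.I * τ)) =
      Real.pi * Complex.I * τ⁻¹ * (d / (2 * Real.pi ^ 2)) := by
    intro d
    field_simp
    linear_combination (-d) * Complex.I_sq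
  rw [logSpecTrace_eq hn hN (im_neg_one_div_pos hτ), e0, hlog, log_one_sub_rootPow hn (by omega),
    log_one_sub_rootPow_sub hm (by omega), log_one_sub_rootPow_sub one_pos (by omega),
    e1, e1, e1, hn']
  push_cast
  rw [mul_one]
  field_simp
  ring

/-- Reflection makes each difference contribute 2φ_k. The coefficients 1 - 2k/N of the logarithm add
up to 3 - 2 = 1. -/
theorem gPoch_sub_sub_hasAsymptoticExpansion (hm : 0 < m) (hn : 0 < n) (hN : N = 1 + m + n) :
    HasAsymptoticExpansion
      (fun y : ℂ => weightSum m n (fun k => gPoch (N - k) N (y / N) - gPoch k N (y / N)) +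
        Complex.log (-(2 * Real.pi * Complex.I * y)) - weightSum m n (fun k =>
            (Real.log (Real.Gamma (k / N) / Real.Gamma (1 - k / N)) : ℂ)))
      (2 • (-phiSeries (N - 1) N - phiSeries (N - m) N + phiSeries n N)) := by
  have hN0 : 0 < N := by omega
  have key : ∀ k : ℕ, 0 < k → k < N → HasAsymptoticExpansion (fun y : ℂ =>
      gPoch (N - k) N (y / N) - gPoch k N (y / N) +
      (1 - 2 * (k / N)) * Complex.log (-(2 * Real.pi * Complex.I * y)) -
      (Real.log (Real.Gamma (k / N) / Real.Gamma (1 - k / N)) : ℂ)) (2 • phiSeries k N) := by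
    intro k hk hkN
    have h := (gPoch_sub_hasAsymptoticExpansion hk hkN).sub (gPoch_hasAsymptoticExpansion hk hkN)
    rw [sub_neg_eq_add, ← two_nsmul] at h
    refine h.congr fun y _ => ?_
    have hG : 0 < Real.Gamma (1 - k / N) := by
      refine Real.Gamma_pos_of_pos ?_
      rw [sub_pos, div_lt_one (by exact_mod_cast hN0)]
      exact_mod_cast hkN
    rw [Real.log_div (Gamma_div_pos hk hN0).ne' hG.ne']
    push_cast
    ring
  have H := ((key 1 one_pos (by omega)).add (key m hm (by omega))).add (key n hn (by omega))
  have es : 2 • phiSeries 1 N + 2 • phiSeries m N + 2 • phiSeries n N =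
      2 • (-phiSeries (N - 1) N - phiSeries (N - m) N + phiSeries n N) := by
    rw [phiSeries_sub (by omega) hN0, phiSeries_sub (by omega) hN0]
    simp only [two_nsmul]
    ring
  rw [es] at H
  refine H.congr fun y _ => ?_
  have hNc : (N : ℂ) ≠ 0 := by exact_mod_cast hN0.ne'
  have hn' : (n : ℂ) / N = 1 - 1 / N - m / N := by
    have : (n : ℂ) = N - 1 - m := by rw [hN]; push_cast; ring
    rw [this]; field_simp
  simp only [weightSum]
  push_cast
  linear_combination (-2 * Complex.log (-(2 * Real.pi * Complex.I * y))) * hn'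

/-- Conjugate roots leave only imaginary parts of dilogarithms. The constants i(πk/N - π/2) sum to
-πi/2. The three reflections contribute -πi/2 to the linear coefficient and rewriting in terms of ψ
of the trace adds 2πi/3, whence πi/6. -/
theorem fPoch_sub_sub_hasAsymptoticExpansion (hm : 0 < m) (hn : 0 < n) (hN : N = 1 + m + n) :
    HasAsymptoticExpansion
      (fun τ : ℂ => weightSum m n (fun k => fPoch (N - k) N τ - fPoch k N τ) - Real.pi * Complex.I
        + Real.pi * Complex.I / 2
        + weightSum m n (fun k => ((dilog (rootPow N k)).im : ℂ)) / (Real.pi * τ))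
      (-(2 • (-psiSeries (N - 1) N - psiSeries (N - m) N + psiSeries n N)) +
        PowerSeries.C (Real.pi * Complex.I / 6) * PowerSeries.X) := by
  have hN0 : 0 < N := by omega
  have key : ∀ k : ℕ, 0 < k → k < N → HasAsymptoticExpansion (fun τ : ℂ =>
      fPoch (N - k) N τ - fPoch k N τ + ((dilog (rootPow N k)).im : ℂ) / (Real.pi * τ) +
      Complex.I * (Real.pi * k / N - Real.pi / 2)) (psiSeries (N - k) N - psiSeries k N) := by
    intro k hk hkN
    refine ((fPoch_hasAsymptoticExpansion (k := N - k) (N := N) (by omega) (by omega)).sub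
      (fPoch_hasAsymptoticExpansion hk hkN)).congr fun τ hτ => ?_
    have hτ0 := ne_zero_of_im_pos hτ
    have hpi : (Real.pi : ℂ) ≠ 0 := by exact_mod_cast Real.pi_ne_zero
    rw [dilog_rootPow_sub hkN.le hN0, log_one_sub_rootPow hk hkN, log_one_sub_rootPow_sub hk hkN]
    have hI := Complex.I_ne_zero
    field_simp
    ring
  have H := ((key 1 one_pos (by omega)).add (key m hm (by omega))).add (key n hn (by omega))
  have es : psiSeries (N - 1) N - psiSeries 1 N + (psiSeries (N - m) N - psiSeries m N) +
      (psiSeries (N - n) N - psiSeries n N) =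
      -(2 • (-psiSeries (N - 1) N - psiSeries (N - m) N + psiSeries n N)) +
        PowerSeries.C (Real.pi * Complex.I / 6) * PowerSeries.X := by
    rw [psiSeries_sub one_pos (by omega), psiSeries_sub hm (by omega), psiSeries_sub hn (by omega)]
    simp only [two_nsmul]
    ring
  rw [es] at H
  refine H.congr fun τ _ => ?_
  have hNc : (N : ℂ) ≠ 0 := by exact_mod_cast hN0.ne'
  have hn' : (n : ℂ) = N - 1 - m := by rw [hN]; push_cast; ring
  simp only [weightSum]
  rw [hn']
  push_cast
  field_simp
  ring

end StrongWeak

namespace StrongWeak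

/-! ### Sums over divisors as double sums -/

/-- Groups a double series over positive integers by the product of its indices; unconditional
convergence makes the regrouping legitimate. The shifts by one encode positivity. -/
lemma hasSum_sum_divisors {F : ℕ → ℕ → ℂ} {a : ℂ}
    (h : HasSum (fun p : ℕ × ℕ => F (p.1 + 1) (p.2 + 1)) a) :
    HasSum (fun l : ℕ => ∑ d ∈ (l + 1).divisors, F d ((l + 1) / d)) a := by
  have e1 : (fun p : ℕ × ℕ => F (p.1 + 1) (p.2 + 1)) =
      (fun p : ℕ+ × ℕ+ => F p.1 p.2) ∘
        (Equiv.pnatEquivNat.symm.prodCongr Equiv.pnatEquivNat.symm) := by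
    funext p; rfl
  rw [e1, Equiv.hasSum_iff, ← sigmaAntidiagonalEquivProd.hasSum_iff] at h
  have h2 := h.sigma fun n => hasSum_fintype _
  rw [← Equiv.pnatEquivNat.symm.hasSum_iff] at h2
  convert! h2 using 2 with l
  rw [← Nat.sum_divisorsAntidiagonal (fun x y => F x y)]
  have := (Finset.sum_attach (Nat.divisorsAntidiagonal (l + 1)) fun p => F p.1 p.2)
  rw [← this]
  rfl

lemma summable_lambert {c : ℕ → ℕ → ℂ} {C : ℝ} (hc : ∀ d e, ‖c d e‖ ≤ C) {q : ℂ} (hq : ‖q‖ < 1) :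
    Summable fun p : ℕ × ℕ => c (p.1 + 1) (p.2 + 1) * q ^ ((p.1 + 1) * (p.2 + 1)) := by
  have hg := summable_geometric_of_lt_one (norm_nonneg q) hq
  have h1 := (hg.mul_of_nonneg hg (fun _ => by positivity) fun _ => by positivity).mul_left C
  refine Summable.of_norm_bounded h1 fun p => ?_
  rw [norm_mul, norm_pow, ← pow_add]
  refine mul_le_mul (hc _ _) (pow_le_pow_of_le_one (norm_nonneg q) hq.le ?_) (by positivity)
    ((norm_nonneg _).trans (hc 0 0))
  nlinarith

/-- The odd function `d ↦ [d ≡ k] - [d ≡ -k]` modulo `N`. -/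
noncomputable def oddResidue (N k : ℕ) (d : ℕ) : ℂ :=
  (if Int.ModEq (N : ℤ) d k then 1 else 0) - if Int.ModEq (N : ℤ) d (-k) then 1 else 0

lemma norm_oddResidue_le (N k d : ℕ) : ‖oddResidue N k d‖ ≤ 1 := by
  rw [oddResidue]
  split_ifs <;> simp

lemma intModEq_neg_iff {N k d : ℕ} (hk : k ≤ N) :
    Int.ModEq (N : ℤ) d (-(k : ℤ)) ↔ Int.ModEq (N : ℤ) d ((N - k : ℕ) : ℤ) := by
  have h : Int.ModEq (N : ℤ) (-(k : ℤ)) ((N - k : ℕ) : ℤ) := by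
    rw [Nat.cast_sub hk, Int.modEq_iff_dvd]
    simp
  exact ⟨fun H => H.trans h, fun H => H.trans h.symm⟩

lemma hasSum_ite_modEq {N k : ℕ} (hk : 0 < k) (hkN : k < N) {f : ℕ → ℂ} {a : ℂ}
    (h : HasSum (fun j : ℕ => f (k + j * N)) a) :
    HasSum (fun d : ℕ => (if Int.ModEq (N : ℤ) ((d + 1 : ℕ) : ℤ) k then 1 else 0) * f (d + 1)) a := by
  have hinj : Function.Injective fun j : ℕ => k - 1 + j * N := by
    intro i j hij
    simp only [add_right_inj] at hij
    exact Nat.eq_of_mul_eq_mul_right (by omega) hij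
  refine (hinj.hasSum_iff ?_).1 ?_
  · intro d hd
    rw [if_neg, zero_mul]
    intro hmod
    rw [Int.natCast_modEq_iff, Nat.ModEq, Nat.mod_eq_of_lt hkN] at hmod
    refine hd ⟨(d + 1) / N, ?_⟩
    have := Nat.mod_add_div' (d + 1) N
    simp only
    omega
  · convert! h using 1
    funext j
    have e : k - 1 + j * N + 1 = k + j * N := by omega
    simp only [Function.comp, e]
    rw [if_pos, one_mul]
    rw [Int.natCast_modEq_iff]
    simp [Nat.ModEq]

lemma hasSum_oddResidue {N k : ℕ} (hk : 0 < k) (hkN : k < N) {f : ℕ → ℂ} {a b : ℂ}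
    (ha : HasSum (fun j : ℕ => f (k + j * N)) a) (hb : HasSum (fun j : ℕ => f (N - k + j * N)) b) :
    HasSum (fun d : ℕ => oddResidue N k (d + 1) * f (d + 1)) (a - b) := by
  have h := (hasSum_ite_modEq hk hkN ha).sub (hasSum_ite_modEq (by omega) (by omega) hb)
  refine h.congr_fun fun d => ?_
  simp only [oddResidue, intModEq_neg_iff hkN.le, sub_mul]

lemma stokesR_eq (m n : ℕ) (l : ℤ) : stokesR m n l = weightSum m n fun k =>
    ∑ d ∈ l.natAbs.divisors, oddResidue (1 + m + n) k d * (d / l) := by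
  simp only [stokesR, weightSum, oddResidue, sub_mul, ite_mul, one_mul, zero_mul]

lemma natCast_div_div {d l : ℕ} (hd : d ∈ (l + 1).divisors) :
    (d : ℂ) / ((l : ℂ) + 1) = 1 / ((l + 1) / d : ℕ) := by
  have hdvd := Nat.dvd_of_mem_divisors hd
  have hd0 : (d : ℂ) ≠ 0 := by exact_mod_cast (Nat.pos_of_mem_divisors hd).ne'
  rw [Nat.cast_div hdvd hd0]
  push_cast
  rw [one_div_div]

lemma stokesR_succ (m n l : ℕ) : stokesR m n ((l : ℤ) + 1) = weightSum m n fun k =>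
    ∑ d ∈ (l + 1).divisors, oddResidue (1 + m + n) k d / ((l + 1) / d : ℕ) := by
  rw [stokesR_eq]
  congr 1
  funext k
  have e : ((l : ℤ) + 1).natAbs = l + 1 := by omega
  rw [e]
  refine Finset.sum_congr rfl fun d hd => ?_
  push_cast
  rw [natCast_div_div hd]
  ring

lemma two_I_mul_sin_eq (N k d : ℕ) :
    2 * Complex.I * (Real.sin (2 * Real.pi * k * d / (N : ℝ)) : ℂ) =
      rootPow N k ^ d - (rootPow N k)⁻¹ ^ d := by
  rw [rootPow, ← Complex.exp_neg, ← Complex.exp_nat_mul, ← Complex.exp_nat_mul, Complex.ofReal_sin,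
    Complex.sin]
  push_cast
  rw [show -(2 * Real.pi * k * d / N : ℂ) * Complex.I = d * -(2 * Real.pi * Complex.I * k / N) by
    ring, show (2 * Real.pi * k * d / N : ℂ) * Complex.I = d * (2 * Real.pi * Complex.I * k / N) by
    ring]
  linear_combination (Complex.exp (d * -(2 * Real.pi * Complex.I * k / N)) -
    Complex.exp (d * (2 * Real.pi * Complex.I * k / N))) * Complex.I_sq

lemma stokesS_eq (m n : ℕ) (l : ℤ) : stokesS m n l = weightSum m n fun k =>
    ∑ d ∈ l.natAbs.divisors, (rootPow (1 + m + n) k ^ d - (rootPow (1 + m + n) k)⁻¹ ^ d) / d := by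
  rw [stokesS]
  simp only [weightSum, mul_add, Finset.mul_sum]
  congr 1
  · congr 1 <;>
    exact Finset.sum_congr rfl fun d _ => by rw [← two_I_mul_sin_eq]; ring
  · exact Finset.sum_congr rfl fun d _ => by rw [← two_I_mul_sin_eq]; ring

lemma hasSum_weightSum {m n : ℕ} {F : ℕ → ℕ → ℂ} {a : ℕ → ℂ}
    (h : ∀ k, k = 1 ∨ k = m ∨ k = n → HasSum (F k) (a k)) :
    HasSum (fun l => weightSum m n fun k => F k l) (weightSum m n a) :=
  ((h 1 (by simp)).add (h m (by simp))).add (h n (by simp))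

/-! ### The generating functions as sums of `q`-Pochhammer symbols -/

lemma norm_pow_lt_one {q : ℂ} (hq : ‖q‖ < 1) {n : ℕ} (hn : n ≠ 0) : ‖q ^ n‖ < 1 := by
  rw [norm_pow]
  exact pow_lt_one₀ (norm_nonneg _) hq hn

/-- In the double series over l = de, summing over e first gives -log(1 - q^d); the residue classes
of d modulo N then select the factors of the two g. -/
theorem hasSum_gPoch_sub {k N : ℕ} (hk : 0 < k) (hkN : k < N) {y : ℂ} (hy : 0 < y.im) :
    HasSum (fun l : ℕ => ∑ d ∈ (l + 1).divisors, oddResidue N k d / ((l + 1) / d : ℕ) *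
      Complex.exp (2 * Real.pi * Complex.I * y) ^ (d * ((l + 1) / d)))
      (gPoch (N - k) N y - gPoch k N y) := by
  set q := Complex.exp (2 * Real.pi * Complex.I * y) with hq
  have hq1 : ‖q‖ < 1 := norm_exp_two_pi_I_mul_lt_one hy
  refine hasSum_sum_divisors (F := fun d e => oddResidue N k d / e * q ^ (d * e)) ?_
  have hs := summable_lambert (c := fun d e => oddResidue N k d / e) (C := 1) (fun d e => by
    rw [norm_div, Complex.norm_natCast]
    rcases Nat.eq_zero_or_pos e with rfl | he
    · simp
    · rw [div_le_one (by exact_mod_cast he)]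
      exact (norm_oddResidue_le N k d).trans (by exact_mod_cast he)) hq1
  have h1 := hs.hasSum.prod_fiberwise
    (g := fun d => oddResidue N k (d + 1) * -Complex.log (1 - q ^ (d + 1))) fun d => by
      have := (Complex.hasSum_taylorSeries_neg_log'
        (norm_pow_lt_one hq1 (n := d + 1) (Nat.succ_ne_zero d))).mul_left (oddResidue N k (d + 1))
      refine this.congr_fun fun e => ?_
      simp only
      rw [pow_mul]
      push_cast
      ring
  have h2 := hasSum_oddResidue hk hkN (f := fun d => -Complex.log (1 - q ^ d))
    (summable_gPoch k (by omega) hy).hasSum.neg (summable_gPoch (N - k) (by omega) hy).hasSum.neg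
  have h3 := h1.unique h2
  have h4 := hs.hasSum
  rw [h3] at h4
  convert! h4 using 1
  rw [gPoch, gPoch]
  ring

/-- Here the sum over d comes first and gives -log(1 - ζ_N^k q^e) for e ≥ 1. The factor e = 0 of f
is not reached, hence the separate logarithm. -/
theorem hasSum_fPoch (k N : ℕ) {y : ℂ} (hy : 0 < y.im) :
    HasSum (fun l : ℕ => ∑ d ∈ (l + 1).divisors, rootPow N k ^ d / d *
      Complex.exp (2 * Real.pi * Complex.I * y) ^ (d * ((l + 1) / d)))
      (Complex.log (1 - rootPow N k) - fPoch k N y) := by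
  set q := Complex.exp (2 * Real.pi * Complex.I * y) with hq
  have hq1 : ‖q‖ < 1 := norm_exp_two_pi_I_mul_lt_one hy
  refine hasSum_sum_divisors (F := fun d e => rootPow N k ^ d / d * q ^ (d * e)) ?_
  have hs := summable_lambert (c := fun d _ => rootPow N k ^ d / d) (C := 1) (fun d e => by
    rw [norm_div, Complex.norm_natCast, norm_pow, norm_rootPow, one_pow]
    rcases Nat.eq_zero_or_pos d with rfl | he
    · simp
    · rw [div_le_one (by exact_mod_cast he)]
      exact_mod_cast he) hq1
  have h1 := ((Equiv.prodComm ℕ ℕ).hasSum_iff.2 hs.hasSum).prod_fiberwise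
    (g := fun e => -Complex.log (1 - rootPow N k * q ^ (e + 1))) fun e => by
      have hz : ‖rootPow N k * q ^ (e + 1)‖ < 1 := by
        rw [norm_mul, norm_rootPow, one_mul]
        exact norm_pow_lt_one hq1 (Nat.succ_ne_zero e)
      refine (Complex.hasSum_taylorSeries_neg_log' hz).congr_fun fun d => ?_
      simp only [Function.comp, Equiv.prodComm_apply, Prod.swap]
      rw [mul_pow, ← pow_mul, mul_comm (e + 1)]
      push_cast
      ring
  have h2 := ((hasSum_nat_add_iff' 1).2 (summable_fPoch k N hy).hasSum).neg
  have h3 := h1.unique h2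
  have h4 := hs.hasSum
  rw [h3] at h4
  convert! h4 using 1
  rw [fPoch]
  simp

lemma weightSum_congr {m n : ℕ} {F G : ℕ → ℂ} (h : ∀ k, k = 1 ∨ k = m ∨ k = n → F k = G k) :
    weightSum m n F = weightSum m n G := by
  rw [weightSum, weightSum, h 1 (by simp), h m (by simp), h n (by simp)]

lemma weightSum_mul (m n : ℕ) (F : ℕ → ℂ) (z : ℂ) :
    weightSum m n F * z = weightSum m n fun k => F k * z := by
  simp only [weightSum, add_mul]

variable {m n N : ℕ}

theorem hasSum_stokesR (hm : 0 < m) (hn : 0 < n) (hN : N = 1 + m + n) {y : ℂ} (hy : 0 < y.im) :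
    HasSum (fun l : ℕ => stokesR m n ((l : ℤ) + 1) *
      Complex.exp (2 * Real.pi * Complex.I * ((l : ℂ) + 1) * y))
      (weightSum m n fun k => gPoch (N - k) N y - gPoch k N y) := by
  refine (hasSum_weightSum (m := m) (n := n) fun k hk =>
    hasSum_gPoch_sub (k := k) (N := N) (by omega) (by omega) hy).congr_fun fun l => ?_
  rw [stokesR_succ, weightSum_mul, ← hN]
  refine weightSum_congr fun k _ => ?_
  rw [Finset.sum_mul]
  refine Finset.sum_congr rfl fun d hd => ?_
  rw [Nat.mul_div_cancel' (Nat.dvd_of_mem_divisors hd), ← Complex.exp_nat_mul]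
  congr 2
  push_cast
  ring

theorem fInf_eq (hm : 0 < m) (hn : 0 < n) (hN : N = 1 + m + n) {y : ℂ} (hy : 0 < y.im) :
    fInf m n y = weightSum m n fun k => gPoch (N - k) N y - gPoch k N y := by
  rw [fInf, genFun, if_pos hy]
  exact (hasSum_stokesR hm hn hN hy).tsum_eq

theorem hasSum_stokesS (hm : 0 < m) (hn : 0 < n) (hN : N = 1 + m + n) {y : ℂ} (hy : 0 < y.im) :
    HasSum (fun l : ℕ => stokesS m n ((l : ℤ) + 1) *
      Complex.exp (2 * Real.pi * Complex.I * ((l : ℂ) + 1) * y))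
      (weightSum m n (fun k => fPoch (N - k) N y - fPoch k N y) - Real.pi * Complex.I) := by
  have h := hasSum_weightSum (m := m) (n := n) fun k hk =>
    (hasSum_fPoch k N hy).sub (hasSum_fPoch (N - k) N hy)
  have hNc : (N : ℂ) ≠ 0 := by exact_mod_cast (by omega : N ≠ 0)
  have hn' : (n : ℂ) = N - 1 - m := by rw [hN]; push_cast; ring
  -- Each k contributes log(1 - ζ_N^k) - log(1 - ζ_N^(-k)) = i(2πk/N - π); since 1 + m + n = N these
  -- add up to 2πi - 3πi = -πi.
  have e : (weightSum m n fun k => Complex.log (1 - rootPow N k) - fPoch k N y -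
      (Complex.log (1 - rootPow N (N - k)) - fPoch (N - k) N y)) =
      weightSum m n (fun k => fPoch (N - k) N y - fPoch k N y) - Real.pi * Complex.I := by
    simp only [weightSum]
    rw [log_one_sub_rootPow one_pos (by omega), log_one_sub_rootPow hm (by omega),
      log_one_sub_rootPow hn (by omega), log_one_sub_rootPow_sub one_pos (by omega),
      log_one_sub_rootPow_sub hm (by omega), log_one_sub_rootPow_sub hn (by omega), hn']
    push_cast
    field_simp
    ring
  rw [e] at h
  refine h.congr_fun fun l => ?_
  have e1 : ((l : ℤ) + 1).natAbs = l + 1 := by omega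
  rw [stokesS_eq, weightSum_mul, ← hN, e1]
  refine weightSum_congr fun k hk => ?_
  rw [Finset.sum_mul, ← Finset.sum_sub_distrib]
  refine Finset.sum_congr rfl fun d hd => ?_
  rw [Nat.mul_div_cancel' (Nat.dvd_of_mem_divisors hd), ← Complex.exp_nat_mul,
    rootPow_sub (by omega) (by omega),
    show ((l + 1 : ℕ) : ℂ) * (2 * Real.pi * Complex.I * y) =
      2 * Real.pi * Complex.I * ((l : ℂ) + 1) * y by push_cast; ring]
  ring

theorem fZero_eq (hm : 0 < m) (hn : 0 < n) (hN : N = 1 + m + n) {y : ℂ} (hy : 0 < y.im) :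
    fZero m n y =
      weightSum m n (fun k => fPoch (N - k) N y - fPoch k N y) - Real.pi * Complex.I := by
  rw [fZero, genFun, if_pos hy]
  exact (hasSum_stokesS hm hn hN hy).tsum_eq

/-! ### The spectral trace -/

lemma exp_fPoch {k : ℕ} (hk : 0 < k) (hkN : k < N) {y : ℂ} (hy : 0 < y.im) :
    Complex.exp (fPoch k N y) = qPoch (rootPow N k) (Complex.exp (2 * Real.pi * Complex.I * y)) := by
  refine Complex.cexp_tsum_eq_tprod (fun j => ?_) (summable_fPoch k N hy)
  rcases j with _ | j
  · rw [pow_zero, mul_one]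
    exact sub_ne_zero.2 (rootPow_ne_one hk hkN).symm
  · have h : ‖rootPow N k * Complex.exp (2 * Real.pi * Complex.I * y) ^ (j + 1)‖ < 1 := by
      rw [norm_mul, norm_rootPow, one_mul]
      exact norm_pow_lt_one (norm_exp_two_pi_I_mul_lt_one hy) (Nat.succ_ne_zero j)
    intro h0
    rw [← sub_eq_zero.1 h0, norm_one] at h
    exact lt_irrefl _ h

lemma exp_gPoch {k : ℕ} (hk : 0 < k) (hN : 0 < N) {y : ℂ} (hy : 0 < y.im) :
    Complex.exp (gPoch k N (y / N)) = qPoch (Complex.exp (2 * Real.pi * Complex.I * y * (k / N)))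
      (Complex.exp (2 * Real.pi * Complex.I * y)) := by
  have hNc : (N : ℂ) ≠ 0 := by exact_mod_cast hN.ne'
  have hy' : 0 < (y / N : ℂ).im := by
    rw [← Complex.ofReal_natCast, Complex.div_ofReal_im]
    exact div_pos hy (by exact_mod_cast hN)
  rw [gPoch, Complex.cexp_tsum_eq_tprod (fun j => ?_) (summable_gPoch k hN hy')]
  · refine tprod_congr fun j => ?_
    rw [← Complex.exp_nat_mul, ← Complex.exp_nat_mul, ← Complex.exp_add]
    congr 2
    push_cast
    field_simp
  · have h := norm_pow_lt_one (norm_exp_two_pi_I_mul_lt_one hy') (n := k + j * N) (by omega)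
    intro h0
    rw [← sub_eq_zero.1 h0, norm_one] at h
    exact lt_irrefl _ h

theorem exp_logSpecTrace (hm : 0 < m) (hn : 0 < n) {y : ℂ} (hy : 0 < y.im) :
    Complex.exp (logSpecTrace m n y) = specTrace m n y := by
  obtain ⟨N, hN⟩ : ∃ N, N = 1 + m + n := ⟨_, rfl⟩
  have hNc : (N : ℂ) ≠ 0 := by exact_mod_cast (by omega : N ≠ 0)
  have hy0 := ne_zero_of_im_pos hy
  have hsin : (Real.sin (Real.pi * n / N) : ℂ) ≠ 0 := by
    exact_mod_cast (sin_pi_mul_div_pos hn (by omega)).ne'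
  have hsqrt : y ^ (1 / 2 : ℂ) ≠ 0 := by
    rw [Complex.cpow_def_of_ne_zero hy0]; exact Complex.exp_ne_zero _
  have hy1 := im_neg_one_div_pos hy
  simp only [logSpecTrace, zSum, specTrace, ← hN]
  have hprod : 2 * y ^ (1 / 2 : ℂ) * (Real.sin (Real.pi * n / N) : ℂ) ≠ 0 :=
    mul_ne_zero (mul_ne_zero two_ne_zero hsqrt) hsin
  simp only [Complex.exp_add, Complex.exp_sub, Complex.exp_log hprod]
  rw [exp_gPoch (by omega) (by omega) hy, exp_gPoch (by omega) (by omega) hy,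
    exp_gPoch hn (by omega) hy, exp_fPoch (by omega) (by omega) hy1,
    exp_fPoch (by omega) (by omega) hy1, exp_fPoch hn (by omega) hy1]
  have e1 : ((N - 1 : ℕ) : ℂ) / N = 1 - 1 / N := by
    rw [Nat.cast_sub (by omega)]; field_simp; simp
  have em : ((N - m : ℕ) : ℂ) / N = 1 - m / N := by
    rw [Nat.cast_sub (by omega)]; field_simp
  have eq : 2 * Real.pi * Complex.I * (-1 / y) = -(2 * Real.pi * Complex.I / y) := by ring
  have r1 : rootPow N (N - 1) = Complex.exp (2 * Real.pi * Complex.I * ((-1 : ℤ) : ℂ) / N) := by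
    rw [rootPow_sub (by omega) (by omega), rootPow, ← Complex.exp_neg]
    congr 1
    push_cast
    ring
  have rm : rootPow N (N - m) = Complex.exp (2 * Real.pi * Complex.I * ((-m : ℤ) : ℂ) / N) := by
    rw [rootPow_sub (by omega) (by omega), rootPow, ← Complex.exp_neg]
    congr 1
    push_cast
    ring
  rw [e1, em, eq, r1, rm, rootPow]
  push_cast
  ring

end StrongWeak

namespace StrongWeak

/-! ### Polylogarithms of negative order at roots of unity -/

lemma summable_inv_nat_add_one_sq : Summable fun n : ℕ => (((n : ℝ) + 1) ^ 2)⁻¹ := by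
  have := (summable_nat_add_iff 1).2 (Real.summable_one_div_nat_pow (p := 2).2 (by norm_num))
  simpa using this

lemma inv_nat_add_le {δ t : ℝ} (hδ : 0 < δ) (hδ1 : δ ≤ 1) (ht : δ ≤ t) (n : ℕ) :
    ((n : ℝ) + t)⁻¹ ≤ δ⁻¹ * ((n : ℝ) + 1)⁻¹ := by
  rw [← mul_inv]
  refine inv_anti₀ (by positivity) ?_
  nlinarith [(Nat.cast_nonneg n : (0 : ℝ) ≤ n)]

/-- For j = 1 neither series converges alone, but the difference of reciprocals is O(1/n²); for
larger j the factor a - b of a^j - b^j gives the same gain. -/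
lemma summable_inv_pow_sub_inv_pow {t : ℝ} (h0 : 0 < t) (h1 : t < 1) (j : ℕ) :
    Summable fun n : ℕ => (((n : ℝ) + t) ^ j)⁻¹ - (((n : ℝ) + 1 - t) ^ j)⁻¹ := by
  set δ := min t (1 - t) with hδ
  have hδ0 : 0 < δ := lt_min h0 (by linarith)
  have hδ1 : δ ≤ 1 := (min_le_left _ _).trans h1.le
  refine Summable.of_norm_bounded
    (summable_inv_nat_add_one_sq.mul_left ((δ⁻¹) ^ 2 * j * (δ⁻¹) ^ (j - 1))) fun n => ?_
  have hn : (0 : ℝ) ≤ n := Nat.cast_nonneg n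
  have ha := inv_nat_add_le hδ0 hδ1 (min_le_left t (1 - t)) n
  have hb := inv_nat_add_le hδ0 hδ1 (min_le_right t (1 - t)) n
  rw [← add_sub_assoc] at hb
  have ha0 : 0 < ((n : ℝ) + t)⁻¹ := by positivity
  have hb0 : 0 < ((n : ℝ) + 1 - t)⁻¹ := inv_pos.2 (by linarith)
  have hle : δ⁻¹ * ((n : ℝ) + 1)⁻¹ ≤ δ⁻¹ := by
    refine mul_le_of_le_one_right (by positivity) ?_
    rw [inv_le_one₀ (by positivity)]
    linarith
  have hdiff : ((n : ℝ) + t)⁻¹ - ((n : ℝ) + 1 - t)⁻¹ =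
      (1 - 2 * t) * (((n : ℝ) + t)⁻¹ * ((n : ℝ) + 1 - t)⁻¹) := by
    have : (n : ℝ) + 1 - t ≠ 0 := by linarith
    field_simp
    ring
  have habs : |((n : ℝ) + t)⁻¹ - ((n : ℝ) + 1 - t)⁻¹| ≤ (δ⁻¹) ^ 2 * (((n : ℝ) + 1) ^ 2)⁻¹ := by
    rw [hdiff, abs_mul, abs_of_pos (mul_pos ha0 hb0)]
    calc |1 - 2 * t| * (((n : ℝ) + t)⁻¹ * ((n : ℝ) + 1 - t)⁻¹)
        ≤ 1 * ((δ⁻¹ * ((n : ℝ) + 1)⁻¹) * (δ⁻¹ * ((n : ℝ) + 1)⁻¹)) := by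
          gcongr
          rw [abs_le]; constructor <;> linarith
      _ = _ := by rw [← inv_pow ((n : ℝ) + 1)]; ring
  rw [← inv_pow, ← inv_pow, Real.norm_eq_abs]
  refine (abs_pow_sub_pow_le _ _ j).trans ?_
  have hmax : max |((n : ℝ) + t)⁻¹| |((n : ℝ) + 1 - t)⁻¹| ≤ δ⁻¹ := by
    rw [abs_of_pos ha0, abs_of_pos hb0]
    exact max_le (ha.trans hle) (hb.trans hle)
  calc _ ≤ (δ⁻¹) ^ 2 * (((n : ℝ) + 1) ^ 2)⁻¹ * j * (δ⁻¹) ^ (j - 1) := by gcongr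
    _ = _ := by ring

/-- The terms of the partial fraction expansion of the derivatives of `π cot (π t)`. -/
noncomputable def cotSummand (s : ℕ) (t : ℝ) (n : ℕ) : ℝ :=
  (((n : ℝ) + t) ^ (s + 1))⁻¹ + (-1) ^ (s + 1) * (((n : ℝ) + 1 - t) ^ (s + 1))⁻¹

lemma abs_cotSummand_succ_le {δ t : ℝ} (hδ : 0 < δ) (hδ1 : δ ≤ 1) (ht : δ ≤ t) (ht1 : t ≤ 1 - δ)
    (s n : ℕ) : |cotSummand (s + 1) t n| ≤ 2 * (δ⁻¹) ^ (s + 2) * (((n : ℝ) + 1) ^ 2)⁻¹ := by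
  have hn : (0 : ℝ) ≤ n := Nat.cast_nonneg n
  have ha := inv_nat_add_le hδ hδ1 ht n
  have hb := inv_nat_add_le hδ hδ1 (by linarith : δ ≤ 1 - t) n
  rw [← add_sub_assoc] at hb
  have ha0 : 0 < ((n : ℝ) + t)⁻¹ := inv_pos.2 (by linarith)
  have hb0 : 0 < ((n : ℝ) + 1 - t)⁻¹ := inv_pos.2 (by linarith)
  have hpow : ∀ x : ℝ, 0 < x → x ≤ δ⁻¹ * ((n : ℝ) + 1)⁻¹ →
      x ^ (s + 2) ≤ (δ⁻¹) ^ (s + 2) * (((n : ℝ) + 1) ^ 2)⁻¹ := by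
    intro x hx hxl
    calc x ^ (s + 2) ≤ (δ⁻¹ * ((n : ℝ) + 1)⁻¹) ^ (s + 2) := by gcongr
      _ = (δ⁻¹) ^ (s + 2) * (((n : ℝ) + 1)⁻¹) ^ (s + 2) := mul_pow _ _ _
      _ ≤ (δ⁻¹) ^ (s + 2) * (((n : ℝ) + 1)⁻¹) ^ 2 := by
        gcongr _ * ?_
        refine pow_le_pow_of_le_one (by positivity) ?_ (by omega)
        rw [inv_le_one₀ (by positivity)]
        linarith
      _ = _ := by rw [inv_pow _ 2]
  have e1 : |cotSummand (s + 1) t n| ≤ (((n : ℝ) + t)⁻¹) ^ (s + 2) +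
      (((n : ℝ) + 1 - t)⁻¹) ^ (s + 2) := by
    rw [cotSummand]
    refine (abs_add_le _ _).trans ?_
    rw [abs_mul, abs_pow, abs_neg, abs_one, one_pow, one_mul, ← inv_pow, ← inv_pow, abs_pow,
      abs_pow, abs_of_pos ha0, abs_of_pos hb0]
  linarith [hpow _ ha0 ha, hpow _ hb0 hb]

lemma summable_cotSummand {t : ℝ} (h0 : 0 < t) (h1 : t < 1) (s : ℕ) :
    Summable (cotSummand s t) := by
  rcases s with _ | s
  · refine (summable_inv_pow_sub_inv_pow h0 h1 1).congr fun n => ?_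
    simp only [cotSummand]
    ring
  · have hδ : 0 < min t (1 - t) := lt_min h0 (by linarith)
    refine Summable.of_norm_bounded (summable_inv_nat_add_one_sq.mul_left _) fun n =>
      abs_cotSummand_succ_le hδ ((min_le_left _ _).trans h1.le) (min_le_left _ _) ?_ s n
    linarith [min_le_right t (1 - t)]

lemma hasDerivAt_cotSummand {t : ℝ} (h0 : 0 < t) (h1 : t < 1) (s n : ℕ) :
    HasDerivAt (fun t => cotSummand s t n) (-((s : ℝ) + 1) * cotSummand (s + 1) t n) t := by
  have hn : (0 : ℝ) ≤ n := Nat.cast_nonneg n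
  have ha : (n : ℝ) + t ≠ 0 := by positivity
  have hb : (n : ℝ) + 1 - t ≠ 0 := by linarith
  have d1 := (((hasDerivAt_id t).const_add (n : ℝ)).pow (s + 1)).inv (pow_ne_zero _ ha)
  have d2 := ((((hasDerivAt_id t).const_sub ((n : ℝ) + 1)).pow (s + 1)).inv
    (pow_ne_zero _ hb)).const_mul ((-1 : ℝ) ^ (s + 1))
  refine (d1.add d2).congr_deriv ?_
  simp only [cotSummand, id, Pi.pow_apply, Nat.add_sub_cancel]
  push_cast
  field_simp
  ring

lemma hasDerivAt_tsum_cotSummand {t : ℝ} (h0 : 0 < t) (h1 : t < 1) (s : ℕ) :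
    HasDerivAt (fun t => ∑' n, cotSummand s t n)
      (-((s : ℝ) + 1) * ∑' n, cotSummand (s + 1) t n) t := by
  set δ := min t (1 - t) / 2 with hδ
  have hm : 0 < min t (1 - t) := lt_min h0 (by linarith)
  have hδ0 : 0 < δ := by positivity
  have hl := min_le_left t (1 - t)
  have hr := min_le_right t (1 - t)
  have hmem : t ∈ Set.Ioo δ (1 - δ) := ⟨by rw [hδ]; linarith, by rw [hδ]; linarith⟩
  have hδ1 : δ ≤ 1 := by rw [hδ]; linarith
  have h := hasDerivAt_tsum_of_isPreconnected (𝕜 := ℝ) (F := ℝ)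
    (g := fun (n : ℕ) t => cotSummand s t n)
    (g' := fun (n : ℕ) t => -((s : ℝ) + 1) * cotSummand (s + 1) t n)
    (u := fun (n : ℕ) => ((s : ℝ) + 1) * (2 * (δ⁻¹) ^ (s + 2) * (((n : ℝ) + 1) ^ 2)⁻¹))
    ((summable_inv_nat_add_one_sq.mul_left _).mul_left _) isOpen_Ioo isPreconnected_Ioo
    (fun n y hy => hasDerivAt_cotSummand (hδ0.trans hy.1) (by linarith [hy.2]) s n)
    (fun n y hy => by
      rw [norm_mul, norm_neg, Real.norm_of_nonneg (by positivity)]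
      gcongr
      exact abs_cotSummand_succ_le hδ0 hδ1 hy.1.le hy.2.le s n)
    hmem (summable_cotSummand h0 h1 s) hmem
  rwa [tsum_mul_left] at h

/-- The classical expansion pairs t + n with t - n; here n + t is paired with n + 1 - t. The two
arrangements differ by a telescoping series with sum 1/t. -/
lemma tsum_cotSummand_zero {t : ℝ} (h0 : 0 < t) (h1 : t < 1) :
    ((∑' n, cotSummand 0 t n : ℝ) : ℂ) = Real.pi * Complex.cot (Real.pi * t) := by
  have hmem : (t : ℂ) ∈ Complex.integerComplement := by
    rw [Complex.mem_integerComplement_iff]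
    rintro ⟨n, hn⟩
    have hn' : (n : ℝ) = t := by exact_mod_cast hn
    rw [← hn'] at h0 h1
    have h2 : 0 < n := by exact_mod_cast h0
    have h3 : n < 1 := by exact_mod_cast h1
    omega
  have hc := cot_series_rep' hmem
  have ht : HasSum (fun n : ℕ => ((n : ℝ) + t)⁻¹ - (((n + 1 : ℕ) : ℝ) + t)⁻¹) t⁻¹ := by
    refine (hasSum_iff_tendsto_nat_of_nonneg (fun n => ?_) _).2 ?_
    · rw [sub_nonneg]
      refine inv_anti₀ (by positivity) ?_
      push_cast
      linarith
    · have : ∀ M : ℕ, ∑ n ∈ Finset.range M, (((n : ℝ) + t)⁻¹ - (((n + 1 : ℕ) : ℝ) + t)⁻¹) =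
          t⁻¹ - ((M : ℝ) + t)⁻¹ := by
        intro M
        rw [Finset.sum_range_sub' (fun n : ℕ => ((n : ℝ) + t)⁻¹)]
        simp
      simp only [this]
      have h2 : Tendsto (fun M : ℕ => ((M : ℝ) + t)⁻¹) atTop (𝓝 0) :=
        tendsto_inv_atTop_zero.comp
          (tendsto_atTop_add_const_right _ _ tendsto_natCast_atTop_atTop)
      simpa using h2.const_sub t⁻¹
  have hs := (summable_cotSummand h0 h1 0).hasSum.sub ht
  have hs' := Complex.hasSum_ofReal.2 hs
  have e : (fun n : ℕ => ((cotSummand 0 t n - (((n : ℝ) + t)⁻¹ - (((n + 1 : ℕ) : ℝ) + t)⁻¹) : ℝ) : ℂ))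
      = fun n : ℕ => 1 / ((t : ℂ) - (n + 1)) + 1 / (t + (n + 1)) := by
    funext n
    have hb : (n : ℝ) + 1 - t ≠ 0 := by
      have : (0 : ℝ) ≤ n := Nat.cast_nonneg n
      linarith
    have hr : (cotSummand 0 t n - (((n : ℝ) + t)⁻¹ - (((n + 1 : ℕ) : ℝ) + t)⁻¹) : ℝ) =
        1 / (t - (n + 1)) + 1 / (t + (n + 1)) := by
      rw [cotSummand, show t - ((n : ℝ) + 1) = -((n : ℝ) + 1 - t) by ring]
      push_cast
      rw [one_div, one_div, inv_neg, add_comm t]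
      ring
    rw [hr]
    push_cast
    ring
  have hs'' := hs'.tsum_eq
  simp only [e] at hs''
  rw [← hc] at hs''
  push_cast at hs'' ⊢
  linear_combination -hs''

lemma exp_two_pi_I_ne_one {t : ℝ} (h0 : 0 < t) (h1 : t < 1) :
    Complex.exp (2 * Real.pi * Complex.I * t) ≠ 1 := by
  rw [Ne, Complex.exp_eq_one_iff]
  rintro ⟨n, hn⟩
  have hn' : (t : ℂ) = n := by
    have h2 : (2 * Real.pi * Complex.I : ℂ) ≠ 0 := Complex.two_pi_I_ne_zero
    exact mul_left_cancel₀ h2 (by linear_combination hn)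
  have h3 : t = n := by exact_mod_cast hn'
  rw [h3] at h0 h1
  have h4 : 0 < n := by exact_mod_cast h0
  have h5 : n < 1 := by exact_mod_cast h1
  omega

/-- At s = 0 this is z/(1 - z) = (i/2) cot(πt) - 1/2; higher orders follow by termwise
differentiation, as z d/dz is (2πi)⁻¹ d/dt. The constant -1/2 survives only at s = 0 and causes the
exceptional term at j = 1 in the large-order relation. -/
theorem polylogNeg_exp (s : ℕ) {t : ℝ} (h0 : 0 < t) (h1 : t < 1) :
    polylogNeg s (Complex.exp (2 * Real.pi * Complex.I * t)) =
      s.factorial * (Complex.I / (2 * Real.pi)) ^ (s + 1) * ((∑' n, cotSummand s t n : ℝ) : ℂ) -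
        if s = 0 then 1 / 2 else 0 := by
  have hpi : (Real.pi : ℂ) ≠ 0 := by exact_mod_cast Real.pi_ne_zero
  induction s generalizing t with
  | zero =>
    rw [tsum_cotSummand_zero h0 h1, Complex.cot_eq_exp_ratio]
    have h2 := exp_two_pi_I_ne_one h0 h1
    have e : (2 * Complex.I * (Real.pi * t) : ℂ) = 2 * Real.pi * Complex.I * t := by ring
    have h3 : 1 - Complex.exp (2 * Real.pi * Complex.I * t) ≠ 0 := sub_ne_zero.2 h2.symm
    rw [e]
    simp only [polylogNeg, if_true]
    have hI := Complex.I_ne_zero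
    rw [Nat.factorial_zero, Nat.cast_one, zero_add, pow_one, one_mul]
    generalize Complex.exp (2 * Real.pi * Complex.I * t) = E at h3 ⊢
    field_simp
    ring
  | succ s ih =>
    set z := Complex.exp (2 * Real.pi * Complex.I * t) with hz
    have hexp : HasDerivAt (fun t : ℝ => Complex.exp (2 * Real.pi * Complex.I * t))
        (z * (2 * Real.pi * Complex.I * 1)) t :=
      ((Complex.ofRealCLM.hasDerivAt (x := t)).const_mul (2 * Real.pi * Complex.I)).cexp
    have hd1 := ((differentiableAt_polylogNeg s (exp_two_pi_I_ne_one h0 h1)).hasDerivAt).comp t hexp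
    have hd2 := (((hasDerivAt_tsum_cotSummand h0 h1 s).ofReal_comp).const_mul
      ((s.factorial : ℂ) * (Complex.I / (2 * Real.pi)) ^ (s + 1))).sub_const
      (if s = 0 then (1 / 2 : ℂ) else 0)
    have hev : (fun t : ℝ => polylogNeg s (Complex.exp (2 * Real.pi * Complex.I * t))) =ᶠ[𝓝 t]
        fun t => s.factorial * (Complex.I / (2 * Real.pi)) ^ (s + 1) *
          ((∑' n, cotSummand s t n : ℝ) : ℂ) - if s = 0 then 1 / 2 else 0 := by
      filter_upwards [Ioo_mem_nhds h0 h1] with u hu using ih hu.1 hu.2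
    have h3 := hd1.unique (hd2.congr_of_eventuallyEq hev)
    rw [← hz] at h3
    rw [if_neg (Nat.succ_ne_zero s), sub_zero]
    simp only [polylogNeg]
    have hI := Complex.I_ne_zero
    have h4 : z * deriv (polylogNeg s) z = (2 * Real.pi * Complex.I)⁻¹ *
        (deriv (polylogNeg s) z * (z * (2 * Real.pi * Complex.I * 1))) := by
      field_simp
    rw [h4, h3, Nat.factorial_succ, pow_succ _ (s + 1)]
    push_cast
    field_simp
    linear_combination (-(s.factorial : ℂ) * ∑' n, (cotSummand (s + 1) t n : ℂ)) * Complex.I_sq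

end StrongWeak

namespace StrongWeak

/-! ### Summation of the Stokes constants in the natural order -/

/-- An incomplete block has fewer than N terms, each tending to 0, so convergence along multiples of
N suffices. -/
lemma tendsto_sum_range_of_blocks {u : ℕ → ℂ} (hu : Tendsto u atTop (𝓝 0)) {N : ℕ} (hN : 0 < N)
    {T : ℂ} (h : Tendsto (fun M : ℕ => ∑ i ∈ Finset.range (M * N), u i) atTop (𝓝 T)) :
    Tendsto (fun x : ℕ => ∑ i ∈ Finset.range x, u i) atTop (𝓝 T) := by
  have hdiv : Tendsto (fun x : ℕ => x / N) atTop atTop := Nat.tendsto_div_const_atTop hN.ne'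
  have h1 := h.comp hdiv
  have h2 : Tendsto (fun x : ℕ => ∑ i ∈ Finset.range (x % N), u (x / N * N + i)) atTop (𝓝 0) := by
    have h3 : Tendsto (fun x : ℕ => ∑ i ∈ Finset.range N, ‖u (x / N * N + i)‖) atTop (𝓝 0) := by
      rw [show (0 : ℝ) = ∑ i ∈ Finset.range N, 0 by simp]
      refine tendsto_finsetSum _ fun i _ => ?_
      have h4 : Tendsto (fun x : ℕ => x / N * N + i) atTop atTop :=
        tendsto_atTop_mono (fun x => Nat.le_add_right_of_le (Nat.le_mul_of_pos_right _ hN)) hdiv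
      simpa using (hu.comp h4).norm
    refine squeeze_zero_norm (fun x => (norm_sum_le _ _).trans ?_) h3
    exact Finset.sum_le_sum_of_subset_of_nonneg
      (Finset.range_mono (Nat.mod_lt x hN).le) fun _ _ _ => norm_nonneg _
  have h5 := h1.add h2
  rw [add_zero] at h5
  refine h5.congr fun x => ?_
  rw [Function.comp, ← Finset.sum_range_add, Nat.div_add_mod']

lemma oddResidue_add_mul {N k : ℕ} (hk : 0 < k) (hkN : k < N) (M : ℕ) {i : ℕ} (hi : i < N) :
    oddResidue N k (M * N + i + 1) =
      (if i = k - 1 then 1 else 0) - if i = N - k - 1 then 1 else 0 := by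
  have key : ∀ r : ℕ, 0 < r → r < N →
      (Int.ModEq (N : ℤ) ((M * N + i + 1 : ℕ) : ℤ) (r : ℤ) ↔ i = r - 1) := by
    intro r hr hrN
    rw [Int.natCast_modEq_iff, Nat.ModEq, Nat.mod_eq_of_lt hrN, add_assoc, Nat.mul_add_mod_self_right]
    rcases Nat.lt_or_ge (i + 1) N with h | h
    · rw [Nat.mod_eq_of_lt h]; omega
    · have : i + 1 = N := by omega
      rw [this, Nat.mod_self]
      omega
  simp only [oddResidue, intModEq_neg_iff hkN.le, key k hk hkN, key (N - k) (by omega) (by omega)]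

/-- Among N consecutive integers only those congruent to k and to N - k matter, so summing by blocks
performs the pairing that conditional convergence requires. -/
lemma sum_oddResidue_blocks {N k : ℕ} (hk : 0 < k) (hkN : k < N) (g : ℕ → ℂ) (M : ℕ) :
    ∑ i ∈ Finset.range (M * N), oddResidue N k (i + 1) * g (i + 1) =
      ∑ n ∈ Finset.range M, (g (k + n * N) - g (N - k + n * N)) := by
  induction M with
  | zero => simp
  | succ M ih =>
    rw [Nat.succ_mul, Finset.sum_range_add, ih, Finset.sum_range_succ]
    congr 1
    rw [Finset.sum_congr rfl fun i hi => by
      rw [oddResidue_add_mul hk hkN M (Finset.mem_range.1 hi), sub_mul, ite_mul, ite_mul, one_mul,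
        zero_mul]]
    rw [Finset.sum_sub_distrib, Finset.sum_ite_eq', Finset.sum_ite_eq',
      if_pos (Finset.mem_range.2 (by omega)), if_pos (Finset.mem_range.2 (by omega))]
    congr 2 <;> omega

/-- `∑ ((k + n N) ^ (-j) - (N - k + n N) ^ (-j))`, a difference of two Hurwitz zeta values. -/
noncomputable def residueSum (N k j : ℕ) : ℂ :=
  ∑' n : ℕ, (1 / ((k + n * N : ℕ) : ℂ) ^ j - 1 / ((N - k + n * N : ℕ) : ℂ) ^ j)

lemma residueSummand_eq {N k : ℕ} (hk : 0 < k) (hkN : k < N) (j n : ℕ) :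
    1 / ((k + n * N : ℕ) : ℂ) ^ j - 1 / ((N - k + n * N : ℕ) : ℂ) ^ j =
      1 / (N : ℂ) ^ j * (((((n : ℝ) + k / N) ^ j)⁻¹ - (((n : ℝ) + 1 - k / N) ^ j)⁻¹ : ℝ) : ℂ) := by
  have hN : (N : ℂ) ≠ 0 := by exact_mod_cast (by omega : N ≠ 0)
  have e1 : ((k + n * N : ℕ) : ℂ) = N * (n + k / N) := by push_cast; field_simp; ring
  have e2 : ((N - k + n * N : ℕ) : ℂ) = N * (n + 1 - k / N) := by
    rw [Nat.cast_add, Nat.cast_sub hkN.le]; push_cast; field_simp; ring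
  rw [e1, e2, mul_pow, mul_pow]
  push_cast
  rw [one_div_mul_eq_div]
  ring

lemma summable_residueSum {N k : ℕ} (hk : 0 < k) (hkN : k < N) (j : ℕ) :
    Summable fun n : ℕ => 1 / ((k + n * N : ℕ) : ℂ) ^ j - 1 / ((N - k + n * N : ℕ) : ℂ) ^ j := by
  have hN : (0 : ℝ) < N := by exact_mod_cast (by omega : 0 < N)
  have hk' : (0 : ℝ) < k := by exact_mod_cast hk
  simp only [residueSummand_eq hk hkN]
  refine Summable.mul_left _ (Complex.hasSum_ofReal.2
    (summable_inv_pow_sub_inv_pow (by positivity) ?_ j).hasSum).summable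
  rw [div_lt_one hN]
  exact_mod_cast hkN

lemma tendsto_sum_oddResidue {N k : ℕ} (hk : 0 < k) (hkN : k < N) {j : ℕ} (hj : 1 ≤ j) :
    Tendsto (fun x : ℕ => ∑ d ∈ Finset.range x, oddResidue N k (d + 1) * (1 / ((d + 1 : ℕ) : ℂ) ^ j))
      atTop (𝓝 (residueSum N k j)) := by
  refine tendsto_sum_range_of_blocks (N := N) ?_ (by omega) ?_
  · have h1 : Tendsto (fun d : ℕ => 1 / ((d : ℝ) + 1)) atTop (𝓝 0) :=
      tendsto_one_div_add_atTop_nhds_zero_nat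
    refine squeeze_zero_norm (fun d => ?_) h1
    rw [norm_mul, norm_div, norm_one, norm_pow, Complex.norm_natCast]
    calc _ ≤ 1 * (1 / ((d + 1 : ℕ) : ℝ) ^ j) := by
          gcongr
          exact norm_oddResidue_le N k _
      _ ≤ 1 * (1 / ((d + 1 : ℕ) : ℝ) ^ 1) := by
          gcongr
          exact_mod_cast Nat.succ_le_succ (Nat.zero_le d)
      _ = _ := by push_cast; ring
  · simp only [sum_oddResidue_blocks hk hkN fun d => 1 / (d : ℂ) ^ j]
    exact (summable_residueSum hk hkN j).hasSum.tendsto_sum_nat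

/-- Both sides sum over the lattice points de ≤ L under the hyperbola; the right side fixes e and
lets d run up to L/e. -/
lemma sum_range_sum_divisors (F : ℕ → ℕ → ℂ) (L : ℕ) :
    ∑ l ∈ Finset.range L, ∑ d ∈ (l + 1).divisors, F d ((l + 1) / d) =
      ∑ e ∈ Finset.range L, ∑ d ∈ Finset.range (L / (e + 1)), F (d + 1) (e + 1) := by
  have h1 : ∀ l : ℕ, ∑ d ∈ (l + 1).divisors, F d ((l + 1) / d) =
      ∑ p ∈ (l + 1).divisorsAntidiagonal, F p.1 p.2 := fun l =>
    (Nat.sum_divisorsAntidiagonal (fun x y => F x y)).symm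
  simp only [h1]
  rw [Finset.sum_sigma', Finset.sum_sigma']
  refine Finset.sum_bij' (fun p _ => ⟨p.2.2 - 1, p.2.1 - 1⟩)
    (fun p _ => ⟨(p.2 + 1) * (p.1 + 1) - 1, (p.2 + 1, p.1 + 1)⟩) ?_ ?_ ?_ ?_ ?_
  · rintro ⟨l, d, e⟩ h
    simp only [Finset.mem_sigma, Finset.mem_range, Nat.mem_divisorsAntidiagonal] at h ⊢
    obtain ⟨hl, hde, -⟩ := h
    have hd : 0 < d := Nat.pos_of_ne_zero (by rintro rfl; simp at hde)
    have he : 0 < e := Nat.pos_of_ne_zero (by rintro rfl; simp at hde)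
    rw [Nat.sub_add_cancel he]
    have h2 : d ≤ L / e := (Nat.le_div_iff_mul_le he).2 (by omega)
    have h3 : e ≤ d * e := Nat.le_mul_of_pos_left e hd
    omega
  · rintro ⟨e, d⟩ h
    simp only [Finset.mem_sigma, Finset.mem_range, Nat.mem_divisorsAntidiagonal] at h ⊢
    have h2 : (d + 1) * (e + 1) ≤ L := (Nat.le_div_iff_mul_le (Nat.succ_pos e)).1 h.2
    have h3 : 0 < (d + 1) * (e + 1) := by positivity
    omega
  · rintro ⟨l, d, e⟩ h
    simp only [Finset.mem_sigma, Finset.mem_range, Nat.mem_divisorsAntidiagonal] at h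
    obtain ⟨hl, hde, -⟩ := h
    have hd : 0 < d := Nat.pos_of_ne_zero (by rintro rfl; simp at hde)
    have he : 0 < e := Nat.pos_of_ne_zero (by rintro rfl; simp at hde)
    simp only [Nat.sub_add_cancel hd, Nat.sub_add_cancel he, hde, Nat.add_sub_cancel]
  · rintro ⟨e, d⟩ _
    simp
  · rintro ⟨l, d, e⟩ h
    simp only [Finset.mem_sigma, Finset.mem_range, Nat.mem_divisorsAntidiagonal] at h
    obtain ⟨hl, hde, -⟩ := h
    have hd : 0 < d := Nat.pos_of_ne_zero (by rintro rfl; simp at hde)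
    have he : 0 < e := Nat.pos_of_ne_zero (by rintro rfl; simp at hde)
    simp only [Nat.sub_add_cancel hd, Nat.sub_add_cancel he]

lemma norm_natCast_add_one (e : ℕ) : ‖(e : ℂ) + 1‖ = (e : ℝ) + 1 := by
  rw [← Nat.cast_add_one, Complex.norm_natCast]; push_cast; rfl

lemma summable_norm_one_div_pow {s : ℕ} (hs : 2 ≤ s) :
    Summable fun e : ℕ => ‖1 / ((e : ℂ) + 1) ^ s‖ := by
  have := (summable_nat_add_iff 1).2 (Real.summable_one_div_nat_pow (p := s).2 (by omega))
  refine this.congr fun e => ?_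
  rw [norm_div, norm_one, norm_pow, norm_natCast_add_one]
  push_cast
  rfl

/-- For fixed e the argument L/(e + 1) tends to infinity, and A is bounded because it converges;
dominated convergence applies. -/
lemma tendsto_tsum_mul_comp_div {A : ℕ → ℂ} {T : ℂ} (hA : Tendsto A atTop (𝓝 T)) {w : ℕ → ℂ}
    (hw : Summable fun e => ‖w e‖) :
    Tendsto (fun L : ℕ => ∑' e : ℕ, w e * A (L / (e + 1))) atTop (𝓝 ((∑' e, w e) * T)) := by
  obtain ⟨C, hC⟩ := isBounded_iff_forall_norm_le.1 (Metric.isBounded_range_of_tendsto A hA)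
  rw [← tsum_mul_right]
  refine tendsto_tsum_of_dominated_convergence (bound := fun e => ‖w e‖ * C) (hw.mul_right C)
    (fun e => ((hA.comp (Nat.tendsto_div_const_atTop (Nat.succ_ne_zero e))).const_mul (w e)))
    (Eventually.of_forall fun L e => ?_)
  rw [norm_mul]
  gcongr
  exact hC _ ⟨_, rfl⟩

/-- The double series has terms χ(d) d^(-j) e^(-j-1) with χ the odd residue function. Under the
hyperbola the outer sum over e is absolutely convergent even for j = 1, and only the inner sums over
d need cancellation. -/
theorem tendsto_sum_oddResidue_divisors {N k : ℕ} (hk : 0 < k) (hkN : k < N) {j : ℕ} (hj : 1 ≤ j) :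
    Tendsto (fun L : ℕ => ∑ l ∈ Finset.range L,
      (∑ d ∈ (l + 1).divisors, oddResidue N k d / ((l + 1) / d : ℕ)) / ((l : ℂ) + 1) ^ j) atTop
      (𝓝 ((∑' e : ℕ, 1 / ((e : ℂ) + 1) ^ (j + 1)) * residueSum N k j)) := by
  have h := tendsto_tsum_mul_comp_div (tendsto_sum_oddResidue hk hkN hj)
    (summable_norm_one_div_pow (s := j + 1) (by omega))
  refine h.congr fun L => ?_
  -- For e ≥ L the quotient L/(e + 1) is 0 and the inner sum is empty.
  rw [tsum_eq_sum (s := Finset.range L) fun e he => by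
    rw [Finset.mem_range, not_lt] at he
    rw [Nat.div_eq_of_lt (by omega), Finset.range_zero, Finset.sum_empty, mul_zero]]
  have h2 := sum_range_sum_divisors
    (fun d e => 1 / (e : ℂ) ^ (j + 1) * (oddResidue N k d * (1 / (d : ℂ) ^ j))) L
  simp only [Finset.mul_sum]
  push_cast at h2 ⊢
  rw [← h2]
  refine Finset.sum_congr rfl fun l _ => ?_
  rw [Finset.sum_div]
  refine Finset.sum_congr rfl fun d hd => ?_
  have h3 : ((l : ℂ) + 1) = d * ((l + 1) / d : ℕ) := by
    rw [← Nat.cast_mul, Nat.mul_div_cancel' (Nat.dvd_of_mem_divisors hd)]; push_cast; rfl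
  have hd0 : (d : ℂ) ≠ 0 := by exact_mod_cast (Nat.pos_of_mem_divisors hd).ne'
  have he0 : (((l + 1) / d : ℕ) : ℂ) ≠ 0 := by
    intro h0
    rw [h0, mul_zero] at h3
    exact Nat.cast_add_one_ne_zero l h3
  rw [h3, mul_pow, pow_succ]
  field_simp

variable {m n N : ℕ}

theorem tendsto_sum_stokesR (hm : 0 < m) (hn : 0 < n) (hN : N = 1 + m + n) {j : ℕ} (hj : 1 ≤ j) :
    Tendsto (fun L : ℕ => ∑ l ∈ Finset.range L, stokesR m n ((l : ℤ) + 1) / ((l : ℂ) + 1) ^ j) atTop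
      (𝓝 ((∑' e : ℕ, 1 / ((e : ℂ) + 1) ^ (j + 1)) * weightSum m n fun k => residueSum N k j)) := by
  have h := ((tendsto_sum_oddResidue_divisors (k := 1) (N := N) one_pos (by omega) hj).add
    (tendsto_sum_oddResidue_divisors (N := N) hm (by omega) hj)).add
    (tendsto_sum_oddResidue_divisors (N := N) hn (by omega) hj)
  have e : (∑' e : ℕ, 1 / ((e : ℂ) + 1) ^ (j + 1)) * residueSum N 1 j +
      (∑' e : ℕ, 1 / ((e : ℂ) + 1) ^ (j + 1)) * residueSum N m j +
      (∑' e : ℕ, 1 / ((e : ℂ) + 1) ^ (j + 1)) * residueSum N n j =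
      (∑' e : ℕ, 1 / ((e : ℂ) + 1) ^ (j + 1)) * weightSum m n fun k => residueSum N k j := by
    rw [weightSum]; ring
  rw [e] at h
  refine h.congr fun L => ?_
  rw [← Finset.sum_add_distrib, ← Finset.sum_add_distrib]
  refine Finset.sum_congr rfl fun l _ => ?_
  rw [stokesR_succ, ← hN, weightSum, add_div, add_div]

end StrongWeak

namespace StrongWeak

/-! ### Dirichlet series of the Stokes constants -/

lemma summable_pairs_div {c : ℕ → ℕ → ℂ} {C : ℝ} (hc : ∀ d e, ‖c d e‖ ≤ C) {j : ℕ} (hj : 2 ≤ j) :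
    Summable fun p : ℕ × ℕ => c (p.1 + 1) (p.2 + 1) / (((p.1 + 1) * (p.2 + 1) : ℕ) : ℂ) ^ j := by
  have hg := summable_norm_one_div_pow hj
  have h1 := (hg.mul_of_nonneg hg (fun _ => norm_nonneg _) fun _ => norm_nonneg _).mul_left C
  refine Summable.of_norm_bounded h1 fun p => ?_
  rw [norm_div, div_eq_mul_inv, ← norm_mul, ← norm_inv]
  refine mul_le_mul (hc _ _) (le_of_eq ?_) (norm_nonneg _) ((norm_nonneg _).trans (hc 0 0))
  congr 1
  push_cast
  rw [mul_pow, mul_inv, one_div, one_div]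

lemma sum_divisors_div_pow (c : ℕ → ℕ → ℂ) (l j : ℕ) :
    ∑ d ∈ (l + 1).divisors, c d ((l + 1) / d) / ((d * ((l + 1) / d) : ℕ) : ℂ) ^ j =
      (∑ d ∈ (l + 1).divisors, c d ((l + 1) / d)) / ((l : ℂ) + 1) ^ j := by
  rw [Finset.sum_div]
  refine Finset.sum_congr rfl fun d hd => ?_
  rw [Nat.mul_div_cancel' (Nat.dvd_of_mem_divisors hd)]
  push_cast
  rfl

lemma hasSum_divisors_div_pow {c : ℕ → ℕ → ℂ} {C : ℝ} (hc : ∀ d e, ‖c d e‖ ≤ C) {j : ℕ}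
    (hj : 2 ≤ j) :
    HasSum (fun l : ℕ => (∑ d ∈ (l + 1).divisors, c d ((l + 1) / d)) / ((l : ℂ) + 1) ^ j)
      (∑' p : ℕ × ℕ, c (p.1 + 1) (p.2 + 1) / (((p.1 + 1) * (p.2 + 1) : ℕ) : ℂ) ^ j) := by
  have := hasSum_sum_divisors (F := fun d e => c d e / ((d * e : ℕ) : ℂ) ^ j)
    (summable_pairs_div hc hj).hasSum
  simpa only [sum_divisors_div_pow] using this

lemma norm_oddResidue_div_le (N k d e : ℕ) : ‖oddResidue N k d / e‖ ≤ 1 := by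
  rw [norm_div, Complex.norm_natCast]
  rcases Nat.eq_zero_or_pos e with rfl | he
  · simp
  · rw [div_le_one (by exact_mod_cast he)]
    exact (norm_oddResidue_le N k d).trans (by exact_mod_cast he)

lemma norm_rootPow_sub_div_le (N k d : ℕ) : ‖(rootPow N k ^ d - (rootPow N k)⁻¹ ^ d) / d‖ ≤ 2 := by
  have h : ‖rootPow N k ^ d - (rootPow N k)⁻¹ ^ d‖ ≤ 2 := by
    refine (norm_sub_le _ _).trans ?_
    rw [norm_pow, norm_pow, norm_inv, norm_rootPow]
    norm_num
  rw [norm_div, Complex.norm_natCast]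
  rcases Nat.eq_zero_or_pos d with rfl | hd
  · simp
  · exact (div_le_self (norm_nonneg _) (by exact_mod_cast hd)).trans h

lemma hasSum_zeta_even {i : ℕ} (hi : 1 ≤ i) :
    HasSum (fun e : ℕ => 1 / ((e : ℂ) + 1) ^ (2 * i))
      (-((2 * Real.pi * Complex.I) ^ (2 * i) / 2 * (bernoulli (2 * i) : ℚ) / (2 * i).factorial)) := by
  obtain ⟨r, rfl⟩ : ∃ r, i = r + 1 := ⟨i - 1, by omega⟩
  have h1 := (hasSum_nat_add_iff' 1).2 (hasSum_zeta_nat (k := r + 1) (by omega))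
  have h2 := Complex.hasSum_ofReal.2 h1
  convert! h2 using 1
  · funext e; push_cast; rfl
  · have hI : Complex.I ^ (2 * (r + 1)) = (-1) ^ (r + 1) := by rw [pow_mul, Complex.I_sq]
    simp only [Finset.range_one, Finset.sum_singleton]
    rw [show 2 * (r + 1) - 1 = 2 * r + 1 by omega]
    push_cast
    rw [mul_pow, mul_pow, hI]
    simp
    ring

lemma hasSum_rootPow_sub {N k : ℕ} (hkN : k < N) {i : ℕ} (hi : 1 ≤ i) :
    HasSum (fun d : ℕ => (rootPow N k ^ (d + 1) - (rootPow N k)⁻¹ ^ (d + 1)) / ((d : ℂ) + 1) /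
        ((d : ℂ) + 1) ^ (2 * i))
      (-(2 * Real.pi * Complex.I) ^ (2 * i + 1) / (2 * i + 1).factorial *
        (((Polynomial.bernoulli (2 * i + 1)).eval ((k : ℚ) / (N : ℚ)) : ℚ) : ℂ)) := by
  have hN : (0 : ℝ) < N := by exact_mod_cast (by omega : 0 < N)
  have hx : (k / N : ℝ) ∈ Set.Icc (0 : ℝ) 1 :=
    ⟨by positivity, by rw [div_le_one hN]; exact_mod_cast hkN.le⟩
  have h1 := (hasSum_nat_add_iff' 1).2 (hasSum_one_div_nat_pow_mul_sin (k := i) (by omega) hx)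
  have h2 := (Complex.hasSum_ofReal.2 h1).mul_left (2 * Complex.I)
  have hb := bernoulliFun_ratCast (2 * i + 1) k N
  rw [bernoulliFun] at hb
  rw [hb] at h2
  convert! h2 using 1
  · funext d
    rw [← two_I_mul_sin_eq]
    have e : 2 * Real.pi * ((d + 1 : ℕ) : ℝ) * (k / N) = 2 * Real.pi * k * ((d + 1 : ℕ) : ℝ) / N := by
      ring
    rw [e]
    push_cast
    rw [div_div, ← pow_succ']
    ring
  · simp only [Finset.range_one, Finset.sum_singleton]
    rw [mul_pow _ Complex.I, pow_succ Complex.I, pow_mul Complex.I, Complex.I_sq,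
      pow_succ (-1 : ℝ)]
    push_cast
    simp
    ring

lemma coeff_phiSeries {i : ℕ} (hi : 1 ≤ i) (k N : ℕ) :
    PowerSeries.coeff (2 * i) (phiSeries k N) = (2 * Real.pi * Complex.I) ^ (2 * i) *
      ((bernoulli (2 * i) : ℚ) : ℂ) *
      (((Polynomial.bernoulli (2 * i + 1)).eval ((k : ℚ) / (N : ℚ)) : ℚ) : ℂ)
        / (((2 * i : ℕ) : ℂ) * ((2 * i + 1).factorial : ℂ)) := by
  rw [phiSeries, PowerSeries.coeff_mk, if_pos ⟨even_two_mul i, by omega⟩]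

lemma coeff_psiSeries {i : ℕ} (hi : 1 ≤ i) (k N : ℕ) :
    PowerSeries.coeff (2 * i - 1) (psiSeries k N) = (2 * Real.pi * Complex.I) ^ (2 * i - 1) *
      ((bernoulli (2 * i) : ℚ) : ℂ) / ((2 * i).factorial : ℂ) *
      polylogNeg (2 * i - 2) (rootPow N k) := by
  rw [psiSeries, PowerSeries.coeff_mk, if_pos ⟨i - 1, by omega⟩, Nat.sub_add_cancel (by omega),
    Nat.sub_sub]

/-- The double series splits as ζ(2i), by Euler, times Σ (ζ_N^(kd) - ζ_N^(-kd)) / d^(2i+1), the sine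
series of B_(2i+1) at k/N. -/
lemma hasSum_rootPow_sub_divisors {N k : ℕ} (hkN : k < N) {i : ℕ} (hi : 1 ≤ i) :
    HasSum (fun l : ℕ => (∑ d ∈ (l + 1).divisors, (rootPow N k ^ d - (rootPow N k)⁻¹ ^ d) / d) /
        ((l : ℂ) + 1) ^ (2 * i))
      (Real.pi * Complex.I / (2 * i - 1).factorial * (2 * Real.pi * Complex.I) ^ (2 * i) *
        PowerSeries.coeff (2 * i) (phiSeries k N)) := by
  have hc : ∀ d e : ℕ, ‖(rootPow N k ^ d - (rootPow N k)⁻¹ ^ d) / d‖ ≤ 2 := fun d _ =>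
    norm_rootPow_sub_div_le N k d
  have h := hasSum_divisors_div_pow (c := fun d _ => (rootPow N k ^ d - (rootPow N k)⁻¹ ^ d) / d)
    hc (j := 2 * i) (by omega)
  have hs := summable_pairs_div (c := fun d _ => (rootPow N k ^ d - (rootPow N k)⁻¹ ^ d) / d)
    hc (j := 2 * i) (by omega)
  have h1 := hs.hasSum.prod_fiberwise fun d => by
    refine ((hasSum_zeta_even hi).mul_left ((rootPow N k ^ (d + 1) - (rootPow N k)⁻¹ ^ (d + 1)) /
      ((d : ℂ) + 1) / ((d : ℂ) + 1) ^ (2 * i))).congr_fun fun e => ?_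
    push_cast
    rw [mul_pow, div_mul_div_comm, mul_one]
  have h2 := h1.unique ((hasSum_rootPow_sub hkN hi).mul_right _)
  rw [h2] at h
  convert! h using 1
  rw [coeff_phiSeries hi, show (2 * i).factorial = 2 * i * (2 * i - 1).factorial by
    rw [Nat.mul_factorial_pred (by omega)], pow_succ]
  have h3 : ((2 * i - 1).factorial : ℂ) ≠ 0 := by exact_mod_cast Nat.factorial_ne_zero _
  have h4 : ((2 * i + 1).factorial : ℂ) ≠ 0 := by exact_mod_cast Nat.factorial_ne_zero _
  have h5 : (i : ℂ) ≠ 0 := by exact_mod_cast (by omega : i ≠ 0)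
  push_cast
  field_simp

/-- For odd exponent the difference of Hurwitz zeta values is a derivative of the cotangent, hence a
polylogarithm at ζ_N^k; ζ(2i) supplies the Bernoulli number. -/
lemma residueSum_odd {N k : ℕ} (hk : 0 < k) (hkN : k < N) {i : ℕ} (hi : 1 ≤ i) :
    (∑' e : ℕ, 1 / ((e : ℂ) + 1) ^ (2 * i - 1 + 1)) * residueSum N k (2 * i - 1) =
      Real.pi * Complex.I / (2 * i - 2).factorial * (2 * Real.pi * Complex.I / N) ^ (2 * i - 1) *
        (PowerSeries.coeff (2 * i - 1) (psiSeries k N) +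
          if i = 1 then Real.pi * Complex.I / 12 else 0) := by
  have hN : (0 : ℝ) < N := by exact_mod_cast (by omega : 0 < N)
  have hk' : (0 : ℝ) < k := by exact_mod_cast hk
  have hx1 : (k / N : ℝ) < 1 := by rw [div_lt_one hN]; exact_mod_cast hkN
  have hx0 : 0 < (k / N : ℝ) := by positivity
  have hNc : (N : ℂ) ≠ 0 := by exact_mod_cast hN.ne'
  have hpi : (Real.pi : ℂ) ≠ 0 := by exact_mod_cast Real.pi_ne_zero
  have hI := Complex.I_ne_zero
  obtain ⟨r, rfl⟩ : ∃ r, i = r + 1 := ⟨i - 1, by omega⟩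
  have e1 : 2 * (r + 1) - 1 = 2 * r + 1 := by omega
  have e2 : 2 * (r + 1) - 2 = 2 * r := by omega
  have hroot : rootPow N k = Complex.exp (2 * Real.pi * Complex.I * ((k / N : ℝ) : ℂ)) := by
    rw [rootPow]; congr 1; push_cast; ring
  have hres : residueSum N k (2 * r + 1) = 1 / (N : ℂ) ^ (2 * r + 1) *
      ((∑' n, cotSummand (2 * r) (k / N) n : ℝ) : ℂ) := by
    rw [residueSum]
    simp only [residueSummand_eq hk hkN]
    rw [tsum_mul_left, Complex.ofReal_tsum]
    congr 1
    refine tsum_congr fun n => ?_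
    rw [cotSummand, (odd_two_mul_add_one r).neg_one_pow]
    congr 1
    ring
  have hpoly := polylogNeg_exp (2 * r) hx0 hx1
  rw [← hroot] at hpoly
  have hcoeff := coeff_psiSeries hi k N
  have hz := (hasSum_zeta_even hi).tsum_eq
  rw [e1, e2] at hcoeff
  rw [e1, e2, show 2 * r + 1 + 1 = 2 * (r + 1) by ring, hz, hres, hcoeff, hpoly]
  have hpow : (Complex.I / (2 * Real.pi)) ^ (2 * r + 1) * (2 * Real.pi * Complex.I) ^ (2 * r + 1) =
      -1 := by
    rw [← mul_pow, show Complex.I / (2 * Real.pi) * (2 * Real.pi * Complex.I) = -1 by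
      field_simp; exact Complex.I_sq, (odd_two_mul_add_one r).neg_one_pow]
  have hf : ((2 * r).factorial : ℂ) ≠ 0 := by exact_mod_cast Nat.factorial_ne_zero _
  have hf2 : ((2 * (r + 1)).factorial : ℂ) ≠ 0 := by exact_mod_cast Nat.factorial_ne_zero _
  set w : ℂ := ((∑' n, cotSummand (2 * r) (k / N) n : ℝ) : ℂ)
  set X := (2 * Real.pi * Complex.I) ^ (2 * r + 1) with hX
  have hX0 : X ≠ 0 := pow_ne_zero _ (by simp [hpi])
  have hd : (2 * Real.pi * Complex.I / N) ^ (2 * r + 1) = X / (N : ℂ) ^ (2 * r + 1) := div_pow _ _ _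
  have hs : (2 * Real.pi * Complex.I) ^ (2 * (r + 1)) = X * (2 * Real.pi * Complex.I) := by
    rw [hX, ← pow_succ]; rfl
  have hI' : (Complex.I / (2 * Real.pi)) ^ (2 * r + 1) = -1 / X := by
    rw [eq_div_iff hX0]; exact hpow
  rw [hd, hs, hI']
  -- Only r = 0 sees the constant -1/2 in Li_0; times πi/6 it accounts for the πi/12.
  rcases Nat.eq_zero_or_pos r with rfl | hr
  · norm_num [bernoulli_two] at hX ⊢
    field_simp
    rw [hX]
    ring
  · rw [if_neg (by omega), if_neg (by omega)]
    field_simp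
    ring

/-! ### The Mittag-Leffler expansions of the Borel transforms -/

lemma hasSum_int_of_pos_of_neg {f : ℤ → ℂ} {a b : ℂ} (h0 : f 0 = 0)
    (ha : HasSum (fun l : ℕ => f ((l : ℤ) + 1)) a) (hb : HasSum (fun l : ℕ => f (-((l : ℤ) + 1))) b) :
    HasSum f (a + b) := by
  refine HasSum.of_nat_of_neg_add_one ?_ hb
  refine (hasSum_nat_add_iff' 1).1 ?_
  simpa [h0] using ha

/-- The halves l > 0 and l < 0 combine with the factor 1 + ε(-1)ⁿ. For ε = ±1 they double or cancel
according to the parity of n, which is why each series has powers of one parity only. -/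
theorem mittagLefflerData_of_symm {φ : PowerSeries ℂ} {κ : ℝ} {A : ℤ → ℂ} {ε : ℂ} (hκ : 0 < κ)
    (hε : ‖ε‖ = 1) (hA : ∀ l, A (-l) = ε * A l) (h0 : PowerSeries.coeff 0 φ = 0)
    (hval : ∀ n : ℕ, ∃ a : ℂ, HasSum (fun l : ℕ => A ((l : ℤ) + 1) / ((l : ℂ) + 1) ^ (n + 2)) a ∧
      (1 + ε * (-1) ^ n) * a / (κ * Complex.I) ^ (n + 2) =
        2 * Real.pi * Complex.I * PowerSeries.coeff (n + 2) φ / ((n + 1).factorial : ℂ)) :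
    MittagLefflerData φ κ A where
  pos := hκ
  coeff_zero := h0
  -- The case n = 0 of the hypothesis is convergence of Σ A_l / l², which for complex series is
  -- absolute.
  summable := by
    obtain ⟨a, ha, -⟩ := hval 0
    have h1 : Summable fun l : ℕ => ‖A ((l : ℤ) + 1)‖ / ((l : ℝ) + 1) ^ 2 :=
      ha.summable.norm.congr fun l => by rw [norm_div, norm_pow, norm_natCast_add_one]
    refine Summable.of_nat_of_neg_add_one ?_ ?_
    · refine (summable_nat_add_iff 1).1 (h1.congr fun l => ?_)
      push_cast
      rfl
    · refine h1.congr fun l => ?_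
      rw [hA, norm_mul, hε, one_mul]
      push_cast
      ring
  hasSum_coeff := fun n => by
    obtain ⟨a, ha, hv⟩ := hval n
    have h1 := ha.div_const ((κ * Complex.I) ^ (n + 2))
    have h2 := h1.mul_left (ε * (-1) ^ n)
    rw [← hv]
    have e : (1 + ε * (-1) ^ n) * a / (κ * Complex.I) ^ (n + 2) =
        a / (κ * Complex.I) ^ (n + 2) + ε * (-1) ^ n * (a / (κ * Complex.I) ^ (n + 2)) := by ring
    rw [e]
    refine hasSum_int_of_pos_of_neg (by simp) ?_ ?_
    · refine h1.congr_fun fun l => ?_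
      push_cast
      rw [show (κ : ℂ) * ((l : ℂ) + 1) * Complex.I = (l + 1) * (κ * Complex.I) by ring, mul_pow,
        div_div]
    · refine h2.congr_fun fun l => ?_
      rw [hA]
      push_cast
      rw [show (κ : ℂ) * -((l : ℂ) + 1) * Complex.I = (-1) * ((l + 1) * (κ * Complex.I)) by ring,
        mul_pow, mul_pow, pow_add (-1 : ℂ), neg_one_sq, mul_one]
      have h3 : ((-1 : ℂ) ^ n) * (-1) ^ n = 1 := by rw [← mul_pow]; norm_num
      have h4 : ((-1 : ℂ) ^ n) ≠ 0 := pow_ne_zero _ (by norm_num)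
      have h5 : (((-1 : ℂ)) ^ n)⁻¹ = (-1) ^ n := by rw [inv_eq_iff_eq_inv, eq_comm, inv_eq_of_mul_eq_one_left h3]
      rw [div_eq_mul_inv, mul_inv, h5, div_div, div_eq_mul_inv]
      ring

/-- A linear term only shifts the constant of the Borel transform, so πiτ/6 leaves poles and
discontinuity untouched. -/
lemma MittagLefflerData.const_mul_add_linear {φ : PowerSeries ℂ} {κ : ℝ} {A : ℤ → ℂ}
    (h : MittagLefflerData φ κ A) (c z : ℂ) :
    MittagLefflerData (PowerSeries.C c * φ + PowerSeries.C z * PowerSeries.X) κ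
      fun l => c * A l where
  pos := h.pos
  coeff_zero := by
    rw [map_add, PowerSeries.coeff_C_mul, PowerSeries.coeff_C_mul, h.coeff_zero,
      PowerSeries.coeff_zero_X]
    simp
  summable := (h.summable.mul_left ‖c‖).congr fun l => by rw [norm_mul]; ring
  hasSum_coeff := fun n => by
    have h1 := (h.hasSum_coeff n).mul_left c
    convert! h1 using 1
    · funext l; ring
    · rw [map_add, PowerSeries.coeff_C_mul, PowerSeries.coeff_C_mul, PowerSeries.coeff_X,
        if_neg (by omega)]
      ring

end StrongWeak

namespace StrongWeak

/-! ### Resurgence of the perturbative series -/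

variable {m n N : ℕ}

lemma coeff_phiTrace (hm : 0 < m) (hn : 0 < n) (hN : N = 1 + m + n) (i : ℕ) :
    PowerSeries.coeff i (phiTrace m n) = ((N : ℂ) / (2 * Real.pi)) ^ i *
      weightSum m n fun k => PowerSeries.coeff i (phiSeries k N) := by
  subst hN
  rw [phiTrace, PowerSeries.coeff_rescale, phiSeries_sub (by omega) (by omega),
    phiSeries_sub (by omega) (by omega), neg_neg, sub_neg_eq_add, map_add, map_add, weightSum]

/-- Two of the three series are reflected, each costing πi/6 in the linear coefficient. -/
lemma coeff_psiTrace (hm : 0 < m) (hn : 0 < n) (hN : N = 1 + m + n) (i : ℕ) :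
    PowerSeries.coeff i (psiTrace m n) =
      (weightSum m n fun k => PowerSeries.coeff i (psiSeries k N)) +
        if i = 1 then Real.pi * Complex.I / 3 else 0 := by
  subst hN
  rw [psiTrace, psiSeries_sub one_pos (by omega), psiSeries_sub hm (by omega)]
  simp only [map_add, map_sub, map_neg, PowerSeries.coeff_C_mul, PowerSeries.coeff_X, weightSum]
  split_ifs <;> ring

lemma coeff_phiTrace_odd (hm : 0 < m) (hn : 0 < n) {i : ℕ} (hi : Odd i) :
    PowerSeries.coeff i (phiTrace m n) = 0 := by
  rw [coeff_phiTrace hm hn rfl]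
  simp [weightSum, phiSeries, Nat.not_even_iff_odd.2 hi]

lemma coeff_psiTrace_even (hm : 0 < m) (hn : 0 < n) {i : ℕ} (hi : Even i) :
    PowerSeries.coeff i (psiTrace m n) = 0 := by
  rw [coeff_psiTrace hm hn rfl, if_neg (by rintro rfl; exact absurd hi (by decide))]
  simp [weightSum, psiSeries, Nat.not_odd_iff_even.2 hi]

lemma stokesS_neg (m n : ℕ) (l : ℤ) : stokesS m n (-l) = stokesS m n l := by
  simp only [stokesS, Int.natAbs_neg]

lemma stokesR_neg (m n : ℕ) (l : ℤ) : stokesR m n (-l) = -stokesR m n l := by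
  simp only [stokesR_eq, Int.natAbs_neg, weightSum]
  push_cast
  simp only [div_neg, mul_neg, Finset.sum_neg_distrib]
  ring

lemma stokesS_div_pow (m n l j : ℕ) :
    stokesS m n ((l : ℤ) + 1) / ((l : ℂ) + 1) ^ j = weightSum m n fun k =>
      (∑ d ∈ (l + 1).divisors, (rootPow (1 + m + n) k ^ d - (rootPow (1 + m + n) k)⁻¹ ^ d) / d) /
        ((l : ℂ) + 1) ^ j := by
  have e1 : ((l : ℤ) + 1).natAbs = l + 1 := by omega
  rw [stokesS_eq, e1, weightSum, weightSum, add_div, add_div]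

lemma stokesR_div_pow (m n l j : ℕ) :
    stokesR m n ((l : ℤ) + 1) / ((l : ℂ) + 1) ^ j = weightSum m n fun k =>
      (∑ d ∈ (l + 1).divisors, oddResidue (1 + m + n) k d / ((l + 1) / d : ℕ)) /
        ((l : ℂ) + 1) ^ j := by
  rw [stokesR_succ, weightSum, weightSum, add_div, add_div]

lemma summable_stokesS_div_pow (m n : ℕ) {j : ℕ} (hj : 2 ≤ j) :
    Summable fun l : ℕ => stokesS m n ((l : ℤ) + 1) / ((l : ℂ) + 1) ^ j := by
  simp only [stokesS_div_pow]
  exact (hasSum_weightSum fun k _ => hasSum_divisors_div_pow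
    (c := fun d _ => (rootPow (1 + m + n) k ^ d - (rootPow (1 + m + n) k)⁻¹ ^ d) / d)
    (fun d _ => norm_rootPow_sub_div_le _ k d) hj).summable

lemma summable_stokesR_div_pow (m n : ℕ) {j : ℕ} (hj : 2 ≤ j) :
    Summable fun l : ℕ => stokesR m n ((l : ℤ) + 1) / ((l : ℂ) + 1) ^ j := by
  simp only [stokesR_div_pow]
  exact (hasSum_weightSum fun k _ => hasSum_divisors_div_pow
    (c := fun d e => oddResidue (1 + m + n) k d / e)
    (fun d e => norm_oddResidue_div_le _ k d e) hj).summable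

theorem hasSum_stokesS_div_pow (hm : 0 < m) (hn : 0 < n) (hN : N = 1 + m + n) {i : ℕ}
    (hi : 1 ≤ i) :
    HasSum (fun l : ℕ => stokesS m n ((l : ℤ) + 1) / ((l : ℂ) + 1) ^ (2 * i))
      (Real.pi * Complex.I / (2 * i - 1).factorial *
        (4 * Real.pi ^ 2 * Complex.I / N) ^ (2 * i) *
        PowerSeries.coeff (2 * i) (phiTrace m n)) := by
  have h := hasSum_weightSum (m := m) (n := n) fun k hk =>
    hasSum_rootPow_sub_divisors (k := k) (N := N) (by omega) hi
  have hNc : (N : ℂ) ≠ 0 := by exact_mod_cast (by omega : N ≠ 0)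
  have hpi : (Real.pi : ℂ) ≠ 0 := by exact_mod_cast Real.pi_ne_zero
  simp only [stokesS_div_pow, ← hN]
  convert! h using 1
  rw [coeff_phiTrace hm hn hN, show (4 * Real.pi ^ 2 * Complex.I / N : ℂ) =
    2 * Real.pi * Complex.I / (N / (2 * Real.pi)) by field_simp; ring, div_pow]
  simp only [weightSum]
  have : ((N : ℂ) / (2 * Real.pi)) ^ (2 * i) ≠ 0 := pow_ne_zero _ (by simp [hNc, hpi])
  generalize ((N : ℂ) / (2 * Real.pi)) ^ (2 * i) = w at this
  field_simp

/-- For i = 1 the three values of k give 3 · πi/12 and the reflections -πi/3, in total the -πi/12 of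
the statement. -/
theorem tendsto_sum_stokesR_div_pow (hm : 0 < m) (hn : 0 < n) (hN : N = 1 + m + n) {i : ℕ}
    (hi : 1 ≤ i) :
    Tendsto (fun L : ℕ => ∑ l ∈ Finset.range L,
        stokesR m n ((l : ℤ) + 1) / ((l : ℂ) + 1) ^ (2 * i - 1)) atTop
      (𝓝 (Real.pi * Complex.I / (2 * i - 2).factorial *
        (2 * Real.pi * Complex.I / N) ^ (2 * i - 1) *
        (PowerSeries.coeff (2 * i - 1) (psiTrace m n) -
          if i = 1 then Real.pi * Complex.I / 12 else 0))) := by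
  have h := tendsto_sum_stokesR hm hn hN (j := 2 * i - 1) (by omega)
  convert! h using 2
  rw [weightSum, mul_add, mul_add, residueSum_odd one_pos (by omega) hi,
    residueSum_odd hm (by omega) hi, residueSum_odd hn (by omega) hi, coeff_psiTrace hm hn hN,
    weightSum]
  split_ifs <;> first | omega | ring

theorem mittagLefflerData_phiTrace (hm : 0 < m) (hn : 0 < n) (hN : N = 1 + m + n) :
    MittagLefflerData (phiTrace m n) (4 * Real.pi ^ 2 / N) (stokesS m n) := by
  have hN0 : (0 : ℝ) < N := by exact_mod_cast (by omega : 0 < N)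
  have hNc : (N : ℂ) ≠ 0 := by exact_mod_cast hN0.ne'
  have hpi : (Real.pi : ℂ) ≠ 0 := by exact_mod_cast Real.pi_ne_zero
  refine mittagLefflerData_of_symm (ε := 1) (by positivity) norm_one (fun l => by
    rw [stokesS_neg, one_mul]) ?_ fun r => ?_
  · rw [coeff_phiTrace hm hn hN]; simp [weightSum, phiSeries]
  · rcases Nat.even_or_odd r with hr | hr
    · obtain ⟨i, hi⟩ : ∃ i, r + 2 = 2 * i := by
        obtain ⟨s, rfl⟩ := hr; exact ⟨s + 1, by omega⟩
      refine ⟨_, by rw [hi]; exact hasSum_stokesS_div_pow hm hn hN (by omega), ?_⟩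
      rw [hr.neg_one_pow, hi, show r + 1 = 2 * i - 1 by omega]
      push_cast
      rw [show (4 * Real.pi ^ 2 / N * Complex.I : ℂ) = 4 * Real.pi ^ 2 * Complex.I / N by ring]
      have h0 : (4 * Real.pi ^ 2 * Complex.I / N : ℂ) ^ (2 * i) ≠ 0 :=
        pow_ne_zero _ (by simp [hNc, hpi])
      generalize (4 * Real.pi ^ 2 * Complex.I / N : ℂ) ^ (2 * i) = w at h0
      field_simp
      ring
    -- For odd r the value of the half-sum is immaterial: its prefactor 1 + (-1)^r and the
    -- coefficient both vanish.
    · refine ⟨_, (summable_stokesS_div_pow m n (by omega)).hasSum, ?_⟩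
      rw [hr.neg_one_pow, coeff_phiTrace_odd hm hn (by rw [Nat.odd_add]; simp [hr])]
      simp

theorem mittagLefflerData_psiTrace (hm : 0 < m) (hn : 0 < n) (hN : N = 1 + m + n) :
    MittagLefflerData (psiTrace m n) (2 * Real.pi / N) (stokesR m n) := by
  have hN0 : (0 : ℝ) < N := by exact_mod_cast (by omega : 0 < N)
  have hNc : (N : ℂ) ≠ 0 := by exact_mod_cast hN0.ne'
  have hpi : (Real.pi : ℂ) ≠ 0 := by exact_mod_cast Real.pi_ne_zero
  refine mittagLefflerData_of_symm (ε := -1) (by positivity) (by simp) (fun l => by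
    rw [stokesR_neg, neg_one_mul]) (coeff_psiTrace_even hm hn (by simp)) fun r => ?_
  refine ⟨_, (summable_stokesR_div_pow m n (by omega)).hasSum, ?_⟩
  rcases Nat.even_or_odd r with hr | hr
  · rw [hr.neg_one_pow, coeff_psiTrace_even hm hn (hr.add even_two)]
    simp
  · obtain ⟨i, hi⟩ : ∃ i, r + 2 = 2 * i - 1 := by
      obtain ⟨s, rfl⟩ := hr; exact ⟨s + 2, by omega⟩
    -- From exponent 2 on the series converges absolutely, so its value is the natural-order limit.
    -- As r + 2 ≥ 3 forces i ≥ 2, the exceptional correction never enters the Mittag-Leffler data.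
    have h1 := (summable_stokesR_div_pow m n (j := r + 2) (by omega)).hasSum.tendsto_sum_nat
    have h2 := tendsto_sum_stokesR_div_pow hm hn hN (i := i) (by omega)
    rw [← hi] at h2
    rw [tendsto_nhds_unique h1 h2, hr.neg_one_pow, if_neg (by omega), sub_zero,
      show r + 1 = 2 * i - 2 by omega]
    push_cast
    rw [show (2 * Real.pi / N * Complex.I : ℂ) = 2 * Real.pi * Complex.I / N by ring]
    have h0 : (2 * Real.pi * Complex.I / N : ℂ) ^ (r + 2) ≠ 0 := pow_ne_zero _ (by simp [hNc, hpi])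
    generalize (2 * Real.pi * Complex.I / N : ℂ) ^ (r + 2) = w at h0
    field_simp
    ring

end StrongWeak

namespace StrongWeak

/-! ### Mellin transforms -/

lemma integrableOn_pow_mul_exp_neg {j : ℕ} (hj : 1 ≤ j) {r : ℝ} (hr : 0 < r) :
    IntegrableOn (fun t : ℝ => t ^ (j - 1) * Real.exp (-(r * t))) (Set.Ioi 0) ∧
      ∫ t in Set.Ioi (0 : ℝ), t ^ (j - 1) * Real.exp (-(r * t)) = Real.Gamma j * (1 / r ^ j) := by
  have hj0 : (0 : ℝ) < j := by exact_mod_cast hj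
  have key := Real.integral_rpow_mul_exp_neg_mul_Ioi hj0 hr
  have e : ∀ t : ℝ, t ^ ((j : ℝ) - 1) = t ^ (j - 1) := fun t => by
    rw [← Real.rpow_natCast t (j - 1), Nat.cast_sub hj, Nat.cast_one]
  simp only [e, Real.rpow_natCast, one_div, inv_pow] at key
  have hG := Real.Gamma_pos_of_pos hj0
  -- A non-integrable function has integral 0 by convention, so the positive value of the integral
  -- already proves integrability.
  refine ⟨Integrable.of_integral_ne_zero (by rw [key]; positivity), ?_⟩
  rw [key, one_div, mul_comm]

lemma exp_two_pi_I_mul_I (a : ℕ) (t : ℝ) :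
    Complex.exp (2 * Real.pi * Complex.I * (Complex.I * t)) ^ a =
      (Real.exp (-(2 * Real.pi * a * t)) : ℂ) := by
  rw [← Complex.exp_nat_mul, Complex.ofReal_exp]
  congr 1
  push_cast
  linear_combination (2 * Real.pi * a * t : ℂ) * Complex.I_sq

lemma integral_pow_mul_exp {j : ℕ} (hj : 1 ≤ j) {a : ℕ} (ha : 0 < a) :
    IntegrableOn (fun t : ℝ => t ^ (j - 1) * Real.exp (-(2 * Real.pi * a * t))) (Set.Ioi 0) ∧
      ∫ t in Set.Ioi (0 : ℝ), t ^ (j - 1) * Real.exp (-(2 * Real.pi * a * t)) =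
        Real.Gamma j / (2 * Real.pi) ^ j * (1 / (a : ℝ) ^ j) := by
  have ha' : (0 : ℝ) < a := by exact_mod_cast ha
  obtain ⟨h1, h2⟩ := integrableOn_pow_mul_exp_neg hj (r := 2 * Real.pi * a) (by positivity)
  refine ⟨h1, ?_⟩
  rw [h2, mul_pow]
  field_simp

lemma im_I_mul_pos {t : ℝ} (ht : 0 < t) : 0 < (Complex.I * t).im := by simpa using ht

variable {m n N : ℕ}

theorem mellin_fZero (hm : 0 < m) (hn : 0 < n) {j : ℕ} (hj : 2 ≤ j) :
    IntegrableOn (fun t : ℝ => (t : ℂ) ^ (j - 1) * fZero m n (Complex.I * t)) (Set.Ioi 0) ∧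
      HasSum (fun l : ℕ => stokesS m n ((l : ℤ) + 1) / ((l : ℂ) + 1) ^ j)
        ((2 * Real.pi) ^ j / Complex.Gamma j *
          ∫ t in Set.Ioi (0 : ℝ), (t : ℂ) ^ (j - 1) * fZero m n (Complex.I * t)) := by
  set F : ℕ → ℝ → ℂ := fun l t => stokesS m n ((l : ℤ) + 1) *
    ((t ^ (j - 1) * Real.exp (-(2 * Real.pi * (l + 1 : ℕ) * t)) : ℝ) : ℂ) with hF
  have hbase := fun l : ℕ => integral_pow_mul_exp (j := j) (by omega) (Nat.succ_pos l)
  have hG : (Complex.Gamma j : ℂ) ≠ 0 := by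
    rw [← Complex.ofReal_natCast, Complex.Gamma_ofReal]
    exact_mod_cast (Real.Gamma_pos_of_pos (by exact_mod_cast (by omega : 0 < j))).ne'
  have hpi : (Real.pi : ℂ) ≠ 0 := by exact_mod_cast Real.pi_ne_zero
  have hint : ∀ l, Integrable (F l) (volume.restrict (Set.Ioi 0)) := fun l =>
    ((hbase l).1.ofReal).const_mul _
  have hval : ∀ l, ∫ t in Set.Ioi (0 : ℝ), F l t =
      Complex.Gamma j / (2 * Real.pi) ^ j * (stokesS m n ((l : ℤ) + 1) / ((l : ℂ) + 1) ^ j) := by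
    intro l
    simp only [hF]
    rw [integral_const_mul, integral_complex_ofReal, (hbase l).2, Complex.ofReal_mul,
      Complex.ofReal_div, ← Complex.Gamma_ofReal]
    push_cast
    ring
  have hnorm : ∀ l, ∫ t in Set.Ioi (0 : ℝ), ‖F l t‖ =
      Real.Gamma j / (2 * Real.pi) ^ j * ‖stokesS m n ((l : ℤ) + 1) / ((l : ℂ) + 1) ^ j‖ := by
    intro l
    have : ∫ t in Set.Ioi (0 : ℝ), ‖F l t‖ = ∫ t in Set.Ioi (0 : ℝ), ‖stokesS m n ((l : ℤ) + 1)‖ *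
        (t ^ (j - 1) * Real.exp (-(2 * Real.pi * (l + 1 : ℕ) * t))) := by
      refine setIntegral_congr_fun measurableSet_Ioi fun t ht => ?_
      have ht' : (0 : ℝ) < t := ht
      simp only [hF]
      rw [norm_mul, Complex.norm_real, Real.norm_of_nonneg (by positivity)]
    rw [this, integral_const_mul, (hbase l).2, norm_div, norm_pow, norm_natCast_add_one]
    push_cast
    ring
  have hs : Summable fun l => ∫ t in Set.Ioi (0 : ℝ), ‖F l t‖ := by
    simp only [hnorm]
    exact (summable_stokesS_div_pow m n hj).norm.mul_left _
  obtain ⟨h1, h2⟩ := integrable_of_hasSum (f := fun t : ℝ =>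
    (t : ℂ) ^ (j - 1) * fZero m n (Complex.I * t)) hint hs (by
      refine (ae_restrict_mem measurableSet_Ioi).mono fun t ht => ?_
      have h := hasSum_stokesS hm hn rfl (im_I_mul_pos ht)
      rw [← fZero_eq hm hn rfl (im_I_mul_pos ht)] at h
      refine (h.mul_left ((t : ℂ) ^ (j - 1))).congr_fun fun l => ?_
      simp only [hF]
      rw [Complex.ofReal_mul, ← exp_two_pi_I_mul_I, ← Complex.exp_nat_mul]
      push_cast
      rw [show 2 * Real.pi * Complex.I * ((l : ℂ) + 1) * (Complex.I * t) =
        ((l : ℂ) + 1) * (2 * Real.pi * Complex.I * (Complex.I * t)) by ring]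
      ring)
  refine ⟨h1, ?_⟩
  refine (h2.mul_left ((2 * Real.pi) ^ j / Complex.Gamma j)).congr_fun fun l => ?_
  rw [hval]
  field_simp

lemma hasSum_gPoch_pairs {k N : ℕ} (hk : 0 < k) (hN : 0 < N) {y : ℂ} (hy : 0 < y.im) :
    HasSum (fun p : ℕ × ℕ => 1 / ((p.2 : ℂ) + 1) *
      Complex.exp (2 * Real.pi * Complex.I * y) ^ ((k + p.1 * N) * (p.2 + 1))) (-gPoch k N y) := by
  set q := Complex.exp (2 * Real.pi * Complex.I * y) with hq
  have hq1 : ‖q‖ < 1 := norm_exp_two_pi_I_mul_lt_one hy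
  have hs : Summable fun p : ℕ × ℕ => 1 / ((p.2 : ℂ) + 1) * q ^ ((k + p.1 * N) * (p.2 + 1)) := by
    refine Summable.of_norm_bounded (summable_lambert (c := fun _ _ => 1) (C := 1) (by simp)
      hq1).norm fun p => ?_
    rw [norm_mul, one_mul, norm_pow, norm_pow, norm_div, norm_one, norm_natCast_add_one]
    have h1 : 1 / ((p.2 : ℝ) + 1) ≤ 1 := by
      rw [div_le_one (by positivity)]
      linarith [(Nat.cast_nonneg p.2 : (0 : ℝ) ≤ p.2)]
    have h2 : p.1 + 1 ≤ k + p.1 * N := by nlinarith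
    calc _ ≤ 1 * ‖q‖ ^ ((k + p.1 * N) * (p.2 + 1)) := by gcongr
      _ ≤ 1 * ‖q‖ ^ ((p.1 + 1) * (p.2 + 1)) := by
        gcongr 1 * ?_
        exact pow_le_pow_of_le_one (norm_nonneg q) hq1.le (Nat.mul_le_mul_right _ h2)
      _ = _ := one_mul _
  have h1 := hs.hasSum.prod_fiberwise (g := fun i => -Complex.log (1 - q ^ (k + i * N))) fun i => by
    refine (Complex.hasSum_taylorSeries_neg_log'
      (norm_pow_lt_one hq1 (n := k + i * N) (by omega))).congr_fun fun e => ?_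
    dsimp only
    rw [pow_mul, one_div_mul_eq_div]
  have h2 := (summable_gPoch k hN hy).hasSum.neg
  rw [gPoch, ← h1.unique h2]
  exact hs.hasSum

lemma integral_norm_eq_of_nonneg_or_nonpos {f : ℝ → ℝ} {s : Set ℝ} (hs : MeasurableSet s)
    (h : (∀ t ∈ s, 0 ≤ f t) ∨ ∀ t ∈ s, f t ≤ 0) : ∫ t in s, ‖f t‖ = |∫ t in s, f t| := by
  rcases h with h | h
  · rw [abs_of_nonneg (setIntegral_nonneg hs h)]
    exact setIntegral_congr_fun hs fun t ht => Real.norm_of_nonneg (h t ht)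
  · rw [abs_of_nonpos (setIntegral_nonpos hs h), ← integral_neg]
    exact setIntegral_congr_fun hs fun t ht => Real.norm_of_nonpos (h t ht)

lemma summable_residueSum_pairs_norm {k N : ℕ} (hk : 0 < k) (hkN : k < N) {j : ℕ} (hj : 1 ≤ j) :
    Summable fun p : ℕ × ℕ =>
      ‖1 / ((k + p.1 * N : ℕ) : ℂ) ^ j - 1 / ((N - k + p.1 * N : ℕ) : ℂ) ^ j‖ *
        ‖1 / ((p.2 : ℂ) + 1) ^ (j + 1)‖ :=
  (summable_residueSum hk hkN j).norm.mul_of_nonneg (summable_norm_one_div_pow (by omega))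
    (fun _ => norm_nonneg _) fun _ => norm_nonneg _

lemma hasSum_prod_mul {f g : ℕ → ℂ} {a b : ℂ} (hf : HasSum f a) (hg : HasSum g b) :
    HasSum (fun p : ℕ × ℕ => f p.1 * g p.2) (a * b) :=
  hf.mul hg (summable_mul_of_summable_norm hf.summable.norm hg.summable.norm)

lemma hasSum_residueSum_pairs {k N : ℕ} (hk : 0 < k) (hkN : k < N) {j : ℕ} (hj : 1 ≤ j) :
    HasSum (fun p : ℕ × ℕ =>
      (1 / ((k + p.1 * N : ℕ) : ℂ) ^ j - 1 / ((N - k + p.1 * N : ℕ) : ℂ) ^ j) *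
        (1 / ((p.2 : ℂ) + 1) ^ (j + 1)))
      ((∑' e : ℕ, 1 / ((e : ℂ) + 1) ^ (j + 1)) * residueSum N k j) := by
  have hz := summable_norm_one_div_pow (s := j + 1) (by omega)
  have hr : HasSum (fun n : ℕ => 1 / ((k + n * N : ℕ) : ℂ) ^ j -
    1 / ((N - k + n * N : ℕ) : ℂ) ^ j) (residueSum N k j) := (summable_residueSum hk hkN j).hasSum
  have h := hasSum_prod_mul hr hz.of_norm.hasSum
  rw [mul_comm]
  exact h

/-- At j = 1 the two g cannot be integrated termwise in L¹ separately. After pairing k + iN with N -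
k + iN each term is a difference of two exponentials of constant sign, so its L¹ norm is the
absolute value of its integral, and these are summable. -/
theorem mellin_gPoch_sub {k N : ℕ} (hk : 0 < k) (hkN : k < N) {j : ℕ} (hj : 1 ≤ j) :
    IntegrableOn (fun t : ℝ => (t : ℂ) ^ (j - 1) *
        (gPoch (N - k) N (Complex.I * t) - gPoch k N (Complex.I * t))) (Set.Ioi 0) ∧
      ∫ t in Set.Ioi (0 : ℝ), (t : ℂ) ^ (j - 1) *
        (gPoch (N - k) N (Complex.I * t) - gPoch k N (Complex.I * t)) =
      Complex.Gamma j / (2 * Real.pi) ^ j *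
        ((∑' e : ℕ, 1 / ((e : ℂ) + 1) ^ (j + 1)) * residueSum N k j) := by
  set E : ℕ → ℝ → ℝ := fun a t => t ^ (j - 1) * Real.exp (-(2 * Real.pi * a * t)) with hE
  set f : ℕ × ℕ → ℝ → ℝ := fun p t => 1 / ((p.2 : ℝ) + 1) *
    (E ((k + p.1 * N) * (p.2 + 1)) t - E ((N - k + p.1 * N) * (p.2 + 1)) t) with hf
  have hE1 := fun a (ha : 0 < a) => integral_pow_mul_exp hj (a := a) ha
  have ha : ∀ p : ℕ × ℕ, 0 < (k + p.1 * N) * (p.2 + 1) := fun p => by positivity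
  have hb : ∀ p : ℕ × ℕ, 0 < (N - k + p.1 * N) * (p.2 + 1) := fun p =>
    Nat.mul_pos (by omega) (by omega)
  have hint : ∀ p, IntegrableOn (f p) (Set.Ioi 0) := fun p =>
    ((hE1 _ (ha p)).1.sub (hE1 _ (hb p)).1).const_mul _
  have hval : ∀ p, ((∫ t in Set.Ioi (0 : ℝ), f p t : ℝ) : ℂ) = Complex.Gamma j / (2 * Real.pi) ^ j *
      ((1 / ((k + p.1 * N : ℕ) : ℂ) ^ j - 1 / ((N - k + p.1 * N : ℕ) : ℂ) ^ j) *
        (1 / ((p.2 : ℂ) + 1) ^ (j + 1))) := by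
    intro p
    simp only [hf]
    rw [integral_const_mul, integral_sub (hE1 _ (ha p)).1 (hE1 _ (hb p)).1, (hE1 _ (ha p)).2,
      (hE1 _ (hb p)).2]
    have halg : ∀ a b w G : ℝ, 1 / w * (G * (1 / (a * w) ^ j) - G * (1 / (b * w) ^ j)) =
        G * ((1 / a ^ j - 1 / b ^ j) * (1 / w ^ (j + 1))) := by
      intro a b w G
      rw [mul_pow, mul_pow, pow_succ w]
      simp only [one_div, mul_inv]
      ring
    rw [Nat.cast_mul (k + p.1 * N), Nat.cast_mul (N - k + p.1 * N), Nat.cast_succ p.2, halg,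
      ← Complex.ofReal_natCast j, Complex.Gamma_ofReal]
    push_cast
    rfl
  have hsign : ∀ p, (∀ t ∈ Set.Ioi (0 : ℝ), 0 ≤ f p t) ∨ ∀ t ∈ Set.Ioi (0 : ℝ), f p t ≤ 0 := by
    intro p
    have hmono : ∀ a b : ℕ, a ≤ b → ∀ t ∈ Set.Ioi (0 : ℝ), E b t ≤ E a t := by
      intro a b hab t ht
      have ht' : (0 : ℝ) < t := ht
      simp only [hE]
      gcongr
    rcases le_total k (N - k) with h | h
    · left
      intro t ht
      exact mul_nonneg (by positivity) (sub_nonneg.2 (hmono _ _ (by gcongr) t ht))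
    · right
      intro t ht
      exact mul_nonpos_of_nonneg_of_nonpos (by positivity)
        (sub_nonpos.2 (hmono _ _ (by gcongr) t ht))
  have hnorm : ∀ p, ∫ t in Set.Ioi (0 : ℝ), ‖(f p t : ℂ)‖ =
      ‖Complex.Gamma j / (2 * Real.pi) ^ j‖ *
      (‖1 / ((k + p.1 * N : ℕ) : ℂ) ^ j - 1 / ((N - k + p.1 * N : ℕ) : ℂ) ^ j‖ *
        ‖1 / ((p.2 : ℂ) + 1) ^ (j + 1)‖) := by
    intro p
    simp only [Complex.norm_real]
    rw [integral_norm_eq_of_nonneg_or_nonpos measurableSet_Ioi (hsign p), ← Real.norm_eq_abs,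
      ← Complex.norm_real, hval, norm_mul, norm_mul]
  have hs : Summable fun p => ∫ t in Set.Ioi (0 : ℝ), ‖(f p t : ℂ)‖ := by
    simp only [hnorm]
    exact (summable_residueSum_pairs_norm hk hkN hj).mul_left _
  have hintC : ∀ p, Integrable (fun t => (f p t : ℂ)) (volume.restrict (Set.Ioi 0)) := fun p =>
    (hint p).ofReal
  obtain ⟨h1, h2⟩ := integrable_of_hasSum (f := fun t : ℝ => (t : ℂ) ^ (j - 1) *
      (gPoch (N - k) N (Complex.I * t) - gPoch k N (Complex.I * t)))
    hintC hs (by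
      refine (ae_restrict_mem measurableSet_Ioi).mono fun t ht => ?_
      have h := (hasSum_gPoch_pairs (N := N) hk (by omega) (im_I_mul_pos ht)).sub
        (hasSum_gPoch_pairs (k := N - k) (N := N) (by omega) (by omega) (im_I_mul_pos ht))
      have h' := h.mul_left ((t : ℂ) ^ (j - 1))
      rw [show -gPoch k N (Complex.I * t) - -gPoch (N - k) N (Complex.I * t) =
        gPoch (N - k) N (Complex.I * t) - gPoch k N (Complex.I * t) by ring] at h'
      refine h'.congr_fun fun p => ?_
      simp only [hf, hE, exp_two_pi_I_mul_I, Complex.ofReal_mul, Complex.ofReal_sub,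
        Complex.ofReal_div, Complex.ofReal_pow, Complex.ofReal_add, Complex.ofReal_one,
        Complex.ofReal_natCast]
      ring)
  refine ⟨h1, h2.unique ?_⟩
  refine ((hasSum_residueSum_pairs hk hkN hj).mul_left
    (Complex.Gamma j / (2 * Real.pi) ^ j)).congr_fun fun p => ?_
  rw [← hval]
  exact integral_complex_ofReal

theorem mellin_fInf (hm : 0 < m) (hn : 0 < n) (hN : N = 1 + m + n) {j : ℕ} (hj : 1 ≤ j) :
    IntegrableOn (fun t : ℝ => (t : ℂ) ^ (j - 1) * fInf m n (Complex.I * t)) (Set.Ioi 0) ∧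
      ∫ t in Set.Ioi (0 : ℝ), (t : ℂ) ^ (j - 1) * fInf m n (Complex.I * t) =
      Complex.Gamma j / (2 * Real.pi) ^ j *
        ((∑' e : ℕ, 1 / ((e : ℂ) + 1) ^ (j + 1)) * weightSum m n fun k => residueSum N k j) := by
  obtain ⟨i1, v1⟩ := mellin_gPoch_sub (k := 1) (N := N) one_pos (by omega) hj
  obtain ⟨im, vm⟩ := mellin_gPoch_sub (N := N) hm (by omega) hj
  obtain ⟨iN, vn⟩ := mellin_gPoch_sub (N := N) hn (by omega) hj
  have e : Set.EqOn (fun t : ℝ => (t : ℂ) ^ (j - 1) * fInf m n (Complex.I * t)) (fun t =>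
      (t : ℂ) ^ (j - 1) * (gPoch (N - 1) N (Complex.I * t) - gPoch 1 N (Complex.I * t)) +
      (t : ℂ) ^ (j - 1) * (gPoch (N - m) N (Complex.I * t) - gPoch m N (Complex.I * t)) +
      (t : ℂ) ^ (j - 1) * (gPoch (N - n) N (Complex.I * t) - gPoch n N (Complex.I * t)))
      (Set.Ioi 0) := by
    intro t ht
    simp only
    rw [fInf_eq hm hn hN (im_I_mul_pos ht), weightSum]
    ring
  refine ⟨((i1.add im).add iN).congr_fun e.symm measurableSet_Ioi, ?_⟩
  have i12 : IntegrableOn (fun t : ℝ =>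
      (t : ℂ) ^ (j - 1) * (gPoch (N - 1) N (Complex.I * t) - gPoch 1 N (Complex.I * t)) +
      (t : ℂ) ^ (j - 1) * (gPoch (N - m) N (Complex.I * t) - gPoch m N (Complex.I * t)))
      (Set.Ioi 0) := i1.add im
  rw [setIntegral_congr_fun measurableSet_Ioi e, integral_add i12 iN, integral_add i1 im,
    v1, vm, vn, weightSum]
  ring

end StrongWeak

namespace StrongWeak

/-! ### The series, their expansions and their discontinuities -/

variable {m n N : ℕ}

lemma exp_neg_eq_rootPow {k N : ℕ} (hkN : k ≤ N) (hN : 0 < N) :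
    Complex.exp (-(2 * Real.pi * Complex.I * k / N)) = rootPow N (N - k) := by
  rw [rootPow_sub hkN hN, Complex.exp_neg, rootPow]

theorem weak_expansion (hm : 0 < m) (hn : 0 < n) (hN : N = 1 + m + n) :
    HasAsymptoticExpansion
      (fun ħ : ℂ => logSpecTrace m n (N * ħ / (2 * Real.pi))
        - (Real.log (Real.Gamma (n / N) * Real.Gamma (m / N) * Real.Gamma (1 / N)
              / (4 * Real.pi ^ 2)) : ℂ)
        + Complex.log (N * ħ / (2 * Real.pi)))
      (phiTrace m n) := by
  have hr : (0 : ℝ) < N / (2 * Real.pi) :=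
    div_pos (by exact_mod_cast (by omega : 0 < N)) (by positivity)
  have h := (logSpecTrace_weak hm hn hN).comp_mul hr
  have e : PowerSeries.rescale (((N / (2 * Real.pi) : ℝ)) : ℂ)
      (-phiSeries (N - 1) N - phiSeries (N - m) N + phiSeries n N) = phiTrace m n := by
    subst hN
    rw [phiTrace]
    push_cast
    rfl
  rw [e] at h
  refine h.congr fun ħ _ => ?_
  rw [show (((N / (2 * Real.pi) : ℝ)) : ℂ) * ħ = N * ħ / (2 * Real.pi) by push_cast; ring]

lemma psiTrace_eq (hN : N = 1 + m + n) :
    psiTrace m n = -psiSeries (N - 1) N - psiSeries (N - m) N + psiSeries n N := by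
  subst hN; rfl

theorem strong_expansion (hm : 0 < m) (hn : 0 < n) (hN : N = 1 + m + n) :
    HasAsymptoticExpansion
      (fun τ : ℂ => logSpecTrace m n (-1 / τ)
        - (Real.pi * Complex.I / (12 * (-1 / τ))
          + Real.pi * Complex.I * (-1 / τ)
            * ((dilog (Complex.exp (2 * Real.pi * Complex.I * n / N))
                - dilog (Complex.exp (-(2 * Real.pi * Complex.I * m / N)))
                - dilog (Complex.exp (-(2 * Real.pi * Complex.I / N)))) / (2 * Real.pi ^ 2)
              - m / N ^ 2 + 1 / 12))
        + (Real.log (2 * √(2 * Real.sin (Real.pi * n / N) * Real.sin (Real.pi * m / N)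
              * Real.sin (Real.pi / N))) : ℂ)
        + Complex.log (-1 / τ) / 2)
      (psiTrace m n) := by
  have e1 : Complex.exp (-(2 * Real.pi * Complex.I / N)) = rootPow N (N - 1) := by
    rw [← exp_neg_eq_rootPow (by omega) (by omega), Nat.cast_one, mul_one]
  rw [exp_neg_eq_rootPow (by omega) (by omega), e1, psiTrace_eq hN]
  exact logSpecTrace_strong hm hn hN

theorem fInf_expansion (hm : 0 < m) (hn : 0 < n) (hN : N = 1 + m + n) :
    HasAsymptoticExpansion
      (fun ħ : ℂ => fInf m n (ħ / (2 * Real.pi)) + Complex.log (-(Complex.I * N * ħ))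
        - weightSum m n (fun k =>
            (Real.log (Real.Gamma (k / N) / Real.Gamma (1 - k / N)) : ℂ)))
      (2 • phiTrace m n) := by
  have hN0 : (0 : ℝ) < N := by exact_mod_cast (by omega : 0 < N)
  have hNc : (N : ℂ) ≠ 0 := by exact_mod_cast hN0.ne'
  have hpi : (Real.pi : ℂ) ≠ 0 := by exact_mod_cast Real.pi_ne_zero
  have hr : (0 : ℝ) < N / (2 * Real.pi) := by positivity
  have h := (gPoch_sub_sub_hasAsymptoticExpansion hm hn hN).comp_mul hr
  have e : PowerSeries.rescale (((N / (2 * Real.pi) : ℝ)) : ℂ)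
      (2 • (-phiSeries (N - 1) N - phiSeries (N - m) N + phiSeries n N)) =
        2 • phiTrace m n := by
    rw [map_nsmul]
    subst hN
    rw [phiTrace]
    push_cast
    rfl
  rw [e] at h
  refine h.congr fun ħ hħ => ?_
  have him : 0 < (ħ / (2 * Real.pi)).im := by
    rw [show ħ / (2 * Real.pi) = ħ / ((2 * Real.pi : ℝ) : ℂ) by push_cast; rfl,
      Complex.div_ofReal_im]
    positivity
  rw [fInf_eq hm hn hN him]
  rw [show (((N / (2 * Real.pi) : ℝ)) : ℂ) * ħ / N = ħ / (2 * Real.pi) by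
      push_cast; field_simp,
    show 2 * Real.pi * Complex.I * ((((N / (2 * Real.pi) : ℝ)) : ℂ) * ħ) = Complex.I * N * ħ by
      push_cast; field_simp]

theorem fZero_expansion (hm : 0 < m) (hn : 0 < n) (hN : N = 1 + m + n) :
    HasAsymptoticExpansion
      (fun τ : ℂ => fZero m n τ + Real.pi * Complex.I / 2
        + weightSum m n (fun k =>
            ((dilog (Complex.exp (2 * Real.pi * Complex.I * k / N))).im : ℂ)) / (Real.pi * τ))
      (-(2 • psiTrace m n) + PowerSeries.C (Real.pi * Complex.I / 6) * PowerSeries.X) := by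
  rw [psiTrace_eq hN]
  refine (fPoch_sub_sub_hasAsymptoticExpansion hm hn hN).congr fun τ hτ => ?_
  rw [fZero_eq hm hn hN hτ]
  rfl

lemma xiPole_eq (hN : N = 1 + m + n) (l : ℤ) :
    xiPole m n l = ((4 * Real.pi ^ 2 / N * l : ℝ) : ℂ) * Complex.I := by
  subst hN
  rw [xiPole]
  push_cast
  ring

lemma etaPole_eq (hN : N = 1 + m + n) (l : ℤ) :
    etaPole m n l = ((2 * Real.pi / N * l : ℝ) : ℂ) * Complex.I := by
  subst hN
  rw [etaPole]
  push_cast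
  ring

lemma im_neg_div_pos {a b : ℝ} (ha : 0 < a) (hb : 0 < b) {y : ℂ} (hy : 0 < y.im) :
    0 < (-(a : ℂ) / (b * y)).im := by
  have h : -(a : ℂ) / (b * y) = ((a / b : ℝ) : ℂ) * (-1 / y) := by
    push_cast
    have := ne_zero_of_im_pos hy
    have : (b : ℂ) ≠ 0 := by exact_mod_cast hb.ne'
    field_simp
  rw [h, Complex.im_ofReal_mul]
  exact mul_pos (div_pos ha hb) (im_neg_one_div_pos hy)

lemma im_neg_two_pi_div_pos (hN : N = 1 + m + n) {y : ℂ} (hy : 0 < y.im) :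
    0 < (-(2 * Real.pi) / (N * y)).im := by
  have h := im_neg_div_pos (a := 2 * Real.pi) (b := N) (by positivity)
    (by exact_mod_cast (by omega : 0 < N)) hy
  push_cast at h
  exact h

lemma im_neg_one_div_mul_pos (hN : N = 1 + m + n) {y : ℂ} (hy : 0 < y.im) :
    0 < (-1 / (N * y)).im := by
  have h := im_neg_div_pos (a := 1) (b := N) one_pos
    (by exact_mod_cast (by omega : 0 < N)) hy
  push_cast at h
  exact h

theorem hasSum_xiPole (hm : 0 < m) (hn : 0 < n) (hN : N = 1 + m + n) {ħ : ℂ} (hħ : 0 < ħ.im) :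
    HasSum (fun l : ℕ => stokesS m n ((l : ℤ) + 1) *
      Complex.exp (-xiPole m n ((l : ℤ) + 1) / ħ)) (fZero m n (-(2 * Real.pi) / (N * ħ))) := by
  have him := im_neg_two_pi_div_pos hN hħ
  have h := hasSum_stokesS hm hn hN him
  rw [← fZero_eq hm hn hN him] at h
  refine h.congr_fun fun l => ?_
  rw [xiPole_eq hN]
  congr 2
  push_cast
  ring

theorem hasSum_etaPole (hm : 0 < m) (hn : 0 < n) (hN : N = 1 + m + n) {τ : ℂ} (hτ : 0 < τ.im) :
    HasSum (fun l : ℕ => stokesR m n ((l : ℤ) + 1) *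
      Complex.exp (-etaPole m n ((l : ℤ) + 1) / τ)) (fInf m n (-1 / (N * τ))) := by
  have him := im_neg_one_div_mul_pos hN hτ
  have h := hasSum_stokesR hm hn hN him
  rw [← fInf_eq hm hn hN him] at h
  refine h.congr_fun fun l => ?_
  rw [etaPole_eq hN]
  congr 2
  push_cast
  ring

/-- The parameters c and z cover at once the discontinuity of the series itself and that of the
doubled series in the dual expansion. -/
theorem hasDiscontinuity_mul_phiTrace_add (hm : 0 < m) (hn : 0 < n) (hN : N = 1 + m + n)
    (c z : ℂ) {ħ : ℂ} (hħ : 0 < ħ.im) :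
    HasDiscontinuity (PowerSeries.C c * phiTrace m n + PowerSeries.C z * PowerSeries.X)
      (Real.pi / 2) ħ (c * fZero m n (-(2 * Real.pi) / (N * ħ))) := by
  refine ((mittagLefflerData_phiTrace hm hn hN).const_mul_add_linear c z).hasDiscontinuity hħ ?_
  refine ((hasSum_xiPole hm hn hN hħ).mul_left c).congr_fun fun l => ?_
  rw [xiPole_eq hN, mul_assoc]
  push_cast
  rfl

theorem hasDiscontinuity_mul_psiTrace_add (hm : 0 < m) (hn : 0 < n) (hN : N = 1 + m + n)
    (c z : ℂ) {τ : ℂ} (hτ : 0 < τ.im) :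
    HasDiscontinuity (PowerSeries.C c * psiTrace m n + PowerSeries.C z * PowerSeries.X)
      (Real.pi / 2) τ (c * fInf m n (-1 / (N * τ))) := by
  refine ((mittagLefflerData_psiTrace hm hn hN).const_mul_add_linear c z).hasDiscontinuity hτ ?_
  refine ((hasSum_etaPole hm hn hN hτ).mul_left c).congr_fun fun l => ?_
  rw [etaPole_eq hN, mul_assoc]
  push_cast
  rfl

/-! ### Large-order relations -/

theorem mellin_fInf_tendsto (hm : 0 < m) (hn : 0 < n) {j : ℕ} (hj : 1 ≤ j) :
    Tendsto (fun L : ℕ => ∑ l ∈ Finset.range L,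
        stokesR m n ((l : ℤ) + 1) / ((l : ℂ) + 1) ^ j) atTop
      (𝓝 ((2 * Real.pi) ^ j / Complex.Gamma j *
        ∫ t in Set.Ioi (0 : ℝ), (t : ℂ) ^ (j - 1) * fInf m n (Complex.I * t))) := by
  have h := tendsto_sum_stokesR hm hn rfl hj
  rw [(mellin_fInf hm hn rfl hj).2]
  have hG : (Complex.Gamma j : ℂ) ≠ 0 := by
    rw [← Complex.ofReal_natCast, Complex.Gamma_ofReal]
    exact_mod_cast (Real.Gamma_pos_of_pos (by exact_mod_cast (by omega : 0 < j))).ne'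
  have hpi : (Real.pi : ℂ) ≠ 0 := by exact_mod_cast Real.pi_ne_zero
  convert h using 2
  field_simp

lemma gamma_two_mul {j : ℕ} (hj : 1 ≤ j) : Complex.Gamma (2 * j) = (2 * j - 1).factorial := by
  rw [← Complex.Gamma_nat_eq_factorial, Nat.cast_sub (by omega)]
  push_cast
  ring_nf

lemma gamma_two_mul_sub_one {j : ℕ} (hj : 1 ≤ j) :
    Complex.Gamma (2 * j - 1) = (2 * j - 2).factorial := by
  rw [← Complex.Gamma_nat_eq_factorial, Nat.cast_sub (by omega)]
  push_cast
  ring_nf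

theorem hasSum_coeff_phiTrace (hm : 0 < m) (hn : 0 < n) {j : ℕ} (hj : 1 ≤ j) :
    HasSum (fun l : ℕ => Complex.Gamma (2 * j) / (Real.pi * Complex.I) *
        (stokesS m n ((l : ℤ) + 1) / xiPole m n ((l : ℤ) + 1) ^ (2 * j)))
      (PowerSeries.coeff (2 * j) (phiTrace m n)) := by
  obtain ⟨N, hN⟩ : ∃ N, N = 1 + m + n := ⟨_, rfl⟩
  have hNc : (N : ℂ) ≠ 0 := by exact_mod_cast (by omega : N ≠ 0)
  have hpi : (Real.pi : ℂ) ≠ 0 := by exact_mod_cast Real.pi_ne_zero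
  have hf : ((2 * j - 1).factorial : ℂ) ≠ 0 := by exact_mod_cast Nat.factorial_ne_zero _
  have h := (hasSum_stokesS_div_pow hm hn hN hj).mul_left (Complex.Gamma (2 * j) /
    (Real.pi * Complex.I) / (4 * Real.pi ^ 2 * Complex.I / N) ^ (2 * j))
  have hx : (4 * Real.pi ^ 2 * Complex.I / N : ℂ) ^ (2 * j) ≠ 0 :=
    pow_ne_zero _ (by simp [hNc, hpi])
  rw [gamma_two_mul hj] at h ⊢
  have e : ((2 * j - 1).factorial : ℂ) / (Real.pi * Complex.I) /
      (4 * Real.pi ^ 2 * Complex.I / N) ^ (2 * j) *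
      (Real.pi * Complex.I / (2 * j - 1).factorial * (4 * Real.pi ^ 2 * Complex.I / N) ^ (2 * j) *
        PowerSeries.coeff (2 * j) (phiTrace m n)) = PowerSeries.coeff (2 * j) (phiTrace m n) := by
    generalize (4 * Real.pi ^ 2 * Complex.I / N : ℂ) ^ (2 * j) = x at hx ⊢
    field_simp
  rw [e] at h
  refine h.congr_fun fun l => ?_
  rw [xiPole, ← hN, mul_pow]
  push_cast
  generalize (4 * Real.pi ^ 2 * Complex.I / N : ℂ) ^ (2 * j) = x
  simp only [div_eq_mul_inv, mul_inv]
  ring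

theorem tendsto_coeff_psiTrace (hm : 0 < m) (hn : 0 < n) {j : ℕ} (hj : 1 ≤ j) :
    Tendsto (fun L : ℕ => Complex.Gamma (2 * j - 1) / (Real.pi * Complex.I) *
        ∑ l ∈ Finset.range L,
          stokesR m n ((l : ℤ) + 1) / etaPole m n ((l : ℤ) + 1) ^ (2 * j - 1)) atTop
      (𝓝 (PowerSeries.coeff (2 * j - 1) (psiTrace m n)
        - if j = 1 then Real.pi * Complex.I / 12 else 0)) := by
  obtain ⟨N, hN⟩ : ∃ N, N = 1 + m + n := ⟨_, rfl⟩
  have hNc : (N : ℂ) ≠ 0 := by exact_mod_cast (by omega : N ≠ 0)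
  have hpi : (Real.pi : ℂ) ≠ 0 := by exact_mod_cast Real.pi_ne_zero
  have hf : ((2 * j - 2).factorial : ℂ) ≠ 0 := by exact_mod_cast Nat.factorial_ne_zero _
  have h := (tendsto_sum_stokesR_div_pow hm hn hN hj).const_mul (Complex.Gamma (2 * j - 1) /
    (Real.pi * Complex.I) / (2 * Real.pi * Complex.I / N) ^ (2 * j - 1))
  have hx : (2 * Real.pi * Complex.I / N : ℂ) ^ (2 * j - 1) ≠ 0 :=
    pow_ne_zero _ (by simp [hNc, hpi])
  rw [gamma_two_mul_sub_one hj] at h ⊢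
  generalize PowerSeries.coeff (2 * j - 1) (psiTrace m n)
        - (if j = 1 then Real.pi * Complex.I / 12 else 0) = c at h ⊢
  have e : ((2 * j - 2).factorial : ℂ) / (Real.pi * Complex.I) /
      (2 * Real.pi * Complex.I / N) ^ (2 * j - 1) *
      (Real.pi * Complex.I / (2 * j - 2).factorial * (2 * Real.pi * Complex.I / N) ^ (2 * j - 1) *
        c) = c := by
    generalize (2 * Real.pi * Complex.I / N : ℂ) ^ (2 * j - 1) = x at hx ⊢
    field_simp
  rw [e] at h
  refine h.congr fun L => ?_
  rw [Finset.mul_sum, Finset.mul_sum]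
  refine Finset.sum_congr rfl fun l _ => ?_
  rw [etaPole, ← hN, mul_pow]
  push_cast
  generalize (2 * Real.pi * Complex.I / N : ℂ) ^ (2 * j - 1) = x
  simp only [div_eq_mul_inv, mul_inv]
  ring

/-- The Dirichlet series of the Stokes constants is evaluated twice, as a coefficient and as a
Mellin transform; equating the two eliminates it. -/
theorem coeff_phiTrace_eq_integral (hm : 0 < m) (hn : 0 < n) (hN : N = 1 + m + n) {j : ℕ}
    (hj : 1 ≤ j) :
    PowerSeries.coeff (2 * j) (phiTrace m n) =
      1 / (Real.pi * Complex.I) * (N / (2 * Real.pi * Complex.I)) ^ (2 * j) *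
        ∫ t in Set.Ioi (0 : ℝ), (t : ℂ) ^ (2 * j - 1) * fZero m n (Complex.I * t) := by
  have hNc : (N : ℂ) ≠ 0 := by exact_mod_cast (by omega : N ≠ 0)
  have hpi : (Real.pi : ℂ) ≠ 0 := by exact_mod_cast Real.pi_ne_zero
  have hf : ((2 * j - 1).factorial : ℂ) ≠ 0 := by exact_mod_cast Nat.factorial_ne_zero _
  have h := (hasSum_stokesS_div_pow hm hn hN hj).unique (mellin_fZero hm hn (by omega)).2
  push_cast at h
  rw [gamma_two_mul hj] at h
  generalize (∫ t in Set.Ioi (0 : ℝ), (t : ℂ) ^ (2 * j - 1) * fZero m n (Complex.I * t)) = w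
    at h ⊢
  have ex : (4 * Real.pi ^ 2 * Complex.I / N : ℂ) ^ (2 * j) * (N / (2 * Real.pi * Complex.I)) ^ (2 * j)
      = (2 * Real.pi) ^ (2 * j) := by
    rw [← mul_pow]
    congr 1
    field_simp
    ring
  have hx : (4 * Real.pi ^ 2 * Complex.I / N : ℂ) ^ (2 * j) ≠ 0 :=
    pow_ne_zero _ (by simp [hNc, hpi])
  rw [← ex] at h
  generalize (4 * Real.pi ^ 2 * Complex.I / N : ℂ) ^ (2 * j) = x at hx h
  generalize (N / (2 * Real.pi * Complex.I) : ℂ) ^ (2 * j) = x' at h ⊢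
  field_simp at h ⊢
  linear_combination h

theorem coeff_psiTrace_eq_integral (hm : 0 < m) (hn : 0 < n) (hN : N = 1 + m + n) {j : ℕ}
    (hj : 1 ≤ j) :
    PowerSeries.coeff (2 * j - 1) (psiTrace m n) =
      1 / (Real.pi * Complex.I) * (N / Complex.I) ^ (2 * j - 1) *
        (∫ t in Set.Ioi (0 : ℝ), (t : ℂ) ^ (2 * j - 2) * fInf m n (Complex.I * t))
      + if j = 1 then Real.pi * Complex.I / 12 else 0 := by
  have hNc : (N : ℂ) ≠ 0 := by exact_mod_cast (by omega : N ≠ 0)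
  have hpi : (Real.pi : ℂ) ≠ 0 := by exact_mod_cast Real.pi_ne_zero
  have hf : ((2 * j - 2).factorial : ℂ) ≠ 0 := by exact_mod_cast Nat.factorial_ne_zero _
  have h := tendsto_nhds_unique (tendsto_sum_stokesR_div_pow hm hn hN hj)
    (mellin_fInf_tendsto hm hn (by omega))
  rw [Nat.cast_sub (by omega)] at h
  push_cast at h
  rw [gamma_two_mul_sub_one hj, show 2 * j - 1 - 1 = 2 * j - 2 by omega] at h
  rw [← sub_eq_iff_eq_add]
  generalize (∫ t in Set.Ioi (0 : ℝ), (t : ℂ) ^ (2 * j - 2) * fInf m n (Complex.I * t)) = w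
    at h ⊢
  generalize PowerSeries.coeff (2 * j - 1) (psiTrace m n)
        - (if j = 1 then Real.pi * Complex.I / 12 else 0) = c at h ⊢
  have ex : (2 * Real.pi * Complex.I / N : ℂ) ^ (2 * j - 1) * (N / Complex.I) ^ (2 * j - 1)
      = (2 * Real.pi) ^ (2 * j - 1) := by
    rw [← mul_pow]
    congr 1
    field_simp
  have hx : (2 * Real.pi * Complex.I / N : ℂ) ^ (2 * j - 1) ≠ 0 :=
    pow_ne_zero _ (by simp [hNc, hpi])
  rw [← ex] at h
  generalize (2 * Real.pi * Complex.I / N : ℂ) ^ (2 * j - 1) = x at hx h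
  generalize (N / Complex.I : ℂ) ^ (2 * j - 1) = x' at h ⊢
  field_simp at h ⊢
  linear_combination h

end StrongWeak

/-! ### The strong–weak resurgent symmetry. -/

theorem theorem1p6 (m n N : ℕ) (hm : 0 < m) (hn : 0 < n) (hN : N = 1 + m + n) :
    -- The spectral trace and its expansions at weak and strong coupling.
    (∀ y : ℂ, 0 < y.im → Complex.exp (logSpecTrace m n y) = specTrace m n y) ∧
    HasAsymptoticExpansion
      (fun ħ : ℂ => logSpecTrace m n (N * ħ / (2 * Real.pi))
        - (Real.log (Real.Gamma (n / N) * Real.Gamma (m / N) * Real.Gamma (1 / N)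
              / (4 * Real.pi ^ 2)) : ℂ)
        + Complex.log (N * ħ / (2 * Real.pi)))
      (phiTrace m n) ∧
    HasAsymptoticExpansion
      (fun τ : ℂ => logSpecTrace m n (-1 / τ)
        - (Real.pi * Complex.I / (12 * (-1 / τ))
          + Real.pi * Complex.I * (-1 / τ)
            * ((dilog (Complex.exp (2 * Real.pi * Complex.I * n / N))
                - dilog (Complex.exp (-(2 * Real.pi * Complex.I * m / N)))
                - dilog (Complex.exp (-(2 * Real.pi * Complex.I / N)))) / (2 * Real.pi ^ 2)
              - m / N ^ 2 + 1 / 12))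
        + (Real.log (2 * √(2 * Real.sin (Real.pi * n / N) * Real.sin (Real.pi * m / N)
              * Real.sin (Real.pi / N))) : ℂ)
        + Complex.log (-1 / τ) / 2)
      (psiTrace m n) ∧
    -- Resurgence: from each series to its tower of simple poles and Stokes constants.
    (IsGevreyOne (phiTrace m n) ∧ HasStokesTower (phiTrace m n) (xiPole m n) (stokesS m n)) ∧
    (IsGevreyOne (psiTrace m n) ∧ HasStokesTower (psiTrace m n) (etaPole m n) (stokesR m n)) ∧
    -- The discontinuities are the generating series of the Stokes constants, and are
    -- sums of `q`-Pochhammer symbols.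
    (∀ ħ : ℂ, 0 < ħ.im →
      HasDiscontinuity (phiTrace m n) (Real.pi / 2) ħ (fZero m n (-(2 * Real.pi) / (N * ħ))) ∧
      HasSum (fun l : ℕ => stokesS m n ((l : ℤ) + 1) *
          Complex.exp (-xiPole m n ((l : ℤ) + 1) / ħ)) (fZero m n (-(2 * Real.pi) / (N * ħ))) ∧
      fZero m n (-(2 * Real.pi) / (N * ħ)) =
        weightSum m n (fun k => fPoch (N - k) N (-(2 * Real.pi) / (N * ħ))
          - fPoch k N (-(2 * Real.pi) / (N * ħ))) - Real.pi * Complex.I) ∧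
    (∀ τ : ℂ, 0 < τ.im →
      HasDiscontinuity (psiTrace m n) (Real.pi / 2) τ (fInf m n (-1 / (N * τ))) ∧
      HasSum (fun l : ℕ => stokesR m n ((l : ℤ) + 1) *
          Complex.exp (-etaPole m n ((l : ℤ) + 1) / τ)) (fInf m n (-1 / (N * τ))) ∧
      fInf m n (-1 / (N * τ)) =
        weightSum m n (fun k => gPoch (N - k) N (-1 / (N * τ)) - gPoch k N (-1 / (N * τ)))) ∧
    -- The asymptotic expansion of each discontinuity is governed by the dual series: the
    -- discontinuity of `ψ` at `τ = -2π/(Nħ)` as `ħ → 0`, and that of `φ` at `ħ = -2π/(Nτ)`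
    -- as `τ → 0`.
    HasAsymptoticExpansion
      (fun ħ : ℂ => fInf m n (ħ / (2 * Real.pi)) + Complex.log (-(Complex.I * N * ħ))
        - weightSum m n (fun k =>
            (Real.log (Real.Gamma (k / N) / Real.Gamma (1 - k / N)) : ℂ)))
      (2 • phiTrace m n) ∧
    HasAsymptoticExpansion
      (fun τ : ℂ => fZero m n τ + Real.pi * Complex.I / 2
        + weightSum m n (fun k =>
            ((dilog (Complex.exp (2 * Real.pi * Complex.I * k / N))).im : ℂ)) / (Real.pi * τ))
      (-(2 • psiTrace m n) + PowerSeries.C (Real.pi * Complex.I / 6) * PowerSeries.X) ∧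
    -- The discontinuity of the expansion of each generating function is the other one.
    (∀ ħ : ℂ, 0 < ħ.im →
      HasDiscontinuity (2 • phiTrace m n) (Real.pi / 2) ħ
        (2 * fZero m n (-(2 * Real.pi) / (N * ħ)))) ∧
    (∀ τ : ℂ, 0 < τ.im →
      HasDiscontinuity
        (-(2 • psiTrace m n) + PowerSeries.C (Real.pi * Complex.I / 6) * PowerSeries.X)
        (Real.pi / 2) τ (-2 * fInf m n (-1 / (N * τ)))) ∧
    -- Mellin transforms of the discontinuities.
    (∀ j : ℕ, 2 ≤ j →
      IntegrableOn (fun t : ℝ => (t : ℂ) ^ (j - 1) * fZero m n (Complex.I * t)) (Set.Ioi 0) ∧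
      HasSum (fun l : ℕ => stokesS m n ((l : ℤ) + 1) / ((l : ℂ) + 1) ^ j)
        ((2 * Real.pi) ^ j / Complex.Gamma j *
          ∫ t in Set.Ioi (0 : ℝ), (t : ℂ) ^ (j - 1) * fZero m n (Complex.I * t))) ∧
    (∀ j : ℕ, 1 ≤ j →
      IntegrableOn (fun t : ℝ => (t : ℂ) ^ (j - 1) * fInf m n (Complex.I * t)) (Set.Ioi 0) ∧
      Filter.Tendsto (fun L : ℕ => ∑ l ∈ Finset.range L,
          stokesR m n ((l : ℤ) + 1) / ((l : ℂ) + 1) ^ j) Filter.atTop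
        (nhds ((2 * Real.pi) ^ j / Complex.Gamma j *
          ∫ t in Set.Ioi (0 : ℝ), (t : ℂ) ^ (j - 1) * fInf m n (Complex.I * t)))) ∧
    -- Exact large-order relations.
    (∀ j : ℕ, PowerSeries.coeff (2 * j + 1) (phiTrace m n) = 0) ∧
    (∀ j : ℕ, 1 ≤ j →
      HasSum (fun l : ℕ => Complex.Gamma (2 * j) / (Real.pi * Complex.I) *
          (stokesS m n ((l : ℤ) + 1) / xiPole m n ((l : ℤ) + 1) ^ (2 * j)))
        (PowerSeries.coeff (2 * j) (phiTrace m n))) ∧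
    (∀ j : ℕ, PowerSeries.coeff (2 * j) (psiTrace m n) = 0) ∧
    (∀ j : ℕ, 1 ≤ j →
      Filter.Tendsto (fun L : ℕ => Complex.Gamma (2 * j - 1) / (Real.pi * Complex.I) *
          ∑ l ∈ Finset.range L,
            stokesR m n ((l : ℤ) + 1) / etaPole m n ((l : ℤ) + 1) ^ (2 * j - 1)) Filter.atTop
        (nhds (PowerSeries.coeff (2 * j - 1) (psiTrace m n)
          - if j = 1 then Real.pi * Complex.I / 12 else 0))) ∧
    -- Hence each series is recovered from its discontinuity along the imaginary axis.
    (∀ j : ℕ, 1 ≤ j →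
      PowerSeries.coeff (2 * j) (phiTrace m n) =
        1 / (Real.pi * Complex.I) * (N / (2 * Real.pi * Complex.I)) ^ (2 * j) *
          ∫ t in Set.Ioi (0 : ℝ), (t : ℂ) ^ (2 * j - 1) * fZero m n (Complex.I * t)) ∧
    (∀ j : ℕ, 1 ≤ j →
      PowerSeries.coeff (2 * j - 1) (psiTrace m n) =
        1 / (Real.pi * Complex.I) * (N / Complex.I) ^ (2 * j - 1) *
          (∫ t in Set.Ioi (0 : ℝ), (t : ℂ) ^ (2 * j - 2) * fInf m n (Complex.I * t))
        + if j = 1 then Real.pi * Complex.I / 12 else 0) := by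
  have hphi (ħ : ℂ) (hħ : 0 < ħ.im) (c z : ℂ) :=
    hasDiscontinuity_mul_phiTrace_add hm hn hN c z hħ
  have hpsi (τ : ℂ) (hτ : 0 < τ.im) (c z : ℂ) :=
    hasDiscontinuity_mul_psiTrace_add hm hn hN c z hτ
  have hφ := mittagLefflerData_phiTrace hm hn hN
  have hψ := mittagLefflerData_psiTrace hm hn hN
  refine ⟨fun y hy => exp_logSpecTrace hm hn hy, weak_expansion hm hn hN,
    strong_expansion hm hn hN, ⟨hφ.isGevreyOne, hφ.hasStokesTower (xiPole_eq hN)⟩,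
    ⟨hψ.isGevreyOne, hψ.hasStokesTower (etaPole_eq hN)⟩,
    fun ħ hħ => ⟨by simpa using hphi ħ hħ 1 0, hasSum_xiPole hm hn hN hħ,
      fZero_eq hm hn hN (im_neg_two_pi_div_pos hN hħ)⟩,
    fun τ hτ => ⟨by simpa using hpsi τ hτ 1 0, hasSum_etaPole hm hn hN hτ,
      fInf_eq hm hn hN (im_neg_one_div_mul_pos hN hτ)⟩,
    fInf_expansion hm hn hN, fZero_expansion hm hn hN, fun ħ hħ => ?_, fun τ hτ => ?_,
    fun j hj => mellin_fZero hm hn hj,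
    fun j hj => ⟨(mellin_fInf hm hn hN hj).1, mellin_fInf_tendsto hm hn hj⟩,
    fun j => coeff_phiTrace_odd hm hn ⟨j, rfl⟩, fun j hj => hasSum_coeff_phiTrace hm hn hj,
    fun j => coeff_psiTrace_even hm hn (even_two_mul j),
    fun j hj => tendsto_coeff_psiTrace hm hn hj,
    fun j hj => coeff_phiTrace_eq_integral hm hn hN hj,
    fun j hj => coeff_psiTrace_eq_integral hm hn hN hj⟩
  · have h := hphi ħ hħ 2 0
    rwa [map_zero, zero_mul, add_zero, map_ofNat, two_mul, ← two_nsmul] at h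
  · have h := hpsi τ hτ (-2) (Real.pi * Complex.I / 6)
    rwa [map_neg, map_ofNat, neg_mul, two_mul, ← two_nsmul] at h
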